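/- Let $A$ be a symmetric $2\times2$ matrix with integer entries such that the quadratic form $Q(\nu)=\tfrac12\nu^tA\nu$ on $\mathbb{R}^2$ has signature $(1,1)$, and let $B(\nu,\mu)=\nu^tA\mu$. Fix one of the two components $C_Q$ of $\{c\in\mathbb{R}^2: Q(c)=-1\}$; if $c_0\in C_Q$, then $C_Q=\{c: Q(c)=-1,\ B(c,c_0)<0\}$. Fix $P\in\mathrm{GL}_2(\mathbb{R})$ with $Q(\nu)=(P\nu)_1(P\nu)_2$ for all $\nu\in\mathbb{R}^2$ and $P^{-1}\binom{1}{-1}\in C_Q$. Put $c(t)=P^{-1}\binom{e^t}{-e^{-t}}$ and $c^\perp(t)=P^{-1}\binom{e^t}{e^{-t}}$; the map $t\mapsto c(t)$ parametrizes $C_Q$. For $c_i\in C_Q$ let $t_i$ be the real number with $c(t_i)=c_i$, and put $c_i^\perp=c^\perp(t_i)$. Let $K_0(x)=\int_0^\infty e^{-x\cosh t}\,dt$ for $x>0$, and let $\operatorname{sgn}(0)=0$. A function $m:\mathbb{Z}^2\to\mathbb{C}$ is called periodic if there is an integer $L\neq0$ with $m(\nu+\mu)=m(\nu)$ for all $\nu\in\mathbb{Z}^2$,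 $\mu\in L\mathbb{Z}^2$. For $c_1,c_2\in C_Q$, a periodic $m$ such that $Q$ is non-zero on the support of $m$, and $\tau=x+iy$ in the upper half-plane $\mathbb{H}$, let $$\begin{aligned}\Phi_m^{c_1,c_2}(\tau)=\ &\operatorname{sgn}(t_2-t_1)\,y^{1/2}\sum_{\nu\in\mathbb{Z}^2}\tfrac12\bigl[1-\operatorname{sgn}(B(\nu,c_1)B(\nu,c_2))\bigr]m(\nu)e^{2\pi iQ(\nu)x}K_0(2\pi Q(\nu)y)\\&+\operatorname{sgn}(t_2-t_1)\,y^{1/2}\sum_{\nu\in\mathbb{Z}^2}\tfrac12\bigl[1-\operatorname{sgn}(B(\nu,c_1^\perp)B(\nu,c_2^\perp))\bigr]m(\nu)e^{2\pi iQ(\nu)x}K_0(-2\pi Q(\nu)y),\end{aligned}$$ where terms whose bracket or whose $m(\nu)$ vanishes are read as $0$. Let $$\mathrm{Aut}^+(Q,\mathbb{Z}^2)=\{\gamma\in\mathrm{GL}_2(\mathbb{R}): Q\circ\gamma=Q,\ \gamma\mathbb{Z}^2=\mathbb{Z}^2,\ \gamma C_Q=C_Q,\ \det\gamma=1\}.$$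 Let $\{(m_j,\gamma_j)\}$ be a finite collection, where each $m_j$ is a periodic function on $\mathbb{Z}^2$ such that $Q$ is non-zero on its support, and $\gamma_j\in\mathrm{Aut}^+(Q,\mathbb{Z}^2)$, with $$\sum_j(m_j-m_j\circ\gamma_j)=0.$$ Then for every $c\in C_Q$ the series that define the functions $\Phi_{m_j}^{c,\gamma_jc}$ converge absolutely, and $f=\sum_j\Phi_{m_j}^{c,\gamma_jc}$ is a Maass form of weight $0$ with eigenvalue $1/4$ on some subgroup of finite index $\Gamma\subset\mathrm{SL}_2(\mathbb{Z})$ with some multiplier system $v$. That is: $v:\Gamma\to\{z\in\mathbb{C}:|z|=1\}$ is a homomorphism with $v(-I)=1$ if $-I\in\Gamma$; $f$ is a smooth function on $\mathbb{H}$; $f(g\tau)=v(g)f(\tau)$ for all $g\in\Gamma$, $\tau\in\mathbb{H}$; $\Delta_0f=\tfrac14f$, where $\Delta_0=-y^2\bigl(\frac{\partial^2}{\partial x^2}+\frac{\partial^2}{\partial y^2}\bigr)$; and $f$ has moderate growth at the cusps: for every $\sigma\in\mathrm{SL}_2(\mathbb{Z})$ there is $k\in\mathbb{N}$ with $f(\sigma\tau)=O(y^k)$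 as $y\to\infty$, uniformly in $x$. Moreover, $\sum_j\Phi_{m_j}^{c,\gamma_jc}$ does not depend on $c\in C_Q$. -/

import Mathlib

open scoped MatrixGroups UpperHalfPlane ContDiff

namespace IndefTheta

noncomputable section

/-- The quadratic form `Q(ν) = ½ νᵗ A ν` on `ℝ²` of an integer matrix `A`. -/
def Q (A : Matrix (Fin 2) (Fin 2) ℤ) : QuadraticForm ℝ (Fin 2 → ℝ) :=
  (1 / 2 : ℝ) • (A.map (Int.cast : ℤ → ℝ)).toQuadraticForm'

/-- The bilinear form `B(ν, μ) = νᵗ A μ` on `ℝ²`. -/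
def B (A : Matrix (Fin 2) (Fin 2) ℤ) (ν μ : Fin 2 → ℝ) : ℝ :=
  ν ⬝ᵥ (A.map (Int.cast : ℤ → ℝ)).mulVec μ

theorem Q_apply (A : Matrix (Fin 2) (Fin 2) ℤ) (ν : Fin 2 → ℝ) : Q A ν = B A ν ν / 2 := by
  simp only [Q, B, smul_apply, Matrix.toQuadraticForm',
    LinearMap.BilinMap.toQuadraticMap_apply, Matrix.toLinearMap₂'_apply', smul_eq_mul]
  ring

/-- The component of `{c | Q(c) = -1}` that contains `c₀` (where `Q(c₀) = -1`). -/
def CQ (A : Matrix (Fin 2) (Fin 2) ℤ) (c₀ : Fin 2 → ℝ) : Set (Fin 2 → ℝ) :=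
  {c | Q A c = -1 ∧ B A c c₀ < 0}

/-- `c(t) = P⁻¹ (eᵗ, -e⁻ᵗ)`. -/
def cCurve (P : GL (Fin 2) ℝ) (t : ℝ) : Fin 2 → ℝ :=
  ((P⁻¹ : GL (Fin 2) ℝ) : Matrix (Fin 2) (Fin 2) ℝ).mulVec ![Real.exp t, -Real.exp (-t)]

/-- `c^⊥(t) = P⁻¹ (eᵗ, e⁻ᵗ)`. -/
def cPerpCurve (P : GL (Fin 2) ℝ) (t : ℝ) : Fin 2 → ℝ :=
  ((P⁻¹ : GL (Fin 2) ℝ) : Matrix (Fin 2) (Fin 2) ℝ).mulVec ![Real.exp t, Real.exp (-t)]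

/-- `P` splits `Q`, that is `Q(ν) = (Pν)₁ (Pν)₂`, with the sign of `P` chosen such that
`P⁻¹ (1, -1)` lies in the component `CQ A c₀`. -/
structure Splits (A : Matrix (Fin 2) (Fin 2) ℤ) (c₀ : Fin 2 → ℝ) (P : GL (Fin 2) ℝ) : Prop where
  eq_mul : ∀ ν : Fin 2 → ℝ, Q A ν =
    (P : Matrix (Fin 2) (Fin 2) ℝ).mulVec ν 0 * (P : Matrix (Fin 2) (Fin 2) ℝ).mulVec ν 1
  mem : ((P⁻¹ : GL (Fin 2) ℝ) : Matrix (Fin 2) (Fin 2) ℝ).mulVec ![1, -1] ∈ CQ A c₀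

/-- The parameter `t` with `c(t) = c`, for `c` on the chosen component
(see `cCurve_tParam` and `tParam_cCurve`). -/
def tParam (P : GL (Fin 2) ℝ) (c : Fin 2 → ℝ) : ℝ :=
  Real.log ((P : Matrix (Fin 2) (Fin 2) ℝ).mulVec c 0)

/-- `c^⊥ = c^⊥(t)` where `c = c(t)`. -/
def cPerp (P : GL (Fin 2) ℝ) (c : Fin 2 → ℝ) : Fin 2 → ℝ := cPerpCurve P (tParam P c)

theorem tParam_cCurve (P : GL (Fin 2) ℝ) (t : ℝ) : tParam P (cCurve P t) = t := by
  rw [tParam, cCurve, Matrix.mulVec_mulVec, ← Units.val_mul, mul_inv_cancel, Units.val_one,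
    Matrix.one_mulVec]
  simp

theorem cCurve_tParam {A : Matrix (Fin 2) (Fin 2) ℤ} (hA : A.IsSymm) {c₀ : Fin 2 → ℝ}
    (hc₀ : Q A c₀ = -1) {P : GL (Fin 2) ℝ} (hP : Splits A c₀ P)
    {c : Fin 2 → ℝ} (hc : c ∈ CQ A c₀) : cCurve P (tParam P c) = c := by
  have hB : ∀ x y : Fin 2 → ℝ, B A x y = Q A (x + y) - Q A x - Q A y := by
    intro x y
    have h10 : A 1 0 = A 0 1 := hA.apply 0 1
    simp only [Q_apply, B, dotProduct, Matrix.mulVec, Fin.sum_univ_two, Matrix.map_apply,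
      Pi.add_apply, h10]
    ring
  obtain ⟨hQc, hBc⟩ := hc
  obtain ⟨-, hBd⟩ := hP.mem
  set M : Matrix (Fin 2) (Fin 2) ℝ := (P : Matrix (Fin 2) (Fin 2) ℝ) with hM
  have hBP : ∀ x y : Fin 2 → ℝ, B A x y =
      M.mulVec x 0 * M.mulVec y 1 + M.mulVec x 1 * M.mulVec y 0 := by
    intro x y
    rw [hB, hP.eq_mul, hP.eq_mul, hP.eq_mul, Matrix.mulVec_add]
    simp only [Pi.add_apply]
    ring
  have hinv : ∀ x : Fin 2 → ℝ,
      M.mulVec (((P⁻¹ : GL (Fin 2) ℝ) : Matrix (Fin 2) (Fin 2) ℝ).mulVec x) = x := by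
    intro x
    rw [hM, Matrix.mulVec_mulVec, ← Units.val_mul, mul_inv_cancel, Units.val_one, Matrix.one_mulVec]
  have hinv' : ∀ x : Fin 2 → ℝ,
      ((P⁻¹ : GL (Fin 2) ℝ) : Matrix (Fin 2) (Fin 2) ℝ).mulVec (M.mulVec x) = x := by
    intro x
    rw [hM, Matrix.mulVec_mulVec, ← Units.val_mul, inv_mul_cancel, Units.val_one, Matrix.one_mulVec]
  rw [hBP] at hBc hBd
  rw [hinv] at hBd
  rw [hP.eq_mul] at hQc hc₀
  simp only [Matrix.cons_val_zero, Matrix.cons_val_one] at hBd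
  have hw0 : 0 < M.mulVec c₀ 0 := by nlinarith [sq_nonneg (M.mulVec c₀ 0 + M.mulVec c₀ 1)]
  have hw1 : M.mulVec c₀ 1 < 0 := by nlinarith
  have hu0 : 0 < M.mulVec c 0 := by
    by_contra! h
    have h1 : 0 < M.mulVec c 1 := by nlinarith
    nlinarith [mul_nonneg_of_nonpos_of_nonpos h hw1.le, mul_pos h1 hw0]
  have hu1 : M.mulVec c 1 = -(M.mulVec c 0)⁻¹ := by
    field_simp
    linarith
  have hv : M.mulVec c = ![Real.exp (tParam P c), -Real.exp (-tParam P c)] := by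
    ext i
    fin_cases i
    · change M.mulVec c 0 = Real.exp (Real.log (M.mulVec c 0))
      rw [Real.exp_log hu0]
    · change M.mulVec c 1 = -Real.exp (-Real.log (M.mulVec c 0))
      rw [Real.exp_neg, Real.exp_log hu0, hu1]
  rw [cCurve, ← hv, hinv']

/-- The modified Bessel function of the second kind `K₀(x) = ∫₀^∞ e^{-x cosh t} dt`, for `x > 0`. -/
def besselK0 (x : ℝ) : ℝ := ∫ t in Set.Ioi (0 : ℝ), Real.exp (-x * Real.cosh t)

/-- The inclusion of `ℤ²` in `ℝ²`. -/
def toReal (ν : Fin 2 → ℤ) : Fin 2 → ℝ := fun i => (ν i : ℝ)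

/-- `m` is a periodic function on `ℤ²`: it is invariant under `Lℤ²` for some integer `L ≠ 0`. -/
def IsPeriodic (m : (Fin 2 → ℤ) → ℂ) : Prop :=
  ∃ L : ℤ, L ≠ 0 ∧ ∀ ν μ : Fin 2 → ℤ, m (ν + L • μ) = m ν

/-- The summand
`½ [1 - sgn(B(ν, d₁) B(ν, d₂))] m(ν) e^{2πi Q(ν) x} K₀(2π s Q(ν) y)`, with `τ = x + iy`. -/
def phiTerm (A : Matrix (Fin 2) (Fin 2) ℤ) (m : (Fin 2 → ℤ) → ℂ) (d₁ d₂ : Fin 2 → ℝ) (s : ℝ)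
    (τ : ℍ) (ν : Fin 2 → ℤ) : ℂ :=
  (((1 / 2 : ℝ) * (1 - Real.sign (B A (toReal ν) d₁ * B A (toReal ν) d₂)) : ℝ) : ℂ) * m ν *
    Complex.exp (2 * Real.pi * Complex.I * (Q A (toReal ν) : ℝ) * (τ.re : ℝ)) *
    (besselK0 (2 * Real.pi * (s * Q A (toReal ν)) * τ.im) : ℝ)

/-- The function `Φ_m^{c₁,c₂}` on the upper half-plane. -/
def Phi (A : Matrix (Fin 2) (Fin 2) ℤ) (P : GL (Fin 2) ℝ) (m : (Fin 2 → ℤ) → ℂ)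
    (c₁ c₂ : Fin 2 → ℝ) (τ : ℍ) : ℂ :=
  (Real.sign (tParam P c₂ - tParam P c₁) : ℝ) * (Real.sqrt τ.im : ℝ) *
      ∑' ν : Fin 2 → ℤ, phiTerm A m c₁ c₂ 1 τ ν +
    (Real.sign (tParam P c₂ - tParam P c₁) : ℝ) * (Real.sqrt τ.im : ℝ) *
      ∑' ν : Fin 2 → ℤ, phiTerm A m (cPerp P c₁) (cPerp P c₂) (-1) τ ν

/-- The action of `SL₂(ℤ)` on `ℝ²`. -/
def actReal (γ : SL(2, ℤ)) (v : Fin 2 → ℝ) : Fin 2 → ℝ :=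
  ((γ : Matrix (Fin 2) (Fin 2) ℤ).map (Int.cast : ℤ → ℝ)).mulVec v

/-- The action of `SL₂(ℤ)` on `ℤ²`. -/
def actInt (γ : SL(2, ℤ)) (ν : Fin 2 → ℤ) : Fin 2 → ℤ :=
  (γ : Matrix (Fin 2) (Fin 2) ℤ).mulVec ν

/-- `Aut⁺(Q, ℤ²)`. The real matrices `γ` with `γℤ² = ℤ²` and `det γ = 1` are precisely the elements
of `SL₂(ℤ)`; the remaining conditions are `Q ∘ γ = Q` and `γ C_Q = C_Q`. -/
def AutPlus (A : Matrix (Fin 2) (Fin 2) ℤ) (c₀ : Fin 2 → ℝ) : Set SL(2, ℤ) :=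
  {γ | (∀ v : Fin 2 → ℝ, Q A (actReal γ v) = Q A v) ∧ actReal γ '' CQ A c₀ = CQ A c₀}

/-- The weight 0 Laplace operator `Δ₀ = -y² (∂²/∂x² + ∂²/∂y²)` on functions on the upper
half-plane. -/
def hypLaplacian (f : ℍ → ℂ) (τ : ℍ) : ℂ :=
  -((τ.im : ℂ) ^ 2) * Laplacian.laplacian (fun z : ℂ => f (UpperHalfPlane.ofComplex z)) (τ : ℂ)

/-- `f` is a Maass form of weight 0 with Laplace eigenvalue `lam` on `Γ` with multiplier
system `v`: here `Γ` has finite index in `SL₂(ℤ)` and `v` is a unitary character of `Γ` that is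
trivial at `-1`, if `-1 ∈ Γ`. -/
structure IsMaassForm (Γ : Subgroup SL(2, ℤ)) (v : Γ →* Circle) (lam : ℂ) (f : ℍ → ℂ) :
    Prop where
  finiteIndex : Γ.FiniteIndex
  multiplier_neg_one : ∀ h : (-1 : SL(2, ℤ)) ∈ Γ, v ⟨-1, h⟩ = 1
  smooth : ContDiffOn ℝ ∞ (fun z : ℂ => f (UpperHalfPlane.ofComplex z)) {z : ℂ | 0 < z.im}
  eigen : ∀ τ : ℍ, hypLaplacian f τ = lam * f τ
  transform : ∀ (g : Γ) (τ : ℍ), f ((g : SL(2, ℤ)) • τ) = (v g : ℂ) * f τ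
  moderate_growth : ∀ σ : SL(2, ℤ), ∃ k : ℕ,
    (fun τ : ℍ => f (σ • τ)) =O[UpperHalfPlane.atImInfty] (fun τ : ℍ => τ.im ^ k)

end

end IndefTheta

/-! Write (a, b) = Pν, so that Q(ν) = ab. For each real t the Gaussian exp(2πi abx − π(e⁻²ᵗa² +
e²ᵗb²)y) defines a Siegel theta function `theta` of weight 0. With e²ˢ = |a/b| the exponent becomes
−2π|ab|y cosh 2(t − s), so the integral of the Gaussian over all t ∈ ℝ is e(Qx)K₀(2π|Q|y). Over [t₁,
t₂] the integral differs from the sign-weighted Bessel term in Φ by E(t₂) − E(t₁), where E(t) is a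
tail of the Bessel integral and involves one endpoint only (`sign_mul_besselTerms`,
`Splits.Phi_eq`).

In these coordinates γ_j is diag(e^{s_j}, e^{-s_j}), which the kernel absorbs by t ↦ t + s_j. Hence
for a term F(t, ν) attached to an endpoint, ∑_j ∑_ν m_j(ν)F(t + s_j, ν) = ∑_j ∑_ν m_j(γ_jν)F(t, ν),
which equals ∑_j ∑_ν m_j(ν)F(t, ν) by the relation on the collection (`sum_tsum_mul_eq`). This
cancellation is used three times. It removes the tails E, so that f is the sum of the integrals of
the theta functions over [t, t + s_j] (`Splits.sum_Phi_eq`). It shows that this sum does not depend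
on t (`sum_thetaIntegral_eq`). And it gives the eigenvalue: each theta function satisfies (Δ₀ −
1/4)θ = −(1/4)∂²θ/∂t², so Δ₀ − 1/4 applied to an integral leaves only boundary terms, which cancel
in the sum (`hypLaplacian_sum_thetaIntegral`).

Modularity comes from the theta functions. After a rescaling of the lattice, periodic coefficients
become functions on a finite discriminant group, and Poisson summation shows that τ ↦ τ + 1 and τ ↦
−1/τ act through the operators of the Weil representation. No formula for a general g is needed: the
operator of g is unitary and permutes the Heisenberg operators, so for g ≡ 1 modulo 2 det S it
commutes with all of them and is a scalar of modulus one (`IsDualForm.exists_scalar`,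
`IsDualForm.exists_circle`). This scalar depends neither on t nor on the coefficients, so it passes
to the integral over t and to the sum over j. The same operators carry every cusp to infinity, where
theta functions grow at most linearly in y. -/

namespace IndefTheta

/-! ### Poisson summation for Gaussians in one and two variables -/

/-- Poisson summation for a shifted complex Gaussian in one variable. -/
theorem tsum_exp_neg_mul_add_sq {α : ℂ} (hα : 0 < α.re) (s : ℂ) :
    ∑' n : ℤ, Complex.exp (-Real.pi * α * (n + s) ^ 2) =
      1 / α ^ (1 / 2 : ℂ) *
        ∑' k : ℤ, Complex.exp (-Real.pi / α * k ^ 2 + 2 * Real.pi * Complex.I * s * k) := by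
  have h0 : α ≠ 0 := fun h => by simp [h] at hα
  -- Expanding the square produces the linear coefficient −αs. The shift s must be complex, since
  -- the second summation in two variables has a complex shift.
  have h := Complex.tsum_exp_neg_quadratic hα (-α * s)
  have h1 : ∀ n : ℤ, Complex.exp (-Real.pi * α * (n + s) ^ 2) =
      Complex.exp (-Real.pi * α * s ^ 2) *
        Complex.exp (-Real.pi * α * n ^ 2 + 2 * Real.pi * (-α * s) * n) := by
    intro n
    rw [← Complex.exp_add]
    ring_nf
  have h2 : ∀ n : ℤ, Complex.exp (-Real.pi / α * n ^ 2 + 2 * Real.pi * Complex.I * s * n) =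
      Complex.exp (-Real.pi * α * s ^ 2) *
        Complex.exp (-Real.pi / α * (n + Complex.I * (-α * s)) ^ 2) := by
    intro n
    rw [← Complex.exp_add]
    congr 1
    field_simp
    linear_combination (α ^ 2 * s ^ 2) * Complex.I_sq
  simp_rw [h1, h2, tsum_mul_left, h]
  ring

theorem summable_exp_neg_mul_sq {c : ℝ} (hc : 0 < c) :
    Summable fun n : ℤ => Real.exp (-c * (n : ℝ) ^ 2) := by
  -- These are the absolute values of the Jacobi theta terms at z = 0, τ = ic/π.
  have h := (summable_jacobiTheta₂_term_iff 0 (((c / Real.pi : ℝ) : ℂ) * Complex.I)).mpr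
    (by simpa using by positivity)
  refine h.norm.congr fun n => ?_
  rw [jacobiTheta₂_term, Complex.norm_exp]
  congr 1
  have : (2 * Real.pi * Complex.I * n * 0 +
      Real.pi * Complex.I * (n : ℂ) ^ 2 * (((c / Real.pi : ℝ) : ℂ) * Complex.I)) =
      ((-c * (n : ℝ) ^ 2 : ℝ) : ℂ) := by
    push_cast
    field_simp
    linear_combination ((n : ℂ) ^ 2 * c) * Complex.I_sq
  rw [this, Complex.ofReal_re]

theorem summable_exp_neg_sq_add_sq {c : ℝ} (hc : 0 < c) (ρ : ℝ) :
    Summable fun k : ℤ × ℤ => Real.exp (-c * ((k.1 : ℝ) ^ 2 + (k.2 + ρ) ^ 2)) := by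
  have h1 := summable_exp_neg_mul_sq hc
  have h2 := summable_exp_neg_mul_sq (half_pos hc)
  have h3 := (h1.mul_of_nonneg h2 (fun _ => (Real.exp_pos _).le)
    (fun _ => (Real.exp_pos _).le)).mul_left (Real.exp (c * ρ ^ 2))
  refine Summable.of_nonneg_of_le (fun _ => (Real.exp_pos _).le) (fun k => ?_) h3
  rw [← Real.exp_add, ← Real.exp_add]
  apply Real.exp_le_exp.mpr
  -- (k + ρ)² − k²/2 + ρ² = (k + 2ρ)²/2, whence the halved constant and the factor exp(cρ²) in the
  -- majorant.
  nlinarith [mul_nonneg hc.le (sq_nonneg ((k.2 : ℝ) + 2 * ρ))]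

/-- A positive definite binary form dominates a positive multiple of the sum of two squares. -/
theorem exists_pos_mul_le_quadratic {a b d : ℝ} (ha : 0 < a) (hdet : 0 < a * d - b ^ 2) :
    ∃ c > 0, ∀ u v : ℝ, c * (u ^ 2 + v ^ 2) ≤ a * u ^ 2 + 2 * b * u * v + d * v ^ 2 := by
  have hd : 0 < d := by
    by_contra! h
    nlinarith [mul_nonneg ha.le (neg_nonneg.mpr h), sq_nonneg b]
  -- Determinant over trace, λ₁λ₂/(λ₁ + λ₂), lies below both eigenvalues. By Cayley–Hamilton, trace
  -- · form − det · |x|² = |Mx|², the sum of the two squares given to `nlinarith`.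
  refine ⟨(a * d - b ^ 2) / (a + d), by positivity, fun u v => ?_⟩
  rw [div_mul_eq_mul_div, div_le_iff₀ (by positivity)]
  nlinarith [sq_nonneg (a * u + b * v), sq_nonneg (b * u + d * v)]

/-- Since Re α > 0, the argument of α stays away from π, so the principal logarithms of α and r/α
add up without a jump by 2πi. This merges the square roots from two successive one-variable
summations into a real factor. -/
theorem cpow_half_mul_cpow_half_div {α : ℂ} (hα : 0 < α.re) {r : ℝ} (hr : 0 < r) :
    α ^ (1 / 2 : ℂ) * ((r : ℂ) / α) ^ (1 / 2 : ℂ) = (Real.sqrt r : ℝ) := by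
  have h0 : α ≠ 0 := fun h => by simp [h] at hα
  have hr' : (r : ℂ) ≠ 0 := by exact_mod_cast hr.ne'
  have harg := Complex.abs_arg_lt_pi_div_two_iff.mpr (Or.inl hα)
  rw [abs_lt] at harg
  have hpi := Real.pi_pos
  have hlog : Complex.log ((r : ℂ) / α) = (Real.log r : ℝ) - Complex.log α := by
    rw [div_eq_mul_inv, Complex.log_ofReal_mul hr (inv_ne_zero h0), Complex.log_inv]
    · ring
    · intro h
      linarith [harg.2]
  rw [Complex.cpow_def_of_ne_zero h0, Complex.cpow_def_of_ne_zero (div_ne_zero hr' h0), hlog,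
    ← Complex.exp_add, Real.sqrt_eq_rpow, Complex.ofReal_cpow hr.le,
    Complex.cpow_def_of_ne_zero hr', Complex.ofReal_log hr.le]
  congr 1
  push_cast
  ring

/-- Poisson summation for a complex Gaussian in two variables. -/
theorem tsum_exp_neg_binary {α β δ : ℂ} (hα : 0 < α.re) (hdet : 0 < α.re * δ.re - β.re ^ 2)
    {r : ℝ} (hr : 0 < r) (hr' : α * δ - β ^ 2 = r) (ρ₀ ρ₁ : ℝ) :
    ∑' n₁ : ℤ, ∑' n₀ : ℤ, Complex.exp (-Real.pi * (α * (n₀ + ρ₀) ^ 2 +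
        2 * β * (n₀ + ρ₀) * (n₁ + ρ₁) + δ * (n₁ + ρ₁) ^ 2)) =
      1 / (Real.sqrt r : ℝ) * ∑' k₀ : ℤ, ∑' k₁ : ℤ,
        Complex.exp (2 * Real.pi * Complex.I * (k₀ * ρ₀ + k₁ * ρ₁)) *
        Complex.exp (-Real.pi / r * (δ * k₀ ^ 2 - 2 * β * k₀ * k₁ + α * k₁ ^ 2)) := by
  have h0 : α ≠ 0 := fun h => by simp [h] at hα
  have hrc : (r : ℂ) ≠ 0 := by exact_mod_cast hr.ne'
  have hN : 0 < Complex.normSq α := Complex.normSq_pos.mpr h0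
  -- `E` is the mixed term after Poisson summation in n₀ alone. Its absolute summability permits the
  -- exchange of sums before the summation in n₁.
  set E : ℤ → ℤ → ℂ := fun n₁ k₀ => Complex.exp (-Real.pi / α * k₀ ^ 2 +
    2 * Real.pi * Complex.I * (ρ₀ + β * (n₁ + ρ₁) / α) * k₀ - Real.pi * (r / α) * (n₁ + ρ₁) ^ 2)
    with hE
  have hinner : ∀ n₁ : ℤ, ∑' n₀ : ℤ, Complex.exp (-Real.pi * (α * (n₀ + ρ₀) ^ 2 +
        2 * β * (n₀ + ρ₀) * (n₁ + ρ₁) + δ * (n₁ + ρ₁) ^ 2)) =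
      1 / α ^ (1 / 2 : ℂ) * ∑' k₀ : ℤ, E n₁ k₀ := by
    intro n₁
    have h1 : ∀ n₀ : ℤ, Complex.exp (-Real.pi * (α * (n₀ + ρ₀) ^ 2 +
        2 * β * (n₀ + ρ₀) * (n₁ + ρ₁) + δ * (n₁ + ρ₁) ^ 2)) =
        Complex.exp (-Real.pi * (r / α) * (n₁ + ρ₁) ^ 2) *
        Complex.exp (-Real.pi * α * (n₀ + (ρ₀ + β * (n₁ + ρ₁) / α)) ^ 2) := by
      intro n₀
      rw [← Complex.exp_add, ← hr']
      congr 1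
      field_simp
      ring
    simp_rw [h1, tsum_mul_left, tsum_exp_neg_mul_add_sq hα]
    rw [mul_left_comm, ← tsum_mul_left]
    congr 2
    ext k
    rw [← Complex.exp_add, hE]
    congr 1
    ring
  have hsum : Summable (Function.uncurry E) := by
    have hA : 0 < α.re / Complex.normSq α := by positivity
    have hεre : ((r : ℂ) / α).re = r * α.re / Complex.normSq α := by
      simp [Complex.div_re]
    have hre := congrArg Complex.re hr'
    have him := congrArg Complex.im hr'
    simp [pow_two] at hre him
    -- Up to the factor −π, the real part of the exponent of `E` is a quadratic form in (k₀, n₁ +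
    -- ρ₁). Because αδ − β² is real, its determinant equals (Re α Re δ − (Re β)²)/|α|².
    have hdet' : 0 < (α.re / Complex.normSq α) * (r * α.re / Complex.normSq α) -
        ((β / α).im) ^ 2 := by
      have : (α.re / Complex.normSq α) * (r * α.re / Complex.normSq α) - ((β / α).im) ^ 2 =
          (α.re * δ.re - β.re ^ 2) / Complex.normSq α := by
        rw [Complex.div_im]
        field_simp
        rw [Complex.normSq_apply]
        linear_combination (-α.re ^ 2) * hre - α.re * α.im * him
      rw [this]
      positivity
    obtain ⟨c, hc, hcle⟩ := exists_pos_mul_le_quadratic hA hdet'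
    have hs := summable_exp_neg_sq_add_sq (mul_pos Real.pi_pos hc) ρ₁
    rw [← (Equiv.prodComm ℤ ℤ).summable_iff] at hs
    refine Summable.of_norm_bounded hs fun k => ?_
    rw [Function.uncurry, hE, Complex.norm_exp]
    apply Real.exp_le_exp.mpr
    have := hcle k.2 (k.1 + ρ₁)
    have hre2 : (-Real.pi / α * k.2 ^ 2 + 2 * Real.pi * Complex.I * (ρ₀ + β * (k.1 + ρ₁) / α) * k.2
        - Real.pi * (r / α) * (k.1 + ρ₁) ^ 2).re = -Real.pi * (α.re / Complex.normSq α * k.2 ^ 2 +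
          2 * (β / α).im * k.2 * (k.1 + ρ₁) + r * α.re / Complex.normSq α * (k.1 + ρ₁) ^ 2) := by
      have e : (-Real.pi / α * k.2 ^ 2 + 2 * Real.pi * Complex.I * (ρ₀ + β * (k.1 + ρ₁) / α) * k.2
        - Real.pi * (r / α) * (k.1 + ρ₁) ^ 2) = ((-Real.pi * k.2 ^ 2 : ℝ) : ℂ) * α⁻¹ +
          ((2 * Real.pi * k.2 : ℝ) : ℂ) * (Complex.I * ρ₀) +
          ((2 * Real.pi * k.2 * (k.1 + ρ₁) : ℝ) : ℂ) * (Complex.I * (β / α)) +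
          ((-Real.pi * (k.1 + ρ₁) ^ 2 : ℝ) : ℂ) * (r / α) := by
        push_cast
        ring
      rw [e]
      simp only [Complex.add_re, Complex.re_ofReal_mul, hεre, Complex.inv_re, Complex.I_mul_re,
        Complex.ofReal_im]
      ring
    rw [hre2]
    simp only [Equiv.prodComm_apply, Prod.fst_swap, Prod.snd_swap]
    nlinarith [Real.pi_pos, mul_le_mul_of_nonneg_left this Real.pi_pos.le]
  have hε : 0 < ((r : ℂ) / α).re := by
    rw [Complex.div_re]
    simp
    positivity
  have houter : ∀ k₀ : ℤ, ∑' n₁ : ℤ, E n₁ k₀ = 1 / ((r : ℂ) / α) ^ (1 / 2 : ℂ) * ∑' k₁ : ℤ,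
        Complex.exp (2 * Real.pi * Complex.I * (k₀ * ρ₀ + k₁ * ρ₁)) *
        Complex.exp (-Real.pi / r * (δ * k₀ ^ 2 - 2 * β * k₀ * k₁ + α * k₁ ^ 2)) := by
    intro k₀
    -- Completing the square in n₁ gives the shift ρ₁ − iβk₀/r.
    have h1 : ∀ n₁ : ℤ, E n₁ k₀ = Complex.exp (2 * Real.pi * Complex.I * (k₀ * ρ₀) -
        Real.pi * k₀ ^ 2 / α * (1 + β ^ 2 / r)) *
        Complex.exp (-Real.pi * (r / α) * (n₁ + (ρ₁ - Complex.I * k₀ * β / r)) ^ 2) := by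
      intro n₁
      simp only [hE]
      rw [← Complex.exp_add]
      congr 1
      field_simp
      linear_combination (k₀ ^ 2 * β ^ 2) * Complex.I_sq
    simp_rw [h1, tsum_mul_left, tsum_exp_neg_mul_add_sq hε]
    rw [mul_left_comm, ← tsum_mul_left]
    congr 2
    ext k
    rw [← Complex.exp_add, ← Complex.exp_add]
    congr 1
    have hδ : δ = (r + β ^ 2) / α := by
      rw [← hr']
      field_simp
      ring
    rw [hδ]
    field_simp
    linear_combination (-2 * k₀ * β * k * α) * Complex.I_sq
  simp_rw [hinner, tsum_mul_left]
  rw [← Summable.tsum_comm hsum]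
  simp_rw [houter, tsum_mul_left]
  rw [← mul_assoc, ← cpow_half_mul_cpow_half_div hα hr]
  congr 1
  field_simp


/-- The Gaussian `exp(2πi ab x - π (a² + b²) y)`. -/
noncomputable def gaussKernel (x y a b : ℝ) : ℂ :=
  Complex.exp (((2 * Real.pi * (a * b) * x : ℝ) : ℂ) * Complex.I +
    ((-(Real.pi * (a ^ 2 + b ^ 2) * y) : ℝ) : ℂ))

theorem norm_gaussKernel (x y a b : ℝ) :
    ‖gaussKernel x y a b‖ = Real.exp (-(Real.pi * (a ^ 2 + b ^ 2) * y)) := by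
  rw [gaussKernel, Complex.norm_exp, Complex.add_re, Complex.re_ofReal_mul, Complex.I_re,
    mul_zero, zero_add, Complex.ofReal_re]

/-- The positive definite form `|V n|²` dominates a multiple of `|n|²` if `V` is invertible. -/
theorem exists_pos_mul_le_sq_add_sq {p q r s : ℝ} (hD : p * s - q * r ≠ 0) :
    ∃ c > 0, ∀ u v : ℝ,
      c * (u ^ 2 + v ^ 2) ≤ (p * u + q * v) ^ 2 + (r * u + s * v) ^ 2 := by
  have h1 : 0 < (p * s - q * r) ^ 2 := by positivity
  have h2 : 0 < p ^ 2 + r ^ 2 := by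
    by_contra! h
    have hp : p = 0 := by nlinarith [sq_nonneg p, sq_nonneg r]
    have hr : r = 0 := by nlinarith [sq_nonneg p, sq_nonneg r]
    simp [hp, hr] at hD
  obtain ⟨c, hc, h⟩ := exists_pos_mul_le_quadratic (a := p ^ 2 + r ^ 2) (b := p * q + r * s)
    (d := q ^ 2 + s ^ 2) h2 (by nlinarith)
  exact ⟨c, hc, fun u v => (h u v).trans (by nlinarith)⟩

theorem summable_gaussKernel {p q r s : ℝ} (hD : p * s - q * r ≠ 0) (x : ℝ) {y : ℝ} (hy : 0 < y) :
    Summable fun k : ℤ × ℤ => gaussKernel x y (p * k.1 + q * k.2) (r * k.1 + s * k.2) := by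
  obtain ⟨c, hc, h⟩ := exists_pos_mul_le_sq_add_sq hD
  have hs := summable_exp_neg_sq_add_sq (c := Real.pi * y * c) (by positivity) 0
  refine Summable.of_norm_bounded hs fun k => ?_
  rw [norm_gaussKernel]
  apply Real.exp_le_exp.mpr
  have := mul_le_mul_of_nonneg_left (h k.1 k.2) (by positivity : 0 ≤ Real.pi * y)
  simp only [add_zero]
  linarith

theorem summable_gaussKernel_add {p q r s : ℝ} (hD : p * s - q * r ≠ 0) (x : ℝ) {y : ℝ}
    (hy : 0 < y) (ρ₀ ρ₁ : ℝ) :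
    Summable fun k : ℤ × ℤ => gaussKernel x y (p * (k.1 + ρ₀) + q * (k.2 + ρ₁))
      (r * (k.1 + ρ₀) + s * (k.2 + ρ₁)) := by
  obtain ⟨c, hc, h⟩ := exists_pos_mul_le_sq_add_sq hD
  have hs := (summable_exp_neg_sq_add_sq (c := Real.pi * y * c / 2) (by positivity) 0).mul_left
    (Real.exp (Real.pi * y * c * (ρ₀ ^ 2 + ρ₁ ^ 2)))
  refine Summable.of_norm_bounded hs fun k => ?_
  rw [norm_gaussKernel, ← Real.exp_add]
  apply Real.exp_le_exp.mpr
  have h1 := mul_le_mul_of_nonneg_left (h (k.1 + ρ₀) (k.2 + ρ₁)) (by positivity : 0 ≤ Real.pi * y)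
  have h2 : 0 ≤ Real.pi * y * c * ((k.1 + 2 * ρ₀) ^ 2 + (k.2 + 2 * ρ₁) ^ 2) := by positivity
  simp only [add_zero]
  linarith

/-- Poisson summation for the Gaussian kernel on a lattice in `ℝ²`; the inversion
`τ ↦ -1/τ` acts on the parameter `τ = x + iy`. -/
theorem tsum_gaussKernel_add {p q r s : ℝ} (hD : p * s - q * r ≠ 0) (x : ℝ) {y : ℝ} (hy : 0 < y)
    (ρ₀ ρ₁ : ℝ) :
    ∑' n : ℤ × ℤ, gaussKernel x y (p * (n.1 + ρ₀) + q * (n.2 + ρ₁))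
        (r * (n.1 + ρ₀) + s * (n.2 + ρ₁)) =
      1 / ((|p * s - q * r| * Real.sqrt (x ^ 2 + y ^ 2) : ℝ) : ℂ) * ∑' k : ℤ × ℤ,
        Complex.exp (2 * Real.pi * Complex.I * (k.1 * ρ₀ + k.2 * ρ₁)) *
          gaussKernel (-x / (x ^ 2 + y ^ 2)) (y / (x ^ 2 + y ^ 2))
            ((-q * k.1 + p * k.2) / (p * s - q * r)) ((s * k.1 - r * k.2) / (p * s - q * r)) := by
  set D := p * s - q * r with hDdef
  have hD2 : 0 < D ^ 2 := by positivity
  have hτ : 0 < x ^ 2 + y ^ 2 := by positivity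
  have h2 : 0 < p ^ 2 + r ^ 2 := by
    by_contra! h
    have hp : p = 0 := by nlinarith [sq_nonneg p, sq_nonneg r]
    have hr : r = 0 := by nlinarith [sq_nonneg p, sq_nonneg r]
    simp [hp, hr] at hDdef
    exact hD hDdef
  -- α, β, δ are the entries of Vᵗ(y − ixJ)V, where V has rows (p, q), (r, s) and J swaps
  -- coordinates. The determinant is D²(x² + y²), real and positive, as the two-variable summation
  -- requires.
  let α : ℂ := ⟨y * (p ^ 2 + r ^ 2), -2 * x * p * r⟩
  let β : ℂ := ⟨y * (p * q + r * s), -x * (p * s + q * r)⟩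
  let δ : ℂ := ⟨y * (q ^ 2 + s ^ 2), -2 * x * q * s⟩
  have hα : α = (y * (p ^ 2 + r ^ 2) : ℝ) + (-2 * x * p * r : ℝ) * Complex.I :=
    Complex.mk_eq_add_mul_I _ _
  have hβ : β = (y * (p * q + r * s) : ℝ) + (-x * (p * s + q * r) : ℝ) * Complex.I :=
    Complex.mk_eq_add_mul_I _ _
  have hδ : δ = (y * (q ^ 2 + s ^ 2) : ℝ) + (-2 * x * q * s : ℝ) * Complex.I :=
    Complex.mk_eq_add_mul_I _ _
  have key := tsum_exp_neg_binary (α := α) (β := β) (δ := δ) (r := D ^ 2 * (x ^ 2 + y ^ 2))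
    (mul_pos hy h2) (by
      have : y * (p ^ 2 + r ^ 2) * (y * (q ^ 2 + s ^ 2)) - (y * (p * q + r * s)) ^ 2 =
        y ^ 2 * D ^ 2 := by rw [hDdef]; ring
      change 0 < y * (p ^ 2 + r ^ 2) * (y * (q ^ 2 + s ^ 2)) - (y * (p * q + r * s)) ^ 2
      rw [this]; positivity) (by positivity) (by
      rw [hα, hβ, hδ, hDdef]
      push_cast
      linear_combination (4 * x ^ 2 * p * r * q * s - x ^ 2 * (p * s + q * r) ^ 2 : ℂ) *
        Complex.I_sq) ρ₀ ρ₁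
  have hl : ∀ n : ℤ × ℤ, gaussKernel x y (p * (n.1 + ρ₀) + q * (n.2 + ρ₁))
      (r * (n.1 + ρ₀) + s * (n.2 + ρ₁)) = Complex.exp (-Real.pi * (α * (n.1 + ρ₀) ^ 2 +
        2 * β * (n.1 + ρ₀) * (n.2 + ρ₁) + δ * (n.2 + ρ₁) ^ 2)) := by
    intro n
    rw [gaussKernel, hα, hβ, hδ]
    congr 1
    push_cast
    ring
  have hrr : ∀ k : ℤ × ℤ, gaussKernel (-x / (x ^ 2 + y ^ 2)) (y / (x ^ 2 + y ^ 2))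
            ((-q * k.1 + p * k.2) / D) ((s * k.1 - r * k.2) / D) =
      Complex.exp (-Real.pi / (D ^ 2 * (x ^ 2 + y ^ 2) : ℝ) *
        (δ * k.1 ^ 2 - 2 * β * k.1 * k.2 + α * k.2 ^ 2)) := by
    intro k
    have hDc : (D : ℂ) ≠ 0 := by exact_mod_cast hD
    have hτc : (x ^ 2 + y ^ 2 : ℂ) ≠ 0 := by exact_mod_cast hτ.ne'
    rw [gaussKernel, hα, hβ, hδ]
    congr 1
    push_cast
    field_simp
    ring
  have hs := summable_gaussKernel_add hD x hy ρ₀ ρ₁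
  have hs2 : Summable fun k : ℤ × ℤ =>
      Complex.exp (2 * Real.pi * Complex.I * (k.1 * ρ₀ + k.2 * ρ₁)) *
          gaussKernel (-x / (x ^ 2 + y ^ 2)) (y / (x ^ 2 + y ^ 2))
            ((-q * k.1 + p * k.2) / D) ((s * k.1 - r * k.2) / D) := by
    have h := summable_gaussKernel (p := -q / D) (q := p / D) (r := s / D) (s := -r / D)
      (by
        have : -q / D * (-r / D) - p / D * (s / D) = -D / D ^ 2 := by
          rw [show -D = q * r - p * s by rw [hDdef]; ring]
          field_simp
        rw [this]
        exact div_ne_zero (neg_ne_zero.mpr hD) hD2.ne') (-x / (x ^ 2 + y ^ 2)) (div_pos hy hτ)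
    refine Summable.of_norm (h.norm.congr fun k => ?_)
    rw [norm_mul, show (2 * Real.pi * Complex.I * (k.1 * ρ₀ + k.2 * ρ₁) : ℂ) =
      ((2 * Real.pi * (k.1 * ρ₀ + k.2 * ρ₁) : ℝ) : ℂ) * Complex.I by push_cast; ring,
      Complex.norm_exp_ofReal_mul_I, one_mul]
    congr 2 <;> ring
  simp_rw [hrr] at hs2 ⊢
  simp_rw [hl] at hs ⊢
  rw [← (Equiv.prodComm ℤ ℤ).tsum_eq]
  simp only [Equiv.prodComm_apply]
  rw [Summable.tsum_prod hs.prod_symm, Summable.tsum_prod hs2]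
  simp only [Prod.fst_swap, Prod.snd_swap]
  rw [key]
  congr 3
  rw [Real.sqrt_mul hD2.le, Real.sqrt_sq_eq_abs]

end IndefTheta

/-! ### The dual lattice, its pairing and the discriminant group -/

namespace IndefTheta

noncomputable section

/-- `e(r) = exp(2πi r)`. -/
def unitExp (r : ℝ) : ℂ := Complex.exp (((2 * Real.pi * r : ℝ) : ℂ) * Complex.I)

theorem unitExp_add (r s : ℝ) : unitExp (r + s) = unitExp r * unitExp s := by
  rw [unitExp, unitExp, unitExp, ← Complex.exp_add]
  congr 1
  push_cast
  ring

theorem unitExp_zero : unitExp 0 = 1 := by simp [unitExp]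

theorem norm_unitExp (r : ℝ) : ‖unitExp r‖ = 1 := Complex.norm_exp_ofReal_mul_I _

theorem unitExp_eq_one_iff {r : ℝ} : unitExp r = 1 ↔ ∃ n : ℤ, r = n := by
  rw [unitExp, Complex.exp_eq_one_iff]
  refine exists_congr fun n => ?_
  have h : (2 * Real.pi * Complex.I : ℂ) ≠ 0 := Complex.two_pi_I_ne_zero
  constructor
  · intro h1
    have h2 : (r : ℂ) * (2 * Real.pi * Complex.I) = n * (2 * Real.pi * Complex.I) := by
      rw [← h1]; push_cast; ring
    exact_mod_cast mul_right_cancel₀ h h2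
  · rintro rfl
    push_cast
    ring

theorem unitExp_intCast (n : ℤ) : unitExp n = 1 := unitExp_eq_one_iff.mpr ⟨n, rfl⟩

theorem unitExp_add_intCast (r : ℝ) (n : ℤ) : unitExp (r + n) = unitExp r := by
  rw [unitExp_add, unitExp_intCast, mul_one]

theorem conj_unitExp (r : ℝ) : (starRingEnd ℂ) (unitExp r) = unitExp (-r) := by
  rw [unitExp, unitExp, ← Complex.exp_conj]
  congr 1
  rw [map_mul, Complex.conj_ofReal, Complex.conj_I]
  push_cast
  ring

theorem toReal_add (a b : Fin 2 → ℤ) : toReal (a + b) = toReal a + toReal b := by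
  ext i; simp [toReal]

theorem toReal_neg (a : Fin 2 → ℤ) : toReal (-a) = -toReal a := by
  ext i; simp [toReal]

theorem toReal_smul (n : ℤ) (a : Fin 2 → ℤ) : toReal (n • a) = (n : ℝ) • toReal a := by
  ext i; simp [toReal]

theorem toReal_mulVec (S : Matrix (Fin 2) (Fin 2) ℤ) (a : Fin 2 → ℤ) :
    toReal (S.mulVec a) = (S.map (Int.cast : ℤ → ℝ)).mulVec (toReal a) := by
  ext i
  simp [toReal, Matrix.mulVec, dotProduct]

/-- The symmetric pairing `⟨a, b⟩ = (Wa)₁(Wb)₂ + (Wa)₂(Wb)₁`, the polar form of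
`(Wa)₁(Wa)₂`. -/
def pairing (W : Matrix (Fin 2) (Fin 2) ℝ) (a b : Fin 2 → ℤ) : ℝ :=
  W.mulVec (toReal a) 0 * W.mulVec (toReal b) 1 + W.mulVec (toReal a) 1 * W.mulVec (toReal b) 0

variable (W : Matrix (Fin 2) (Fin 2) ℝ)

theorem pairing_comm (a b : Fin 2 → ℤ) : pairing W a b = pairing W b a := by
  rw [pairing, pairing]; ring

theorem pairing_add_left (a b c : Fin 2 → ℤ) :
    pairing W (a + b) c = pairing W a c + pairing W b c := by
  simp only [pairing, toReal_add, Matrix.mulVec_add, Pi.add_apply]; ring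

theorem pairing_add_right (a b c : Fin 2 → ℤ) :
    pairing W a (b + c) = pairing W a b + pairing W a c := by
  simp only [pairing, toReal_add, Matrix.mulVec_add, Pi.add_apply]; ring

theorem pairing_neg_left (a b : Fin 2 → ℤ) : pairing W (-a) b = -pairing W a b := by
  simp only [pairing, toReal_neg, Matrix.mulVec_neg, Pi.neg_apply]; ring

theorem pairing_neg_right (a b : Fin 2 → ℤ) : pairing W a (-b) = -pairing W a b := by
  simp only [pairing, toReal_neg, Matrix.mulVec_neg, Pi.neg_apply]; ring

theorem pairing_smul_left (n : ℤ) (a b : Fin 2 → ℤ) : pairing W (n • a) b = n * pairing W a b := by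
  simp only [pairing, toReal_smul, Matrix.mulVec_smul, Pi.smul_apply, smul_eq_mul]; ring

theorem pairing_smul_right (n : ℤ) (a b : Fin 2 → ℤ) : pairing W a (n • b) = n * pairing W a b := by
  simp only [pairing, toReal_smul, Matrix.mulVec_smul, Pi.smul_apply, smul_eq_mul]; ring

/-- The form `⟨a, b⟩` on `ℤ²` has Gram matrix `S⁻¹` for an integral matrix `S` that defines an
even form. So `ℤ²` with this form is the dual of the even lattice `Sℤ²`. -/
structure IsDualForm (W : Matrix (Fin 2) (Fin 2) ℝ) (S : Matrix (Fin 2) (Fin 2) ℤ) : Prop where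
  gram_mul : W.transpose * !![0, 1; 1, 0] * W * S.map (Int.cast : ℤ → ℝ) = 1
  even : ∀ l : Fin 2 → ℤ, Even (l ⬝ᵥ S.mulVec l)

variable {W} {S : Matrix (Fin 2) (Fin 2) ℤ}

theorem pairing_eq_dotProduct (a b : Fin 2 → ℤ) : pairing W a b =
    toReal a ⬝ᵥ (W.transpose * !![0, 1; 1, 0] * W).mulVec (toReal b) := by
  simp [pairing, Matrix.mulVec, dotProduct, Fin.sum_univ_two, Matrix.mul_apply]
  ring

namespace IsDualForm

theorem pairing_mulVec_right (h : IsDualForm W S) (a l : Fin 2 → ℤ) :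
    pairing W a (S.mulVec l) = ((a ⬝ᵥ l : ℤ) : ℝ) := by
  rw [pairing_eq_dotProduct, toReal_mulVec, Matrix.mulVec_mulVec, h.gram_mul, Matrix.one_mulVec]
  simp [toReal, dotProduct]

theorem pairing_mulVec_left (h : IsDualForm W S) (l a : Fin 2 → ℤ) :
    pairing W (S.mulVec l) a = ((a ⬝ᵥ l : ℤ) : ℝ) := by
  rw [pairing_comm, h.pairing_mulVec_right]

theorem det_sq_mul (h : IsDualForm W S) : W.det ^ 2 * (S.det : ℝ) = -1 := by
  have h1 := congrArg Matrix.det h.gram_mul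
  rw [Matrix.det_mul, Matrix.det_mul, Matrix.det_mul, Matrix.det_transpose, Matrix.det_one,
    Matrix.det_fin_two_of, show (S.map (Int.cast : ℤ → ℝ)).det = (S.det : ℝ) from
      ((Int.castRingHom ℝ).map_det S).symm] at h1
  linarith

theorem det_ne_zero (h : IsDualForm W S) : S.det ≠ 0 := by
  intro h0
  have := h.det_sq_mul
  simp [h0] at this

theorem mulVec_injective (h : IsDualForm W S) : Function.Injective S.mulVec :=
  fun l l' hl => by
    ext i
    have h1 := h.pairing_mulVec_right (Pi.single i 1) l
    rw [hl, h.pairing_mulVec_right, single_one_dotProduct, single_one_dotProduct] at h1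
    exact_mod_cast h1.symm

/-- Integrality of all pairings with `a` forces `a ∈ Sℤ²`. -/
theorem exists_eq_mulVec (h : IsDualForm W S) {a : Fin 2 → ℤ} (ha : ∀ b, ∃ n : ℤ, pairing W b a = n) :
    ∃ l, a = S.mulVec l := by
  choose n hn using ha
  refine ⟨fun i => n (Pi.single i 1), ?_⟩
  have h1 : S.map (Int.cast : ℤ → ℝ) * (W.transpose * !![0, 1; 1, 0] * W) = 1 :=
    mul_eq_one_comm.mp h.gram_mul
  have h2 : toReal (fun i => n (Pi.single i 1)) =
      (W.transpose * !![0, 1; 1, 0] * W).mulVec (toReal a) := by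
    ext i
    have h3 := hn (Pi.single i 1)
    rw [pairing_eq_dotProduct, show toReal (Pi.single i 1) = Pi.single i 1 by
      ext j; by_cases hj : j = i <;> simp [toReal, hj],
      single_one_dotProduct] at h3
    exact h3.symm
  have h4 : toReal (S.mulVec fun i => n (Pi.single i 1)) = toReal a := by
    rw [toReal_mulVec, h2, Matrix.mulVec_mulVec, h1, Matrix.one_mulVec]
  ext i
  have h5 := congrFun h4 i
  simp only [toReal] at h5
  exact_mod_cast h5.symm

end IsDualForm

/-- The finite group `ℤ²/Sℤ²`. -/
abbrev DiscGroup (S : Matrix (Fin 2) (Fin 2) ℤ) : Type :=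
  (Fin 2 → ℤ) ⧸ LinearMap.range S.mulVecLin

namespace DiscGroup

/-- The class of an integral vector. -/
def cls (S : Matrix (Fin 2) (Fin 2) ℤ) (a : Fin 2 → ℤ) : DiscGroup S :=
  (LinearMap.range S.mulVecLin).mkQ a

/-- A representative of a class. -/
def rep (x : DiscGroup S) : Fin 2 → ℤ :=
  Function.surjInv (Submodule.mkQ_surjective (LinearMap.range S.mulVecLin)) x

@[simp]
theorem cls_rep (x : DiscGroup S) : cls S (rep x) = x :=
  Function.surjInv_eq (Submodule.mkQ_surjective (LinearMap.range S.mulVecLin)) x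

theorem cls_surjective : Function.Surjective (cls S) := fun x => ⟨rep x, cls_rep x⟩

theorem cls_add (a b : Fin 2 → ℤ) : cls S (a + b) = cls S a + cls S b := map_add _ a b

theorem cls_neg (a : Fin 2 → ℤ) : cls S (-a) = -cls S a := map_neg _ a

theorem cls_zero : cls S 0 = 0 := map_zero _

theorem cls_mulVec (l : Fin 2 → ℤ) : cls S (S.mulVec l) = 0 := by
  rw [cls, Submodule.mkQ_apply, Submodule.Quotient.mk_eq_zero]
  exact ⟨l, rfl⟩

theorem cls_eq_cls_iff {a b : Fin 2 → ℤ} : cls S a = cls S b ↔ ∃ l, a = b + S.mulVec l := by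
  rw [cls, cls, Submodule.mkQ_apply, Submodule.mkQ_apply, Submodule.Quotient.eq]
  constructor
  · rintro ⟨l, hl⟩
    exact ⟨l, by rw [← Matrix.mulVecLin_apply, hl]; abel⟩
  · rintro ⟨l, rfl⟩
    exact ⟨l, by simp⟩

end DiscGroup

theorem IsDualForm.natCard_discGroup (h : IsDualForm W S) :
    Nat.card (DiscGroup S) = S.det.natAbs := by
  let e : (Fin 2 → ℤ) ≃ₗ[ℤ] LinearMap.range S.mulVecLin :=
    LinearEquiv.ofInjective S.mulVecLin h.mulVec_injective
  have h1 := Submodule.natAbs_det_equiv (LinearMap.range S.mulVecLin) e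
  -- Followed by the inclusion into ℤ², the isomorphism of ℤ² with Sℤ² is S itself, so the index of
  -- Sℤ² is |det S|.
  rw [← h1]
  have h2 : (LinearMap.range S.mulVecLin).subtype ∘ₗ
      AddMonoidHom.toIntLinearMap (e : (Fin 2 → ℤ) →+ LinearMap.range S.mulVecLin) =
      Matrix.toLin' S := by
    ext i j
    change S.mulVec (Pi.single i 1) j = Matrix.toLin' S (Pi.single i 1) j
    rw [Matrix.toLin'_apply]
  rw [h2, LinearMap.det_toLin']

theorem IsDualForm.finite_discGroup (h : IsDualForm W S) : Finite (DiscGroup S) :=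
  Nat.finite_of_card_ne_zero (by
    rw [h.natCard_discGroup]; exact Int.natAbs_ne_zero.mpr h.det_ne_zero)

end

end IndefTheta

/-! ### The finite Weil representation and the Heisenberg operators -/

namespace IndefTheta

noncomputable section

variable {W : Matrix (Fin 2) (Fin 2) ℝ} {S : Matrix (Fin 2) (Fin 2) ℤ}

open DiscGroup

/-- The bicharacter `e(⟨x, y⟩)` on `ℤ²/Sℤ²`. -/
def chi (W : Matrix (Fin 2) (Fin 2) ℝ) (x y : DiscGroup S) : ℂ := unitExp (pairing W (rep x) (rep y))

/-- Pairings of integral vectors with Sℤ² are integers, so they disappear under e(·); this lets the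
bicharacter descend to the discriminant group. -/
theorem IsDualForm.unitExp_pairing_congr (h : IsDualForm W S) {a a' b b' : Fin 2 → ℤ}
    (ha : cls S a = cls S a') (hb : cls S b = cls S b') :
    unitExp (pairing W a b) = unitExp (pairing W a' b') := by
  obtain ⟨l, rfl⟩ := cls_eq_cls_iff.mp ha
  obtain ⟨k, rfl⟩ := cls_eq_cls_iff.mp hb
  rw [pairing_add_right, pairing_add_left, h.pairing_mulVec_right, h.pairing_mulVec_left, add_assoc,
    ← Int.cast_add, unitExp_add_intCast]

theorem IsDualForm.chi_mk (h : IsDualForm W S) (a b : Fin 2 → ℤ) :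
    chi W (cls S a) (cls S b) = unitExp (pairing W a b) :=
  h.unitExp_pairing_congr (cls_rep _) (cls_rep _)

theorem chi_comm (x y : DiscGroup S) : chi W x y = chi W y x := by
  rw [chi, chi, pairing_comm]

theorem IsDualForm.chi_add_right (h : IsDualForm W S) (x y z : DiscGroup S) :
    chi W x (y + z) = chi W x y * chi W x z := by
  obtain ⟨a, rfl⟩ := cls_surjective x
  obtain ⟨b, rfl⟩ := cls_surjective y
  obtain ⟨c, rfl⟩ := cls_surjective z
  rw [← cls_add, h.chi_mk, h.chi_mk, h.chi_mk, pairing_add_right, unitExp_add]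

theorem IsDualForm.chi_add_left (h : IsDualForm W S) (x y z : DiscGroup S) :
    chi W (x + y) z = chi W x z * chi W y z := by
  rw [chi_comm, h.chi_add_right, chi_comm z x, chi_comm z y]

theorem IsDualForm.chi_zero_right (h : IsDualForm W S) (x : DiscGroup S) : chi W x 0 = 1 := by
  obtain ⟨a, rfl⟩ := cls_surjective x
  rw [← cls_zero, h.chi_mk, ← zero_smul ℤ (0 : Fin 2 → ℤ), pairing_smul_right]
  simp [unitExp_zero]

theorem IsDualForm.chi_neg_right (h : IsDualForm W S) (x y : DiscGroup S) :
    chi W x (-y) = (starRingEnd ℂ) (chi W x y) := by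
  obtain ⟨a, rfl⟩ := cls_surjective x
  obtain ⟨b, rfl⟩ := cls_surjective y
  rw [← cls_neg, h.chi_mk, h.chi_mk, pairing_neg_right, conj_unitExp]

/-- Nondegeneracy: a vector whose pairings with ℤ² are all integral already lies in Sℤ². -/
theorem IsDualForm.exists_chi_ne_one (h : IsDualForm W S) {x : DiscGroup S} (hx : x ≠ 0) :
    ∃ y, chi W y x ≠ 1 := by
  by_contra! hc
  obtain ⟨a, rfl⟩ := cls_surjective x
  obtain ⟨l, rfl⟩ := h.exists_eq_mulVec (a := a) fun b => by
    rw [← unitExp_eq_one_iff, ← h.chi_mk]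
    exact hc _
  exact hx (cls_mulVec l)

/-- Orthogonality of characters: translation of the summation variable by z multiplies the sum by
χ(z, x), which can be chosen different from 1. -/
theorem IsDualForm.sum_chi (h : IsDualForm W S) [Fintype (DiscGroup S)] {x : DiscGroup S}
    (hx : x ≠ 0) : ∑ y, chi W y x = 0 := by
  obtain ⟨z, hz⟩ := h.exists_chi_ne_one hx
  have h1 : ∑ y, chi W y x = chi W z x * ∑ y, chi W y x := by
    rw [Finset.mul_sum, ← Equiv.sum_comp (Equiv.addLeft z)]
    simp only [Equiv.coe_addLeft, h.chi_add_left]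
  have h2 : (chi W z x - 1) * ∑ y, chi W y x = 0 := by linear_combination -h1
  exact (mul_eq_zero.mp h2).resolve_left (sub_ne_zero.mpr hz)

/-- The quadratic character `e(⟨x, x⟩/2)` on `ℤ²/Sℤ²`. -/
def quadChar (W : Matrix (Fin 2) (Fin 2) ℝ) (x : DiscGroup S) : ℂ :=
  unitExp (pairing W (rep x) (rep x) / 2)

/-- Replacing a by a + Sl changes half the self-pairing by a·l + (l·Sl)/2, which is an integer
because S is even. -/
theorem IsDualForm.quadChar_mk (h : IsDualForm W S) (a : Fin 2 → ℤ) :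
    quadChar W (cls S a) = unitExp (pairing W a a / 2) := by
  obtain ⟨l, hl⟩ := cls_eq_cls_iff.mp (cls_rep (cls S a))
  obtain ⟨n, hn⟩ := h.even l
  rw [quadChar, hl, pairing_add_right, pairing_add_left, pairing_add_left, h.pairing_mulVec_right,
    h.pairing_mulVec_right, h.pairing_mulVec_left,
    ← unitExp_add_intCast (pairing W a a / 2) (a ⬝ᵥ l + n), dotProduct_comm (S.mulVec l), hn]
  congr 1
  push_cast
  ring

/-- The action of the translation `τ ↦ τ + 1` in the Weil representation. -/
def weilT (W : Matrix (Fin 2) (Fin 2) ℝ) (S : Matrix (Fin 2) (Fin 2) ℤ) :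
    (DiscGroup S → ℂ) →ₗ[ℂ] (DiscGroup S → ℂ) where
  toFun m x := quadChar W x * m x
  map_add' m m' := by ext x; simp [mul_add]
  map_smul' c m := by ext x; simp [mul_left_comm]

/-- The action of the inversion `τ ↦ -1/τ` in the Weil representation. -/
def weilS (W : Matrix (Fin 2) (Fin 2) ℝ) (S : Matrix (Fin 2) (Fin 2) ℤ) [Fintype (DiscGroup S)] :
    (DiscGroup S → ℂ) →ₗ[ℂ] (DiscGroup S → ℂ) where
  toFun m x := ((Real.sqrt |(S.det : ℝ)|)⁻¹ : ℝ) * ∑ y, chi W x (-y) * m y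
  map_add' m m' := by ext x; simp [mul_add, Finset.sum_add_distrib]
  map_smul' c m := by
    ext x
    simp only [Pi.smul_apply, smul_eq_mul, RingHom.id_apply, Finset.mul_sum]
    exact Finset.sum_congr rfl fun y _ => by ring

/-- The operators of the Heisenberg group, in the Schrödinger model on functions on `ℤ²/Sℤ²`. -/
def heis (W : Matrix (Fin 2) (Fin 2) ℝ) (a b : Fin 2 → ℤ) (m : DiscGroup S → ℂ) :
    DiscGroup S → ℂ :=
  fun x => unitExp (pairing W a b / 2) * chi W (cls S b) x * m (x + cls S a)

/-- The symmetrizing phase e(⟨a, b⟩/2) in `heis` absorbs the value of the quadratic character at a,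
so that the parameters transform linearly with no further factor. -/
theorem IsDualForm.weilT_heis (h : IsDualForm W S) (a b : Fin 2 → ℤ) (m : DiscGroup S → ℂ) :
    weilT W S (heis W a b m) = heis W a (b - a) (weilT W S m) := by
  ext x
  obtain ⟨k, rfl⟩ := cls_surjective x
  simp only [weilT, heis, LinearMap.coe_mk, AddHom.coe_mk, ← cls_add, h.quadChar_mk, h.chi_mk,
    ← mul_assoc, ← unitExp_add]
  congr 2
  simp only [sub_eq_add_neg, pairing_add_left, pairing_add_right, pairing_neg_left,
    pairing_neg_right, pairing_comm W k a]
  ring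

/-- The finite Fourier transform exchanges translations and modulations; the proof shifts the
summation variable by a. -/
theorem IsDualForm.weilS_heis (h : IsDualForm W S) [Fintype (DiscGroup S)] (a b : Fin 2 → ℤ)
    (m : DiscGroup S → ℂ) : weilS W S (heis W a b m) = heis W (-b) a (weilS W S m) := by
  ext x
  obtain ⟨k, rfl⟩ := cls_surjective x
  simp only [weilS, heis, LinearMap.coe_mk, AddHom.coe_mk]
  rw [mul_left_comm (unitExp _ * _)]
  congr 1
  rw [← Equiv.sum_comp (Equiv.subRight (cls S a)), Finset.mul_sum]
  refine Finset.sum_congr rfl fun y _ => ?_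
  obtain ⟨l, rfl⟩ := cls_surjective y
  simp only [Equiv.subRight_apply, sub_add_cancel, ← mul_assoc]
  simp only [sub_eq_add_neg, ← cls_neg, ← cls_add, h.chi_mk, ← unitExp_add]
  congr 2
  simp only [pairing_add_left, pairing_add_right, pairing_neg_left, pairing_neg_right,
    pairing_comm W k a, pairing_comm W b a]
  ring

theorem sum_norm_sq_weilT [Fintype (DiscGroup S)] (m : DiscGroup S → ℂ) :
    ∑ x, ‖weilT W S m x‖ ^ 2 = ∑ x, ‖m x‖ ^ 2 := by
  refine Finset.sum_congr rfl fun x _ => ?_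
  simp only [weilT, LinearMap.coe_mk, AddHom.coe_mk, norm_mul, quadChar, norm_unitExp, one_mul]

/-- Parseval, from the orthogonality of characters; the normalization matches because the group has
order |det S|. -/
theorem IsDualForm.sum_norm_sq_weilS (h : IsDualForm W S) [Fintype (DiscGroup S)]
    (m : DiscGroup S → ℂ) : ∑ x, ‖weilS W S m x‖ ^ 2 = ∑ x, ‖m x‖ ^ 2 := by
  classical
  have hdet : 0 < |(S.det : ℝ)| := abs_pos.mpr (by exact_mod_cast h.det_ne_zero)
  have hcard : (Fintype.card (DiscGroup S) : ℂ) = (|(S.det : ℝ)| : ℝ) := by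
    rw [← Nat.card_eq_fintype_card, h.natCard_discGroup]
    rw [← Int.cast_abs, ← Nat.cast_natAbs, Complex.ofReal_natCast]
  have key : ∑ x, (∑ y, chi W x (-y) * m y) * (starRingEnd ℂ) (∑ y, chi W x (-y) * m y) =
      (|(S.det : ℝ)| : ℝ) * ∑ x, m x * (starRingEnd ℂ) (m x) := by
    simp_rw [map_sum, Finset.sum_mul_sum]
    rw [Finset.sum_comm, Finset.mul_sum]
    refine Finset.sum_congr rfl fun y _ => ?_
    rw [Finset.sum_comm]
    have h1 : ∀ z, ∑ x, chi W x (-y) * m y * (starRingEnd ℂ) (chi W x (-z) * m z) =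
        if z = y then (|(S.det : ℝ)| : ℝ) * (m y * (starRingEnd ℂ) (m y)) else 0 := by
      intro z
      have h2 : ∀ x, chi W x (-y) * m y * (starRingEnd ℂ) (chi W x (-z) * m z) =
          (m y * (starRingEnd ℂ) (m z)) * chi W x (z - y) := by
        intro x
        rw [map_mul, ← h.chi_neg_right, neg_neg, sub_eq_add_neg, h.chi_add_right]
        ring
      simp_rw [h2, ← Finset.mul_sum]
      split_ifs with hz
      · subst hz
        simp only [sub_self, h.chi_zero_right]
        rw [Finset.sum_const, Finset.card_univ, nsmul_eq_mul, hcard]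
        ring
      · rw [h.sum_chi (sub_ne_zero.mpr hz), mul_zero]
    simp_rw [h1]
    simp
  have h3 : ∀ f : DiscGroup S → ℂ, ((∑ x, ‖f x‖ ^ 2 : ℝ) : ℂ) =
      ∑ x, f x * (starRingEnd ℂ) (f x) := by
    intro f
    push_cast
    exact Finset.sum_congr rfl fun x _ => (Complex.mul_conj' _).symm
  have h4 : ∀ x, ‖weilS W S m x‖ ^ 2 =
      |(S.det : ℝ)|⁻¹ * ‖∑ y, chi W x (-y) * m y‖ ^ 2 := by
    intro x
    simp only [weilS, LinearMap.coe_mk, AddHom.coe_mk]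
    rw [norm_mul, mul_pow, Complex.norm_real, Real.norm_eq_abs, sq_abs, inv_pow,
      Real.sq_sqrt hdet.le]
  have h5 : ∑ x, ‖∑ y, chi W x (-y) * m y‖ ^ 2 = |(S.det : ℝ)| * ∑ x, ‖m x‖ ^ 2 := by
    have := key
    rw [← h3, ← h3] at this
    exact_mod_cast this
  simp_rw [h4, ← Finset.mul_sum, h5]
  field_simp

/-- A linear operator on functions on `ℤ²/Sℤ²` that commutes with the Heisenberg operators is
scalar. -/
theorem IsDualForm.exists_scalar (h : IsDualForm W S) [Fintype (DiscGroup S)]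
    (R : (DiscGroup S → ℂ) →ₗ[ℂ] (DiscGroup S → ℂ))
    (hR : ∀ a b m, R (heis W a b m) = heis W a b (R m)) : ∃ c : ℂ, ∀ m, R m = c • m := by
  classical
  set δ : DiscGroup S → (DiscGroup S → ℂ) := fun x => Pi.single x 1
  -- Modulations fix δ₀, hence also Rδ₀. At y ≠ 0 some modulation has a factor other than 1, so Rδ₀
  -- vanishes there.
  have h0 : ∀ y, y ≠ 0 → R (δ 0) y = 0 := by
    intro y hy
    obtain ⟨z, hz⟩ := h.exists_chi_ne_one hy
    obtain ⟨b, rfl⟩ := cls_surjective z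
    have h1 : heis W 0 b (δ 0) = δ 0 := by
      ext x
      by_cases hx : x = 0
      · subst hx
        rw [heis, ← zero_smul ℤ (0 : Fin 2 → ℤ), pairing_smul_left, h.chi_zero_right]
        simp [unitExp_zero, cls_zero]
      · simp [heis, cls_zero, δ, hx]
    have h2 := congrFun (hR 0 b (δ 0)) y
    rw [h1, heis, ← zero_smul ℤ (0 : Fin 2 → ℤ), pairing_smul_left] at h2
    simp only [Int.cast_zero, zero_mul, zero_div, unitExp_zero, one_mul, zero_smul, cls_zero,
      add_zero] at h2
    have h3 : (chi W (cls S b) y - 1) * R (δ 0) y = 0 := by linear_combination -h2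
    exact (mul_eq_zero.mp h3).resolve_left (sub_ne_zero.mpr hz)
  obtain ⟨c, hc⟩ : ∃ c, R (δ 0) 0 = c := ⟨_, rfl⟩
  refine ⟨c, fun m => ?_⟩
  -- Every δ_x is a translate of δ₀ and R commutes with translations, so the constant is the same
  -- for all x.
  have h1 : ∀ x, R (δ x) = c • δ x := by
    intro x
    obtain ⟨a, rfl⟩ := cls_surjective x
    have h2 : ∀ f : DiscGroup S → ℂ, heis W (-a) 0 f = fun y => f (y - cls S a) := by
      intro f
      ext y
      rw [heis, ← zero_smul ℤ (0 : Fin 2 → ℤ), pairing_smul_right, zero_smul, cls_zero, chi_comm,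
        h.chi_zero_right, cls_neg, ← sub_eq_add_neg]
      simp [unitExp_zero]
    have h3 : δ (cls S a) = heis W (-a) 0 (δ 0) := by
      rw [h2]
      ext y
      simp [δ, Pi.single_apply, sub_eq_zero]
    rw [h3, hR, h2, h2]
    ext y
    simp only [Pi.smul_apply, smul_eq_mul]
    by_cases hy : y - cls S a = 0
    · simp [hy, δ, ← hc]
    · rw [h0 _ hy]
      simp [δ, hy]
  have h2 : m = ∑ x, m x • δ x := by
    ext y
    simp [δ, Finset.sum_apply, Pi.single_apply]
  conv_lhs => rw [h2]
  conv_rhs => rw [h2]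
  simp_rw [map_sum, map_smul, h1, Finset.smul_sum]
  exact Finset.sum_congr rfl fun x _ => smul_comm _ _ _

end

end IndefTheta

/-! ### The theta functions and their behaviour under the generators of SL₂(ℤ) -/

namespace IndefTheta

noncomputable section

/-- The Gaussian `exp(2πi ab x - π (e⁻²ᵗa² + e²ᵗb²) y)` at `(a, b) = Wk`. -/
def latticeKernel (W : Matrix (Fin 2) (Fin 2) ℝ) (x y t : ℝ) (k : Fin 2 → ℤ) : ℂ :=
  gaussKernel x y (Real.exp (-t) * W.mulVec (toReal k) 0) (Real.exp t * W.mulVec (toReal k) 1)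

/-- The theta function `y^{1/2} ∑ m(k) exp(2πi ab x - π (e⁻²ᵗa² + e²ᵗb²) y)`, `(a, b) = Wk`. -/
def theta (W : Matrix (Fin 2) (Fin 2) ℝ) (m : (Fin 2 → ℤ) → ℂ) (t : ℝ) (τ : ℍ) : ℂ :=
  (Real.sqrt τ.im : ℝ) * ∑' k, m k * latticeKernel W τ.re τ.im t k

theorem summable_exp_neg_lattice {c : ℝ} (hc : 0 < c) :
    Summable fun k : Fin 2 → ℤ => Real.exp (-(c * ((k 0 : ℝ) ^ 2 + (k 1 : ℝ) ^ 2))) := by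
  rw [← (finTwoArrowEquiv ℤ).symm.summable_iff]
  refine (summable_exp_neg_sq_add_sq hc 0).congr fun k => ?_
  simp

/-- Both weights e^{±t} are at least e^{-T}. The uniformity in t is what later allows sums over the
lattice to be integrated termwise over bounded intervals. -/
theorem exists_pos_mul_le_mulVec {W : Matrix (Fin 2) (Fin 2) ℝ} (hW : W.det ≠ 0) (T : ℝ) :
    ∃ c > 0, ∀ t, |t| ≤ T → ∀ k : Fin 2 → ℤ, c * ((k 0 : ℝ) ^ 2 + (k 1 : ℝ) ^ 2) ≤
      Real.pi * ((Real.exp (-t) * W.mulVec (toReal k) 0) ^ 2 +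
        (Real.exp t * W.mulVec (toReal k) 1) ^ 2) := by
  rw [Matrix.det_fin_two] at hW
  obtain ⟨c, hc, h⟩ := exists_pos_mul_le_sq_add_sq hW
  refine ⟨Real.pi * (Real.exp (-T)) ^ 2 * c, by positivity, fun t ht k => ?_⟩
  rw [abs_le] at ht
  have h1 : Real.exp (-T) ≤ Real.exp (-t) := Real.exp_le_exp.mpr (by linarith)
  have h2 : Real.exp (-T) ≤ Real.exp t := Real.exp_le_exp.mpr (by linarith)
  have h3 := pow_le_pow_left₀ (Real.exp_pos _).le h1 2
  have h4 := pow_le_pow_left₀ (Real.exp_pos _).le h2 2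
  have h5 := h (k 0) (k 1)
  have e0 : W.mulVec (toReal k) 0 = W 0 0 * k 0 + W 0 1 * k 1 := by
    simp [Matrix.mulVec, dotProduct, toReal]
  have e1 : W.mulVec (toReal k) 1 = W 1 0 * k 0 + W 1 1 * k 1 := by
    simp [Matrix.mulVec, dotProduct, toReal]
  rw [e0, e1, mul_pow, mul_pow, mul_assoc, mul_assoc]
  refine mul_le_mul_of_nonneg_left ?_ Real.pi_pos.le
  calc Real.exp (-T) ^ 2 * (c * ((k 0 : ℝ) ^ 2 + (k 1 : ℝ) ^ 2)) ≤ Real.exp (-T) ^ 2 *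
        ((W 0 0 * k 0 + W 0 1 * k 1) ^ 2 + (W 1 0 * k 0 + W 1 1 * k 1) ^ 2) := by gcongr
    _ ≤ _ := by rw [mul_add]; gcongr

theorem norm_latticeKernel (W : Matrix (Fin 2) (Fin 2) ℝ) (x y t : ℝ) (k : Fin 2 → ℤ) :
    ‖latticeKernel W x y t k‖ = Real.exp (-(Real.pi * ((Real.exp (-t) * W.mulVec (toReal k) 0) ^ 2 +
        (Real.exp t * W.mulVec (toReal k) 1) ^ 2) * y)) := norm_gaussKernel _ _ _ _

theorem exists_norm_latticeKernel_le {W : Matrix (Fin 2) (Fin 2) ℝ} (hW : W.det ≠ 0) (T : ℝ) :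
    ∃ c > 0, ∀ t, |t| ≤ T → ∀ x y, 0 ≤ y → ∀ k : Fin 2 → ℤ, ‖latticeKernel W x y t k‖ ≤
      Real.exp (-((c * y) * ((k 0 : ℝ) ^ 2 + (k 1 : ℝ) ^ 2))) := by
  obtain ⟨c, hc, h⟩ := exists_pos_mul_le_mulVec hW T
  refine ⟨c, hc, fun t ht x y hy k => ?_⟩
  rw [norm_latticeKernel]
  apply Real.exp_le_exp.mpr
  nlinarith [mul_le_mul_of_nonneg_right (h t ht k) hy]

theorem summable_mul_latticeKernel {W : Matrix (Fin 2) (Fin 2) ℝ} (hW : W.det ≠ 0)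
    {m : (Fin 2 → ℤ) → ℂ} {C : ℝ} (hm : ∀ k, ‖m k‖ ≤ C) (x : ℝ) {y : ℝ} (hy : 0 < y) (t : ℝ) :
    Summable fun k => m k * latticeKernel W x y t k := by
  obtain ⟨c, hc, h⟩ := exists_norm_latticeKernel_le hW |t|
  refine Summable.of_norm_bounded
    ((summable_exp_neg_lattice (mul_pos hc hy)).mul_left C) fun k => ?_
  rw [norm_mul]
  exact mul_le_mul (hm k) (h t le_rfl x y hy.le k) (norm_nonneg _)
    ((norm_nonneg _).trans (hm k))

theorem latticeKernel_neg (W : Matrix (Fin 2) (Fin 2) ℝ) (x y t : ℝ) (k : Fin 2 → ℤ) :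
    latticeKernel W x y t (-k) = latticeKernel W x y t k := by
  simp only [latticeKernel, gaussKernel, toReal_neg, Matrix.mulVec_neg, Pi.neg_apply, mul_neg,
    neg_mul, neg_neg, neg_sq]

theorem latticeKernel_add_one (W : Matrix (Fin 2) (Fin 2) ℝ) (x y t : ℝ) (k : Fin 2 → ℤ) :
    latticeKernel W (x + 1) y t k = unitExp (pairing W k k / 2) * latticeKernel W x y t k := by
  rw [latticeKernel, latticeKernel, gaussKernel, gaussKernel, unitExp, ← Complex.exp_add, pairing]
  congr 1
  have h : Real.exp (-t) * Real.exp t = 1 := by rw [← Real.exp_add]; simp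
  generalize Real.exp (-t) = u at *
  generalize Real.exp t = v at *
  generalize W.mulVec (toReal k) 0 = a at *
  generalize W.mulVec (toReal k) 1 = b at *
  have hc : (u : ℂ) * v = 1 := by exact_mod_cast h
  push_cast
  linear_combination (2 * Real.pi * a * b * Complex.I) * hc

variable {W : Matrix (Fin 2) (Fin 2) ℝ} {S : Matrix (Fin 2) (Fin 2) ℤ}

open DiscGroup

/-- A sum over `ℤ²`, arranged by classes modulo `Sℤ²`. -/
theorem IsDualForm.tsum_eq_sum_tsum (h : IsDualForm W S) [Fintype (DiscGroup S)]
    {f : (Fin 2 → ℤ) → ℂ} (hf : Summable f) :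
    ∑' k, f k = ∑ x : DiscGroup S, ∑' l, f (rep x + S.mulVec l) := by
  have hb : Function.Bijective
      (fun p : DiscGroup S × (Fin 2 → ℤ) => rep p.1 + S.mulVec p.2) := by
    constructor
    · rintro ⟨x, l⟩ ⟨x', l'⟩ hxl
      have h1 := congrArg (cls S) hxl
      simp only [cls_add, cls_mulVec, cls_rep, add_zero] at h1
      subst h1
      exact congrArg (Prod.mk x) (h.mulVec_injective (add_left_cancel hxl))
    · intro k
      obtain ⟨l, hl⟩ := cls_eq_cls_iff.mp (cls_rep (cls S k)).symm
      exact ⟨(cls S k, l), hl.symm⟩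
  let e := Equiv.ofBijective _ hb
  have hs : Summable fun p => f (e p) := e.summable_iff.mpr hf
  rw [← e.tsum_eq, Summable.tsum_prod hs, tsum_fintype]
  rfl

theorem IsDualForm.det_left_ne_zero (h : IsDualForm W S) : W.det ≠ 0 := fun h0 => by
  have := h.det_sq_mul
  simp [h0] at this

/-- Poisson summation for the lattice with basis V = WS and shift ρ = S⁻¹a. With respect to the
swapped pairing the dual basis of V is W, so the dual sum runs over Wℤ². The swap also exchanges the
weights e^{±t} back, so t is unchanged. -/
theorem IsDualForm.tsum_latticeKernel (h : IsDualForm W S) (x : ℝ) {y : ℝ} (hy : 0 < y) (t : ℝ)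
    (a : Fin 2 → ℤ) :
    ∑' l, latticeKernel W x y t (a + S.mulVec l) =
      1 / ((Real.sqrt |(S.det : ℝ)| * Real.sqrt (x ^ 2 + y ^ 2) : ℝ) : ℂ) *
        ∑' k, unitExp (-pairing W k a) *
          latticeKernel W (-x / (x ^ 2 + y ^ 2)) (y / (x ^ 2 + y ^ 2)) t k := by
  set V := W * S.map (Int.cast : ℤ → ℝ) with hV
  set ρ := (W.transpose * !![0, 1; 1, 0] * W).mulVec (toReal a) with hρ
  have hdetS : (S.map (Int.cast : ℤ → ℝ)).det = (S.det : ℝ) :=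
    ((Int.castRingHom ℝ).map_det S).symm
  have hdetV : V 0 0 * V 1 1 - V 0 1 * V 1 0 = W.det * S.det := by
    rw [← Matrix.det_fin_two, hV, Matrix.det_mul, hdetS]
  have hne : W.det * S.det ≠ 0 :=
    mul_ne_zero h.det_left_ne_zero (by exact_mod_cast h.det_ne_zero)
  -- From (det W)² det S = −1, which says that the covolume of the even lattice is √|det S|.
  have habs : |W.det * S.det| = Real.sqrt |(S.det : ℝ)| := by
    rw [eq_comm, Real.sqrt_eq_iff_mul_self_eq (abs_nonneg _) (abs_nonneg _), ← abs_mul]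
    rw [show W.det * S.det * (W.det * S.det) = (W.det ^ 2 * S.det) * S.det by ring, h.det_sq_mul,
      neg_one_mul, abs_neg]
  have hinv : !![0, 1; 1, 0] * V * W.transpose = 1 := by
    apply mul_eq_one_comm.mp
    rw [hV, ← h.gram_mul]
    simp only [Matrix.mul_assoc]
  have i00 : V 1 0 * W 0 0 + V 1 1 * W 0 1 = 1 := by
    simpa [Matrix.mul_apply, Fin.sum_univ_two, Matrix.vecMul, dotProduct] using congrFun₂ hinv 0 0
  have i01 : V 1 0 * W 1 0 + V 1 1 * W 1 1 = 0 := by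
    simpa [Matrix.mul_apply, Fin.sum_univ_two, Matrix.vecMul, dotProduct] using congrFun₂ hinv 0 1
  have i10 : V 0 0 * W 0 0 + V 0 1 * W 0 1 = 0 := by
    simpa [Matrix.mul_apply, Fin.sum_univ_two, Matrix.vecMul, dotProduct] using congrFun₂ hinv 1 0
  have i11 : V 0 0 * W 1 0 + V 0 1 * W 1 1 = 1 := by
    simpa [Matrix.mul_apply, Fin.sum_univ_two, Matrix.vecMul, dotProduct] using congrFun₂ hinv 1 1
  have hu : Real.exp (-t) * Real.exp t = 1 := by rw [← Real.exp_add]; simp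
  have hWa : ∀ l : Fin 2 → ℤ, W.mulVec (toReal (a + S.mulVec l)) = V.mulVec (toReal l + ρ) := by
    intro l
    rw [toReal_add, toReal_mulVec, Matrix.mulVec_add, Matrix.mulVec_add, hρ, hV,
      Matrix.mulVec_mulVec, Matrix.mulVec_mulVec, Matrix.mul_assoc W,
      mul_eq_one_comm.mp h.gram_mul, Matrix.mul_one, add_comm]
  have hD : Real.exp (-t) * V 0 0 * (Real.exp t * V 1 1) -
      Real.exp (-t) * V 0 1 * (Real.exp t * V 1 0) = W.det * S.det := by
    rw [← hdetV]
    linear_combination (V 0 0 * V 1 1 - V 0 1 * V 1 0) * hu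
  have key := tsum_gaussKernel_add (p := Real.exp (-t) * V 0 0) (q := Real.exp (-t) * V 0 1)
    (r := Real.exp t * V 1 0) (s := Real.exp t * V 1 1) (by rw [hD]; exact hne) x hy (ρ 0) (ρ 1)
  rw [hD, habs] at key
  -- The reflection k ↦ −k reconciles the sign of the character with the Poisson formula; the kernel
  -- is even.
  rw [← (finTwoArrowEquiv ℤ).symm.tsum_eq,
    ← (Equiv.neg (Fin 2 → ℤ)).tsum_eq (fun k => unitExp (-pairing W k a) * _),
    ← (finTwoArrowEquiv ℤ).symm.tsum_eq]
  convert key using 1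
  · refine tsum_congr fun n => ?_
    rw [latticeKernel, hWa]
    congr 1 <;> simp [Matrix.mulVec, dotProduct, toReal] <;> ring
  · congr 1
    refine tsum_congr fun n => ?_
    rw [Equiv.neg_apply, pairing_neg_left, neg_neg, latticeKernel_neg, latticeKernel]
    congr 1
    · rw [unitExp, pairing_eq_dotProduct, ← hρ]
      congr 1
      simp [dotProduct, toReal]
      ring
    · congr 1
      · rw [eq_div_iff hne, ← hdetV]
        simp [Matrix.mulVec, dotProduct, toReal]
        linear_combination (Real.exp (-t) * n.1) * (V 1 1 * i10 - V 0 1 * i00) +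
          (Real.exp (-t) * n.2) * (V 0 0 * i00 - V 1 0 * i10)
      · rw [eq_div_iff hne, ← hdetV]
        simp [Matrix.mulVec, dotProduct, toReal]
        linear_combination (Real.exp t * n.1) * (V 1 1 * i11 - V 0 1 * i01) +
          (Real.exp t * n.2) * (V 0 0 * i01 - V 1 0 * i11)

theorem re_S_smul (τ : ℍ) :
    (ModularGroup.S • τ).re = -τ.re / (τ.re ^ 2 + τ.im ^ 2) := by
  rw [UpperHalfPlane.modular_S_smul, ← UpperHalfPlane.coe_re, UpperHalfPlane.coe_mk,
    Complex.inv_re, Complex.normSq_apply]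
  simp [pow_two]

theorem im_S_smul (τ : ℍ) :
    (ModularGroup.S • τ).im = τ.im / (τ.re ^ 2 + τ.im ^ 2) := by
  rw [UpperHalfPlane.modular_S_smul, ← UpperHalfPlane.coe_im, UpperHalfPlane.coe_mk,
    Complex.inv_im, Complex.normSq_apply]
  simp [pow_two]

/-- Summing over the classes modulo Sℤ², the characters from Poisson summation assemble into the
finite Fourier transform of the coefficients. The weight is 0 because √(Im τ') / |τ'| = √(Im τ) for
τ' = −1/τ. -/
theorem IsDualForm.theta_S_smul (h : IsDualForm W S) [Fintype (DiscGroup S)]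
    (m : DiscGroup S → ℂ) (t : ℝ) (τ : ℍ) :
    theta W (fun k => m (cls S k)) t (ModularGroup.S • τ) =
      theta W (fun k => weilS W S m (cls S k)) t τ := by
  set τ' := ModularGroup.S • τ with hτ'
  have hy := τ.im_pos
  have hy' := τ'.im_pos
  have hN : 0 < τ.re ^ 2 + τ.im ^ 2 := by positivity
  have hN' : τ'.re ^ 2 + τ'.im ^ 2 = (τ.re ^ 2 + τ.im ^ 2)⁻¹ := by
    rw [hτ', re_S_smul, im_S_smul]
    field_simp
  have hre : -τ'.re / (τ'.re ^ 2 + τ'.im ^ 2) = τ.re := by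
    rw [hN', hτ', re_S_smul]
    field_simp
  have him : τ'.im / (τ'.re ^ 2 + τ'.im ^ 2) = τ.im := by
    rw [hN', hτ', im_S_smul]
    field_simp
  obtain ⟨C, hC⟩ : ∃ C, ∀ x, ‖m x‖ ≤ C := ⟨∑ x, ‖m x‖, fun x =>
    Finset.single_le_sum (f := fun x => ‖m x‖) (fun _ _ => norm_nonneg _) (Finset.mem_univ x)⟩
  have hs : ∀ a : Fin 2 → ℤ, Summable fun k => unitExp (-pairing W k a) *
      latticeKernel W τ.re τ.im t k := fun a =>
    summable_mul_latticeKernel h.det_left_ne_zero (fun k => (norm_unitExp _).le) _ hy t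
  rw [theta, theta, h.tsum_eq_sum_tsum
    (summable_mul_latticeKernel h.det_left_ne_zero (fun k => hC _) _ hy' t)]
  have h1 : ∀ x : DiscGroup S, ∑' l, m (cls S (rep x + S.mulVec l)) *
      latticeKernel W τ'.re τ'.im t (rep x + S.mulVec l) =
      1 / ((Real.sqrt |(S.det : ℝ)| * Real.sqrt (τ'.re ^ 2 + τ'.im ^ 2) : ℝ) : ℂ) *
        ∑' k, m x * (unitExp (-pairing W k (rep x)) * latticeKernel W τ.re τ.im t k) := by
    intro x
    simp only [cls_add, cls_rep, cls_mulVec, add_zero]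
    rw [tsum_mul_left, tsum_mul_left, h.tsum_latticeKernel _ hy', hre, him]
    ring
  simp_rw [h1]
  rw [← Finset.mul_sum, ← Summable.tsum_finsetSum fun x _ => (hs (rep x)).mul_left (m x)]
  have h2 : ∀ k, weilS W S m (cls S k) * latticeKernel W τ.re τ.im t k =
      ((Real.sqrt |(S.det : ℝ)|)⁻¹ : ℝ) *
        ∑ x, m x * (unitExp (-pairing W k (rep x)) * latticeKernel W τ.re τ.im t k) := by
    intro k
    simp only [weilS, LinearMap.coe_mk, AddHom.coe_mk]
    rw [mul_assoc, Finset.sum_mul]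
    congr 1
    refine Finset.sum_congr rfl fun x _ => ?_
    rw [← cls_rep x, ← cls_neg, h.chi_mk, pairing_neg_right, cls_rep]
    ring
  simp_rw [h2]
  rw [tsum_mul_left, ← mul_assoc, ← mul_assoc]
  congr 1
  rw [hN', hτ', im_S_smul]
  norm_cast
  rw [Real.sqrt_div' _ hN.le, Real.sqrt_inv]
  have := Real.sqrt_pos.mpr hN
  field_simp

theorem IsDualForm.theta_T_smul (h : IsDualForm W S) (m : DiscGroup S → ℂ) (t : ℝ) (τ : ℍ) :
    theta W (fun k => m (cls S k)) t (ModularGroup.T • τ) =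
      theta W (fun k => weilT W S m (cls S k)) t τ := by
  rw [theta, theta, UpperHalfPlane.modular_T_smul, UpperHalfPlane.vadd_im,
    UpperHalfPlane.vadd_re, add_comm 1]
  congr 1
  refine tsum_congr fun k => ?_
  simp only [weilT, LinearMap.coe_mk, AddHom.coe_mk, h.quadChar_mk, latticeKernel_add_one]
  ring

end

end IndefTheta

/-! ### Intertwining operators and the multiplier system -/

namespace IndefTheta

noncomputable section

variable {W : Matrix (Fin 2) (Fin 2) ℝ} {S : Matrix (Fin 2) (Fin 2) ℤ}

open DiscGroup

/-- `R` is a unitary operator that implements the action of `g` on theta functions, and that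
intertwines the Heisenberg operators. -/
structure IsIntertwiner (W : Matrix (Fin 2) (Fin 2) ℝ) [Fintype (DiscGroup S)] (g : SL(2, ℤ))
    (R : (DiscGroup S → ℂ) →ₗ[ℂ] (DiscGroup S → ℂ)) : Prop where
  norm_sq : ∀ m, ∑ x, ‖R m x‖ ^ 2 = ∑ x, ‖m x‖ ^ 2
  heis : ∀ a b m, R (heis W a b m) =
    heis W (g 0 0 • a - g 1 0 • b) (g 1 1 • b - g 0 1 • a) (R m)
  theta : ∀ m t τ, theta W (fun k => m (cls S k)) t (g • τ) =
    theta W (fun k => R m (cls S k)) t τ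

theorem IsIntertwiner.one [Fintype (DiscGroup S)] :
    IsIntertwiner (S := S) W 1 LinearMap.id where
  norm_sq m := rfl
  heis a b m := by simp
  theta m t τ := by simp

/-- The order reverses: moving g and then g' from the argument to the coefficients applies R first
and R' second. -/
theorem IsIntertwiner.mul [Fintype (DiscGroup S)] {g g' : SL(2, ℤ)}
    {R R' : (DiscGroup S → ℂ) →ₗ[ℂ] (DiscGroup S → ℂ)} (h : IsIntertwiner W g R)
    (h' : IsIntertwiner W g' R') : IsIntertwiner W (g * g') (R' ∘ₗ R) where
  norm_sq m := by rw [LinearMap.comp_apply, h'.norm_sq, h.norm_sq]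
  heis a b m := by
    rw [LinearMap.comp_apply, h.heis, h'.heis, LinearMap.comp_apply]
    congr 1 <;> ext i <;>
    · simp [Matrix.mul_apply, Fin.sum_univ_two]
      ring
  theta m t τ := by
    rw [mul_smul, h.theta, h'.theta]
    rfl

theorem IsIntertwiner.injective [Fintype (DiscGroup S)] {g : SL(2, ℤ)}
    {R : (DiscGroup S → ℂ) →ₗ[ℂ] (DiscGroup S → ℂ)} (h : IsIntertwiner W g R) :
    Function.Injective R := by
  rw [injective_iff_map_eq_zero]
  intro m hm
  have h1 := h.norm_sq m
  rw [hm] at h1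
  simp only [Pi.zero_apply, norm_zero, ne_eq, OfNat.ofNat_ne_zero, not_false_eq_true, zero_pow,
    Finset.sum_const_zero] at h1
  have h2 := (Finset.sum_eq_zero_iff_of_nonneg fun x _ => sq_nonneg ‖m x‖).mp h1.symm
  ext x
  simpa using h2 x (Finset.mem_univ x)

theorem IsIntertwiner.exists_inv [Fintype (DiscGroup S)] {g : SL(2, ℤ)}
    {R : (DiscGroup S → ℂ) →ₗ[ℂ] (DiscGroup S → ℂ)} (h : IsIntertwiner W g R) :
    ∃ R', IsIntertwiner W g⁻¹ (S := S) R' := by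
  let e := LinearEquiv.ofInjectiveEndo R h.injective
  have he : ∀ m, R (e.symm m) = m := fun m => e.apply_symm_apply m
  refine ⟨e.symm, fun m => ?_, fun a b m => ?_, fun m t τ => ?_⟩
  · rw [← h.norm_sq]
    exact Finset.sum_congr rfl fun x _ => by rw [LinearEquiv.coe_coe, he]
  · apply h.injective
    rw [LinearEquiv.coe_coe, he, h.heis, he]
    have hd := Matrix.det_fin_two (g : Matrix (Fin 2) (Fin 2) ℤ)
    rw [g.det_coe] at hd
    rw [Matrix.SpecialLinearGroup.coe_inv, Matrix.adjugate_fin_two]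
    congr 1 <;> ext i
    · simp
      linear_combination (a i) * hd
    · simp
      linear_combination (b i) * hd
  · have h1 := h.theta (e.symm m) t (g⁻¹ • τ)
    rw [smul_inv_smul, he] at h1
    exact h1.symm

/-- Only existence is claimed, so induction on words in the two generators suffices; the relations
of SL₂(ℤ) need no check. -/
theorem IsDualForm.exists_isIntertwiner (h : IsDualForm W S) [Fintype (DiscGroup S)]
    (g : SL(2, ℤ)) : ∃ R, IsIntertwiner W (S := S) g R := by
  have hg : g ∈ Subgroup.closure {ModularGroup.S, ModularGroup.T} := by
    simp [SpecialLinearGroup.SL2Z_generators]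
  induction hg using Subgroup.closure_induction with
  | mem g hg =>
    rcases hg with rfl | rfl
    · refine ⟨weilS W S, h.sum_norm_sq_weilS, fun a b m => ?_, h.theta_S_smul⟩
      rw [h.weilS_heis]
      congr 1 <;> simp [ModularGroup.S]
    · refine ⟨weilT W S, sum_norm_sq_weilT, fun a b m => ?_, h.theta_T_smul⟩
      rw [h.weilT_heis]
      congr 1 <;> simp [ModularGroup.T]
  | one => exact ⟨_, IsIntertwiner.one⟩
  | mul g g' _ _ ih ih' =>
    obtain ⟨R, hR⟩ := ih
    obtain ⟨R', hR'⟩ := ih'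
    exact ⟨_, hR.mul hR'⟩
  | inv g _ ih =>
    obtain ⟨R, hR⟩ := ih
    exact hR.exists_inv

theorem exists_det_smul_eq_mulVec (S : Matrix (Fin 2) (Fin 2) ℤ) (a : Fin 2 → ℤ) :
    ∃ l, S.det • a = S.mulVec l :=
  ⟨S.adjugate.mulVec a, by
    rw [Matrix.mulVec_mulVec, Matrix.mul_adjugate, Matrix.smul_mulVec, Matrix.one_mulVec]⟩

/-- The Heisenberg operators depend on their parameters modulo `2 det S` only. -/
theorem IsDualForm.heis_add_smul (h : IsDualForm W S) (a b a' b' : Fin 2 → ℤ)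
    (m : DiscGroup S → ℂ) :
    heis W (a + (2 * S.det) • a') (b + (2 * S.det) • b') m = heis W a b m := by
  obtain ⟨l, hl⟩ := exists_det_smul_eq_mulVec S a'
  obtain ⟨k, hk⟩ := exists_det_smul_eq_mulVec S b'
  have hz : ∀ c, cls S ((2 * S.det) • c) = 0 := by
    intro c
    obtain ⟨j, hj⟩ := exists_det_smul_eq_mulVec S c
    rw [mul_smul, hj, two_smul, cls_add, cls_mulVec, add_zero]
  ext x
  simp only [heis, cls_add, hz, add_zero]
  congr 2
  rw [mul_smul, mul_smul, hl, hk, pairing_add_right, pairing_add_left, pairing_add_left,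
    pairing_smul_left, pairing_smul_left, pairing_smul_right, pairing_smul_right,
    h.pairing_mulVec_left, h.pairing_mulVec_right, h.pairing_mulVec_right,
    -- The factor 2 in 2 det S compensates the half in the phase e(⟨a, b⟩/2), so the change of the
    -- phase is an integer.
    ← unitExp_add_intCast (pairing W a b / 2) (b ⬝ᵥ l + a ⬝ᵥ k + 2 * (S.mulVec l ⬝ᵥ k))]
  congr 1
  push_cast
  ring

/-- On the principal congruence subgroup of level `2 |det S|` all theta functions transform
by the same scalars, which have absolute value one. -/
theorem IsDualForm.exists_circle (h : IsDualForm W S) [Fintype (DiscGroup S)] {g : SL(2, ℤ)}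
    (hg : g ∈ CongruenceSubgroup.Gamma (2 * S.det.natAbs)) :
    ∃ c : Circle, ∀ (m : DiscGroup S → ℂ) t τ, theta W (fun k => m (cls S k)) t (g • τ) =
      c * theta W (fun k => m (cls S k)) t τ := by
  obtain ⟨R, hR⟩ := h.exists_isIntertwiner g
  have hdvd : ∀ z : ℤ, (z : ZMod (2 * S.det.natAbs)) = 0 → ∃ w, z = 2 * S.det * w := by
    intro z hz
    rw [ZMod.intCast_zmod_eq_zero_iff_dvd] at hz
    have : (2 * S.det) ∣ z := by
      rw [← Int.natAbs_dvd, Int.natAbs_mul]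
      exact_mod_cast hz
    exact this
  rw [CongruenceSubgroup.Gamma_mem] at hg
  obtain ⟨w₀, h₀⟩ := hdvd (g 0 0 - 1) (by push_cast; rw [hg.1, sub_self])
  obtain ⟨w₁, h₁⟩ := hdvd (g 0 1) hg.2.1
  obtain ⟨w₂, h₂⟩ := hdvd (g 1 0) hg.2.2.1
  obtain ⟨w₃, h₃⟩ := hdvd (g 1 1 - 1) (by push_cast; rw [hg.2.2.2, sub_self])
  -- As g ≡ 1 modulo 2 det S, the transformed parameters of a Heisenberg operator differ from the
  -- original ones by multiples of 2 det S, so R commutes with the operator.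
  obtain ⟨c, hc⟩ := h.exists_scalar R fun a b m => by
    rw [hR.heis, ← h.heis_add_smul a b (w₀ • a - w₂ • b) (w₃ • b - w₁ • a)]
    congr 1 <;> ext i
    · simp
      linear_combination a i * h₀ - b i * h₂
    · simp
      linear_combination b i * h₃ - a i * h₁
  have hnorm : ‖c‖ = 1 := by
    have h1 := hR.norm_sq (fun _ => 1)
    rw [hc] at h1
    simp only [Pi.smul_apply, smul_eq_mul, mul_one, Finset.sum_const, nsmul_eq_mul, norm_one,
      one_pow] at h1
    have h2 : (0 : ℝ) < (Finset.univ : Finset (DiscGroup S)).card := by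
      exact_mod_cast Finset.card_pos.mpr ⟨0, Finset.mem_univ _⟩
    have h3 : ‖c‖ ^ 2 = 1 := by
      field_simp at h1
      linarith
    nlinarith [norm_nonneg c, sq_nonneg (‖c‖ - 1)]
  refine ⟨⟨c, mem_sphere_zero_iff_norm.mpr hnorm⟩, fun m t τ => ?_⟩
  rw [hR.theta, hc, theta, theta, mul_left_comm]
  congr 1
  rw [← tsum_mul_left]
  refine tsum_congr fun k => ?_
  simp [mul_assoc]

/-- At x = 0 the oscillating factor disappears and every summand is positive. This one nonzero value
determines the transformation scalars. -/
theorem theta_one_ne_zero (hW : W.det ≠ 0) : theta W (fun _ => 1) 0 UpperHalfPlane.I ≠ 0 := by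
  rw [theta]
  have h1 : ∀ k : Fin 2 → ℤ, (1 : ℂ) * latticeKernel W UpperHalfPlane.I.re UpperHalfPlane.I.im 0 k =
      ((Real.exp (-(Real.pi * ((Real.exp (-0) * W.mulVec (toReal k) 0) ^ 2 +
        (Real.exp 0 * W.mulVec (toReal k) 1) ^ 2) * UpperHalfPlane.I.im)) : ℝ) : ℂ) := by
    intro k
    rw [latticeKernel, gaussKernel, UpperHalfPlane.I_re, Complex.ofReal_exp]
    simp
  have hs := summable_mul_latticeKernel hW (m := fun _ => 1) (C := 1) (fun _ => by simp)
    UpperHalfPlane.I.re UpperHalfPlane.I.im_pos 0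
  simp_rw [h1] at hs ⊢
  rw [← Complex.ofReal_tsum, ← Complex.ofReal_mul]
  have hs' := Complex.summable_ofReal.mp hs
  have h2 := hs'.tsum_pos (fun k => (Real.exp_pos _).le) 0 (Real.exp_pos _)
  have h3 := Real.sqrt_pos.mpr UpperHalfPlane.I.im_pos
  exact_mod_cast (mul_pos h3 h2).ne'

/-- The scalar of each g can be read off from a nonzero theta value, so it is unique, and
multiplicativity follows by applying g' and g in turn. -/
theorem IsDualForm.exists_multiplier (h : IsDualForm W S) [Fintype (DiscGroup S)] :
    ∃ v : CongruenceSubgroup.Gamma (2 * S.det.natAbs) →* Circle,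
      ∀ (g : CongruenceSubgroup.Gamma (2 * S.det.natAbs)) (m : DiscGroup S → ℂ) t τ,
        theta W (fun k => m (cls S k)) t ((g : SL(2, ℤ)) • τ) =
        v g * theta W (fun k => m (cls S k)) t τ := by
  choose c hc using fun g : CongruenceSubgroup.Gamma (2 * S.det.natAbs) => h.exists_circle g.2
  have huniq : ∀ z z' : Circle, (z : ℂ) * theta W (fun _ => 1) 0 UpperHalfPlane.I =
      z' * theta W (fun _ => 1) 0 UpperHalfPlane.I → z = z' := fun z z' hz =>
    Circle.ext (mul_right_cancel₀ (theta_one_ne_zero h.det_left_ne_zero) hz)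
  refine ⟨MonoidHom.mk' c fun g g' => huniq _ _ ?_, hc⟩
  rw [← hc (g * g') (fun _ => 1), Subgroup.coe_mul, mul_smul, hc g (fun _ => 1),
    hc g' (fun _ => 1), Circle.coe_mul, mul_assoc]

end

end IndefTheta

/-! ### Smoothness and the Laplacian of exponential integrals -/

namespace IndefTheta

noncomputable section

open MeasureTheory

/-- The real differential `u dx + v dy` on the complex plane. -/
def planeForm (u v : ℂ) : ℂ →L[ℝ] ℂ := Complex.reCLM.smulRight u + Complex.imCLM.smulRight v

theorem planeForm_apply (u v z : ℂ) : planeForm u v z = z.re * u + z.im * v := by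
  simp [planeForm]

theorem norm_planeForm_le (u v : ℂ) : ‖planeForm u v‖ ≤ ‖u‖ + ‖v‖ := by
  refine (norm_add_le _ _).trans (add_le_add ?_ ?_) <;>
  simp [ContinuousLinearMap.norm_smulRight_apply]

theorem isOpen_im_pos : IsOpen {z : ℂ | 0 < z.im} := isOpen_lt continuous_const Complex.continuous_im

theorem hasFDerivAt_planeForm {u v : ℂ → ℂ} {u₁ u₂ v₁ v₂ z : ℂ}
    (hu : HasFDerivAt u (planeForm u₁ u₂) z) (hv : HasFDerivAt v (planeForm v₁ v₂) z) :
    HasFDerivAt (fun z => planeForm (u z) (v z))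
      ((ContinuousLinearMap.smulRightL ℝ ℂ ℂ Complex.reCLM).comp (planeForm u₁ u₂) +
        (ContinuousLinearMap.smulRightL ℝ ℂ ℂ Complex.imCLM).comp (planeForm v₁ v₂)) z :=
  (((ContinuousLinearMap.smulRightL ℝ ℂ ℂ Complex.reCLM).hasFDerivAt).comp z hu).add
    (((ContinuousLinearMap.smulRightL ℝ ℂ ℂ Complex.imCLM).hasFDerivAt).comp z hv)

/-- The Laplacian of a function with known first and second partial derivatives. -/
theorem laplacian_eq_of_hasFDerivAt {f fx fy : ℂ → ℂ} {U : Set ℂ} (hU : IsOpen U)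
    (hf : ∀ z ∈ U, HasFDerivAt f (planeForm (fx z) (fy z)) z) {z : ℂ} (hz : z ∈ U)
    {a b c d : ℂ} (hfx : HasFDerivAt fx (planeForm a b) z)
    (hfy : HasFDerivAt fy (planeForm c d) z) : Laplacian.laplacian f z = a + d := by
  have h1 : fderiv ℝ f =ᶠ[nhds z] fun z => planeForm (fx z) (fy z) :=
    Filter.eventuallyEq_of_mem (hU.mem_nhds hz) fun w hw => (hf w hw).fderiv
  rw [InnerProductSpace.laplacian_eq_iteratedFDeriv_complexPlane]
  simp only [iteratedFDeriv_two_apply]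
  rw [h1.fderiv_eq, (hasFDerivAt_planeForm hfx hfy).fderiv]
  simp [planeForm_apply]

variable {X : Type*}

/-- The integrand of `expIntegral`. -/
def expIntegrand (α β : X → ℝ) (w : X → ℂ) (p q : ℕ) (z : ℂ) (ξ : X) : ℂ :=
  w ξ * (((α ξ : ℂ) * Complex.I) ^ p * (-(β ξ : ℂ)) ^ q) *
    Complex.exp ((α ξ : ℂ) * z.re * Complex.I - (β ξ : ℂ) * z.im)

/-- ∂/∂x multiplies by iα and ∂/∂y by −β, so the family indexed by (p, q) is closed under
differentiation. Smoothness of the integrals then follows by induction over all p, q at once. -/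
theorem hasFDerivAt_expIntegrand (α β : X → ℝ) (w : X → ℂ) (p q : ℕ) (z : ℂ) (ξ : X) :
    HasFDerivAt (fun z => expIntegrand α β w p q z ξ)
      (planeForm (expIntegrand α β w (p + 1) q z ξ) (expIntegrand α β w p (q + 1) z ξ)) z := by
  have hre : HasFDerivAt (fun z : ℂ => (z.re : ℂ)) (Complex.ofRealCLM.comp Complex.reCLM) z :=
    (Complex.ofRealCLM.comp Complex.reCLM).hasFDerivAt
  have him : HasFDerivAt (fun z : ℂ => (z.im : ℂ)) (Complex.ofRealCLM.comp Complex.imCLM) z :=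
    (Complex.ofRealCLM.comp Complex.imCLM).hasFDerivAt
  have h1 := ((((hre.const_mul (α ξ : ℂ)).mul_const Complex.I).sub
    (him.const_mul (β ξ : ℂ))).cexp).const_mul
    (w ξ * (((α ξ : ℂ) * Complex.I) ^ p * (-(β ξ : ℂ)) ^ q))
  refine h1.congr_fderiv ?_
  ext v
  simp [planeForm_apply, expIntegrand]
  ring

variable [MeasurableSpace X]

/-- The integral of `w (iα)^p (-β)^q exp(iαx - βy)`, as a function of `z = x + iy`. -/
def expIntegral (μ : Measure X) (α β : X → ℝ) (w : X → ℂ) (p q : ℕ) (z : ℂ) : ℂ :=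
  ∫ ξ, expIntegrand α β w p q z ξ ∂μ

/-- Conditions under which `expIntegral` is smooth on the upper half-plane. -/
structure ExpIntegrable (μ : Measure X) (α β : X → ℝ) (w : X → ℂ) : Prop where
  measurable_left : Measurable α
  measurable_right : Measurable β
  measurable_weight : Measurable w
  abs_le : ∀ ξ, |α ξ| ≤ β ξ
  integrable : ∀ y : ℝ, 0 < y → Integrable (fun ξ => ‖w ξ‖ * Real.exp (-(β ξ * y))) μ

variable {μ : Measure X} {α β : X → ℝ} {w : X → ℂ}

theorem ExpIntegrable.norm_expIntegrand_le (h : ExpIntegrable μ α β w) (p q : ℕ) (z : ℂ) (ξ : X) :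
    ‖expIntegrand α β w p q z ξ‖ ≤ ‖w ξ‖ * (β ξ ^ (p + q) * Real.exp (-(β ξ * z.im))) := by
  have hβ : 0 ≤ β ξ := (abs_nonneg _).trans (h.abs_le ξ)
  rw [expIntegrand, norm_mul, norm_mul, norm_mul, norm_pow, norm_pow, norm_mul, Complex.norm_I,
    mul_one, norm_neg, Complex.norm_real, Complex.norm_real, Real.norm_eq_abs, Real.norm_eq_abs,
    abs_of_nonneg hβ, Complex.norm_exp, pow_add, mul_assoc]
  have e : ((α ξ : ℂ) * z.re * Complex.I - (β ξ : ℂ) * z.im).re = -(β ξ * z.im) := by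
    simp
  rw [e]
  gcongr
  exact h.abs_le ξ

/-- Half of the exponential decay absorbs the power, through uⁿ/n! ≤ eᵘ with u = by/2; the other
half remains, uniformly for y' ≥ y. -/
theorem pow_mul_exp_neg_le {b y y' : ℝ} (hb : 0 ≤ b) (hy : 0 < y) (hy' : y ≤ y') (n : ℕ) :
    b ^ n * Real.exp (-(b * y')) ≤ (n.factorial / (y / 2) ^ n) * Real.exp (-(b * (y / 2))) := by
  have h1 := Real.pow_div_factorial_le_exp (b * (y / 2)) (by positivity) n
  have h2 : Real.exp (-(b * y')) ≤ Real.exp (-(b * (y / 2))) * Real.exp (-(b * (y / 2))) := by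
    rw [← Real.exp_add]
    apply Real.exp_le_exp.mpr
    nlinarith
  have h3 : b ^ n ≤ (n.factorial / (y / 2) ^ n) * Real.exp (b * (y / 2)) := by
    rw [mul_pow, div_le_iff₀ (by positivity)] at h1
    rw [div_mul_eq_mul_div, le_div_iff₀ (by positivity)]
    linarith
  calc b ^ n * Real.exp (-(b * y')) ≤ ((n.factorial / (y / 2) ^ n) * Real.exp (b * (y / 2))) *
        (Real.exp (-(b * (y / 2))) * Real.exp (-(b * (y / 2)))) := by gcongr
    _ = (n.factorial / (y / 2) ^ n) * (Real.exp (b * (y / 2)) * Real.exp (-(b * (y / 2)))) *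
        Real.exp (-(b * (y / 2))) := by ring
    _ = _ := by rw [← Real.exp_add]; simp

theorem ExpIntegrable.norm_expIntegrand_le' (h : ExpIntegrable μ α β w) (p q : ℕ) {y : ℝ}
    (hy : 0 < y) {z : ℂ} (hz : y ≤ z.im) (ξ : X) :
    ‖expIntegrand α β w p q z ξ‖ ≤ ((p + q).factorial / (y / 2) ^ (p + q)) *
      (‖w ξ‖ * Real.exp (-(β ξ * (y / 2)))) := by
  refine (h.norm_expIntegrand_le p q z ξ).trans ?_
  have := pow_mul_exp_neg_le ((abs_nonneg _).trans (h.abs_le ξ)) hy hz (p + q)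
  calc _ ≤ ‖w ξ‖ * _ := mul_le_mul_of_nonneg_left this (norm_nonneg _)
    _ = _ := by ring

theorem ExpIntegrable.measurable_expIntegrand (h : ExpIntegrable μ α β w) (p q : ℕ) (z : ℂ) :
    Measurable (expIntegrand α β w p q z) := by
  have := h.measurable_left
  have := h.measurable_right
  have := h.measurable_weight
  unfold expIntegrand
  fun_prop

theorem ExpIntegrable.integrable_expIntegrand (h : ExpIntegrable μ α β w) (p q : ℕ) {z : ℂ}
    (hz : 0 < z.im) : Integrable (expIntegrand α β w p q z) μ :=
  Integrable.mono' ((h.integrable (z.im / 2) (half_pos hz)).const_mul _)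
    (h.measurable_expIntegrand p q z).aestronglyMeasurable
    (Filter.Eventually.of_forall fun ξ => h.norm_expIntegrand_le' p q hz le_rfl ξ)

theorem ExpIntegrable.hasFDerivAt_expIntegral (h : ExpIntegrable μ α β w) (p q : ℕ) {z : ℂ}
    (hz : 0 < z.im) : HasFDerivAt (expIntegral μ α β w p q)
      (planeForm (expIntegral μ α β w (p + 1) q z) (expIntegral μ α β w p (q + 1) z)) z := by
  have hy : 0 < z.im / 2 := half_pos hz
  have hs : {w : ℂ | z.im / 2 < w.im} ∈ nhds z :=
    (isOpen_lt continuous_const Complex.continuous_im).mem_nhds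
      (show z.im / 2 < z.im by linarith)
  have hi1 := h.integrable_expIntegrand (p + 1) q hz
  have hi2 := h.integrable_expIntegrand p (q + 1) hz
  have hF' : Integrable (fun ξ => planeForm (expIntegrand α β w (p + 1) q z ξ)
      (expIntegrand α β w p (q + 1) z ξ)) μ :=
    ((ContinuousLinearMap.smulRightL ℝ ℂ ℂ Complex.reCLM).integrable_comp hi1).add
      ((ContinuousLinearMap.smulRightL ℝ ℂ ℂ Complex.imCLM).integrable_comp hi2)
  have key := hasFDerivAt_integral_of_dominated_of_fderiv_le (μ := μ) (𝕜 := ℝ)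
    (F := fun z ξ => expIntegrand α β w p q z ξ)
    (F' := fun z ξ => planeForm (expIntegrand α β w (p + 1) q z ξ)
      (expIntegrand α β w p (q + 1) z ξ)) (x₀ := z) hs
    (Filter.Eventually.of_forall fun z => (h.measurable_expIntegrand p q z).aestronglyMeasurable)
    (h.integrable_expIntegrand p q hz) hF'.aestronglyMeasurable
    (Filter.Eventually.of_forall fun ξ z hz' => (norm_planeForm_le _ _).trans
      (add_le_add (h.norm_expIntegrand_le' (p + 1) q hy (le_of_lt hz') ξ)
        (h.norm_expIntegrand_le' p (q + 1) hy (le_of_lt hz') ξ)))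
    (((h.integrable _ (half_pos hy)).const_mul _).add ((h.integrable _ (half_pos hy)).const_mul _))
    (Filter.Eventually.of_forall fun ξ z _ => hasFDerivAt_expIntegrand α β w p q z ξ)
  refine key.congr_fderiv (ContinuousLinearMap.ext fun v => ?_)
  rw [ContinuousLinearMap.integral_apply hF']
  simp only [planeForm_apply]
  rw [integral_add (hi1.const_mul _) (hi2.const_mul _), integral_const_mul, integral_const_mul]
  rfl

theorem ExpIntegrable.contDiffOn_expIntegral (h : ExpIntegrable μ α β w) (n : ℕ) (p q : ℕ) :
    ContDiffOn ℝ n (expIntegral μ α β w p q) {z : ℂ | 0 < z.im} := by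
  induction n generalizing p q with
  | zero =>
    rw [Nat.cast_zero, contDiffOn_zero]
    exact fun z hz => (h.hasFDerivAt_expIntegral p q hz).continuousAt.continuousWithinAt
  | succ n ih =>
    rw [Nat.cast_succ, contDiffOn_succ_iff_fderiv_of_isOpen isOpen_im_pos]
    refine ⟨fun z hz => (h.hasFDerivAt_expIntegral p q hz).differentiableAt.differentiableWithinAt,
      by simp, ?_⟩
    refine ContDiffOn.congr (f := fun z => planeForm (expIntegral μ α β w (p + 1) q z)
      (expIntegral μ α β w p (q + 1) z)) ?_ fun z hz => (h.hasFDerivAt_expIntegral p q hz).fderiv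
    exact ((ih (p + 1) q).continuousLinearMap_comp
      (ContinuousLinearMap.smulRightL ℝ ℂ ℂ Complex.reCLM)).add
      ((ih p (q + 1)).continuousLinearMap_comp
        (ContinuousLinearMap.smulRightL ℝ ℂ ℂ Complex.imCLM))

theorem ExpIntegrable.contDiffOn_infty_expIntegral (h : ExpIntegrable μ α β w) (p q : ℕ) :
    ContDiffOn ℝ ∞ (expIntegral μ α β w p q) {z : ℂ | 0 < z.im} :=
  contDiffOn_infty.mpr fun n => h.contDiffOn_expIntegral n p q

theorem hasFDerivAt_comp_im {g : ℝ → ℝ} {g' : ℝ} {z : ℂ} (hg : HasDerivAt g g' z.im) :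
    HasFDerivAt (fun z : ℂ => (g z.im : ℂ)) (planeForm 0 g') z := by
  have h1 := (Complex.ofRealCLM.hasFDerivAt.comp z.im hg.hasFDerivAt).comp z
    Complex.imCLM.hasFDerivAt
  refine h1.congr_fderiv ?_
  ext v
  simp [planeForm_apply]

theorem hasFDerivAt_mul_planeForm {f g : ℂ → ℂ} {f₁ f₂ g₁ g₂ z : ℂ}
    (hf : HasFDerivAt f (planeForm f₁ f₂) z) (hg : HasFDerivAt g (planeForm g₁ g₂) z) :
    HasFDerivAt (fun z => f z * g z) (planeForm (f₁ * g z + f z * g₁) (f₂ * g z + f z * g₂)) z := by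
  refine (hf.mul hg).congr_fderiv ?_
  ext v
  simp [planeForm_apply]
  ring

/-- The hyperbolic Laplacian applied to `y^{1/2}` times an exponential integral. -/
theorem ExpIntegrable.laplacian_sqrt_mul (h : ExpIntegrable μ α β w) {z : ℂ} (hz : 0 < z.im) :
    -((z.im : ℂ) ^ 2) * Laplacian.laplacian
      (fun z : ℂ => (Real.sqrt z.im : ℂ) * expIntegral μ α β w 0 0 z) z =
      1 / 4 * ((Real.sqrt z.im : ℂ) * expIntegral μ α β w 0 0 z) - (Real.sqrt z.im : ℂ) *
        ((z.im : ℂ) ^ 2 * (expIntegral μ α β w 2 0 z + expIntegral μ α β w 0 2 z) +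
          z.im * expIntegral μ α β w 0 1 z) := by
  have hs : ∀ y : ℝ, 0 < y → HasDerivAt Real.sqrt (1 / (2 * Real.sqrt y)) y := fun y hy =>
    Real.hasDerivAt_sqrt hy.ne'
  have hs2 : HasDerivAt (fun y => 1 / (2 * Real.sqrt y)) (-(1 / (4 * z.im * Real.sqrt z.im)))
      z.im := by
    have h1 : HasDerivAt (fun y => (2 * Real.sqrt y)⁻¹)
        (-(2 * (1 / (2 * Real.sqrt z.im))) / (2 * Real.sqrt z.im) ^ 2) z.im :=
      ((hs z.im hz).const_mul 2).inv (by positivity)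
    simp only [one_div] at h1 ⊢
    refine h1.congr_deriv ?_
    have h2 := Real.sq_sqrt hz.le
    have h3 := Real.sqrt_pos.mpr hz
    field_simp
    rw [h2]
    try ring
  have hf1 : ∀ w' ∈ {z : ℂ | 0 < z.im}, _ := fun w' (hw : 0 < w'.im) =>
    hasFDerivAt_mul_planeForm (hasFDerivAt_comp_im (hs w'.im hw))
      (h.hasFDerivAt_expIntegral 0 0 hw)
  have hsz : HasFDerivAt (fun z : ℂ => (Real.sqrt z.im : ℂ)) _ z := hasFDerivAt_comp_im (hs z.im hz)
  have hs2z : HasFDerivAt (fun z : ℂ => ((1 / (2 * Real.sqrt z.im) : ℝ) : ℂ)) _ z :=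
    hasFDerivAt_comp_im hs2
  have hzero : HasFDerivAt (fun _ : ℂ => (0 : ℂ)) (planeForm 0 0) z :=
    (hasFDerivAt_const (0 : ℂ) z).congr_fderiv (by ext v; simp [planeForm_apply])
  have hadd : ∀ {f g : ℂ → ℂ} {f₁ f₂ g₁ g₂ : ℂ}, HasFDerivAt f (planeForm f₁ f₂) z →
      HasFDerivAt g (planeForm g₁ g₂) z →
      HasFDerivAt (fun z => f z + g z) (planeForm (f₁ + g₁) (f₂ + g₂)) z := by
    intro f g f₁ f₂ g₁ g₂ hf hg
    refine (hf.add hg).congr_fderiv ?_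
    ext v
    simp [planeForm_apply]
    ring
  -- The eigenvalue 1/4 has its origin in y²(√y)'' = −√y/4; the mixed derivative 2y²(√y)'∂/∂y = √y ·
  -- y∂/∂y gives the first-order term.
  have hlap := laplacian_eq_of_hasFDerivAt isOpen_im_pos hf1 hz
    (hadd (hasFDerivAt_mul_planeForm hzero (h.hasFDerivAt_expIntegral 0 0 hz))
      (hasFDerivAt_mul_planeForm hsz (h.hasFDerivAt_expIntegral 1 0 hz)))
    (hadd (hasFDerivAt_mul_planeForm hs2z (h.hasFDerivAt_expIntegral 0 0 hz))
      (hasFDerivAt_mul_planeForm hsz (h.hasFDerivAt_expIntegral 0 1 hz)))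
  rw [hlap]
  have h3 : (Real.sqrt z.im : ℂ) ≠ 0 := by exact_mod_cast (Real.sqrt_pos.mpr hz).ne'
  have h4 : (z.im : ℂ) = (Real.sqrt z.im : ℂ) ^ 2 := by
    exact_mod_cast (Real.sq_sqrt hz.le).symm
  push_cast
  generalize (Real.sqrt z.im : ℂ) = r at *
  rw [h4]
  field_simp
  ring

end

end IndefTheta

/-! ### Bessel tails and the integral of a single Gaussian -/

namespace IndefTheta

noncomputable section

open MeasureTheory Set

theorem integrableOn_exp_neg_mul_cosh {κ : ℝ} (hκ : 0 < κ) (u : ℝ) :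
    IntegrableOn (fun v => Real.exp (-κ * Real.cosh (2 * v))) (Ioi u) := by
  refine Integrable.mono' (exp_neg_integrableOn_Ioi u (by positivity : 0 < 2 * κ))
    (by fun_prop) (Filter.Eventually.of_forall fun v => ?_)
  rw [Real.norm_eq_abs, Real.abs_exp]
  apply Real.exp_le_exp.mpr
  have h : 2 * v ≤ Real.cosh (2 * v) := by
    rcases le_total 0 (2 * v) with h | h
    · exact (Real.self_le_sinh_iff.mpr h).trans (Real.sinh_lt_cosh _).le
    · exact h.trans (Real.cosh_pos _).le
  nlinarith

theorem integral_exp_neg_mul_cosh (κ : ℝ) :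
    ∫ v in Ioi (0 : ℝ), Real.exp (-κ * Real.cosh (2 * v)) = besselK0 κ / 2 := by
  have h := integral_comp_mul_left_Ioi (fun v => Real.exp (-κ * Real.cosh v)) 0
    (by norm_num : (0 : ℝ) < 2)
  rw [h, besselK0, mul_zero, smul_eq_mul]
  ring

/-- The signed tail `½ sgn(u) K₀(κ) - ∫₀ᵘ exp(-κ cosh 2v) dv` of the Bessel integral. -/
def besselTail (κ u : ℝ) : ℝ :=
  1 / 2 * Real.sign u * besselK0 κ - ∫ v in (0 : ℝ)..u, Real.exp (-κ * Real.cosh (2 * v))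

theorem besselTail_of_pos {κ u : ℝ} (hκ : 0 < κ) (hu : 0 < u) :
    besselTail κ u = ∫ v in Ioi u, Real.exp (-κ * Real.cosh (2 * v)) := by
  have h := intervalIntegral.integral_interval_add_Ioi (integrableOn_exp_neg_mul_cosh hκ 0)
    (integrableOn_exp_neg_mul_cosh hκ u)
  rw [integral_exp_neg_mul_cosh] at h
  rw [besselTail, Real.sign_of_pos hu]
  linarith

theorem besselTail_neg (κ u : ℝ) : besselTail κ (-u) = -besselTail κ u := by
  rw [besselTail, besselTail, Real.sign_neg]
  have h := intervalIntegral.integral_comp_neg (a := 0) (b := u)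
    (fun v => Real.exp (-κ * Real.cosh (2 * v)))
  simp only [mul_neg, Real.cosh_neg, neg_zero] at h
  rw [intervalIntegral.integral_symm, ← h]
  ring

theorem besselTail_zero (κ : ℝ) : besselTail κ 0 = 0 := by simp [besselTail]

/-- Half of the exponent is estimated by cosh 2v ≥ cosh 2u and leaves the integral; the other half,
with κ ≥ κ₀, makes the rest integrable. -/
theorem abs_besselTail_le_of_pos {κ₀ κ u : ℝ} (hκ₀ : 0 < κ₀) (hκ : κ₀ ≤ κ) (hu : 0 < u) :
    |besselTail κ u| ≤ besselK0 (κ₀ / 2) / 2 * Real.exp (-(κ / 2 * Real.cosh (2 * u))) := by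
  have hκ' : 0 < κ := hκ₀.trans_le hκ
  rw [besselTail_of_pos hκ' hu, abs_of_nonneg (integral_nonneg fun v => (Real.exp_pos _).le),
    ← integral_exp_neg_mul_cosh, ← integral_mul_const]
  have hi : IntegrableOn (fun v => Real.exp (-(κ₀ / 2) * Real.cosh (2 * v)) *
      Real.exp (-(κ / 2 * Real.cosh (2 * u)))) (Ioi 0) :=
    (integrableOn_exp_neg_mul_cosh (half_pos hκ₀) 0).mul_const _
  calc ∫ v in Ioi u, Real.exp (-κ * Real.cosh (2 * v)) ≤ ∫ v in Ioi u,
        Real.exp (-(κ₀ / 2) * Real.cosh (2 * v)) * Real.exp (-(κ / 2 * Real.cosh (2 * u))) := by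
        refine setIntegral_mono_on (integrableOn_exp_neg_mul_cosh hκ' u)
          (hi.mono_set (Ioi_subset_Ioi hu.le)) measurableSet_Ioi fun v hv => ?_
        rw [← Real.exp_add]
        apply Real.exp_le_exp.mpr
        have h1 : Real.cosh (2 * u) ≤ Real.cosh (2 * v) := by
          rw [Real.cosh_le_cosh, abs_of_pos (by linarith), abs_of_pos]
          · linarith [mem_Ioi.mp hv]
          · linarith [mem_Ioi.mp hv]
        nlinarith [Real.cosh_pos (2 * v)]
    _ ≤ _ := setIntegral_mono_set hi
        (Filter.Eventually.of_forall fun v => (by positivity))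
        (Ioi_subset_Ioi hu.le).eventuallyLE

theorem besselK0_nonneg (κ : ℝ) : 0 ≤ besselK0 κ := integral_nonneg fun _ => (Real.exp_pos _).le

theorem abs_besselTail_le {κ₀ κ : ℝ} (hκ₀ : 0 < κ₀) (hκ : κ₀ ≤ κ) (u : ℝ) :
    |besselTail κ u| ≤ besselK0 (κ₀ / 2) / 2 * Real.exp (-(κ / 2 * Real.cosh (2 * u))) := by
  rcases lt_trichotomy u 0 with hu | rfl | hu
  · have h := abs_besselTail_le_of_pos hκ₀ hκ (neg_pos.mpr hu)
    rwa [besselTail_neg, abs_neg, mul_neg, Real.cosh_neg] at h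
  · rw [besselTail_zero, abs_zero]
    have := besselK0_nonneg (κ₀ / 2)
    positivity
  · exact abs_besselTail_le_of_pos hκ₀ hκ hu

theorem besselTail_sub (κ u₁ u₂ : ℝ) : besselTail κ u₂ - besselTail κ u₁ =
    1 / 2 * (Real.sign u₂ - Real.sign u₁) * besselK0 κ -
      ∫ v in u₁..u₂, Real.exp (-κ * Real.cosh (2 * v)) := by
  have hc : Continuous fun v => Real.exp (-κ * Real.cosh (2 * v)) := by fun_prop
  rw [← intervalIntegral.integral_interval_sub_left (a := 0) (hc.intervalIntegrable _ _)
    (hc.intervalIntegrable _ _), besselTail, besselTail]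
  ring

/-- Since sinh preserves signs, the bracket detects a change of sign between u₁ and u₂. The
convention sgn 0 = 0 gives weight 1/2 when exactly one of them vanishes, and the leading sign
removes u₁ = u₂ = 0. -/
theorem sign_sub_mul_bracket {c : ℝ} (hc : 0 < c) (u₁ u₂ : ℝ) :
    Real.sign (u₂ - u₁) * (1 / 2 * (1 - Real.sign (c * (Real.sinh u₁ * Real.sinh u₂)))) =
      1 / 2 * (Real.sign u₂ - Real.sign u₁) := by
  rcases lt_trichotomy u₁ 0 with h₁ | rfl | h₁ <;> rcases lt_trichotomy u₂ 0 with h₂ | rfl | h₂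
  · rw [Real.sign_of_pos (mul_pos hc (mul_pos_of_neg_of_neg (Real.sinh_neg_iff.mpr h₁)
      (Real.sinh_neg_iff.mpr h₂))), Real.sign_of_neg h₁, Real.sign_of_neg h₂]
    ring
  · rw [Real.sign_of_pos (by linarith), Real.sign_of_neg h₁]
    simp
  · rw [Real.sign_of_neg (mul_neg_of_pos_of_neg hc (mul_neg_of_neg_of_pos
      (Real.sinh_neg_iff.mpr h₁) (Real.sinh_pos_iff.mpr h₂))), Real.sign_of_neg h₁,
      Real.sign_of_pos h₂, Real.sign_of_pos (by linarith)]
    ring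
  · rw [Real.sign_of_neg (by linarith), Real.sign_of_neg h₂]
    simp
  · simp
  · rw [Real.sign_of_pos (by linarith), Real.sign_of_pos h₂]
    simp
  · rw [Real.sign_of_neg (mul_neg_of_pos_of_neg hc (mul_neg_of_pos_of_neg
      (Real.sinh_pos_iff.mpr h₁) (Real.sinh_neg_iff.mpr h₂))), Real.sign_of_pos h₁,
      Real.sign_of_neg h₂, Real.sign_of_neg (by linarith)]
    ring
  · rw [Real.sign_of_neg (by linarith), Real.sign_of_pos h₁]
    simp
  · rw [Real.sign_of_pos (mul_pos hc (mul_pos (Real.sinh_pos_iff.mpr h₁)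
      (Real.sinh_pos_iff.mpr h₂))), Real.sign_of_pos h₁, Real.sign_of_pos h₂]
    ring

/-- The parameter `t` at which `e⁻²ᵗa² + e²ᵗb²` is minimal. -/
def critParam (a b : ℝ) : ℝ := Real.log (|a| / |b|) / 2

theorem abs_eq_abs_mul_exp_critParam {a b : ℝ} (ha : a ≠ 0) (hb : b ≠ 0) :
    |a| = |b| * (Real.exp (critParam a b) * Real.exp (critParam a b)) := by
  have h : 0 < |a| / |b| := div_pos (abs_pos.mpr ha) (abs_pos.mpr hb)
  rw [← Real.exp_add, critParam, add_halves, Real.exp_log h]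
  field_simp

theorem abs_mul_exp_sub {a b : ℝ} (ha : a ≠ 0) (hb : b ≠ 0) (t : ℝ) :
    |b| * Real.exp t - |a| * Real.exp (-t) =
      2 * |b| * Real.exp (critParam a b) * Real.sinh (t - critParam a b) := by
  rw [abs_eq_abs_mul_exp_critParam ha hb, Real.sinh_eq]
  have h1 : Real.exp t = Real.exp (critParam a b) * Real.exp (t - critParam a b) := by
    rw [← Real.exp_add]; congr 1; ring
  have h2 : Real.exp (-(t - critParam a b)) = Real.exp (critParam a b) * Real.exp (-t) := by
    rw [← Real.exp_add]; congr 1; ring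
  rw [h1, h2]
  ring

/-- Centering t at the minimum of the form makes the two exponentials symmetric, which brings the
Gaussian into the shape of the integrand of K₀. -/
theorem exp_mul_sq_add_exp_mul_sq {a b : ℝ} (ha : a ≠ 0) (hb : b ≠ 0) (t : ℝ) :
    (Real.exp (-t) * a) ^ 2 + (Real.exp t * b) ^ 2 =
      2 * |a * b| * Real.cosh (2 * (t - critParam a b)) := by
  rw [mul_pow, mul_pow, ← sq_abs a, ← sq_abs b, abs_mul, abs_eq_abs_mul_exp_critParam ha hb,
    Real.cosh_eq]
  set s := critParam a b
  have h1 : Real.exp (2 * (t - s)) = Real.exp t ^ 2 * Real.exp (-s) ^ 2 := by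
    rw [← Real.exp_nat_mul, ← Real.exp_nat_mul, ← Real.exp_add]; congr 1; push_cast; ring
  have h2 : Real.exp (-(2 * (t - s))) = Real.exp (-t) ^ 2 * Real.exp s ^ 2 := by
    rw [← Real.exp_nat_mul, ← Real.exp_nat_mul, ← Real.exp_add]; congr 1; push_cast; ring
  have h3 : Real.exp s * Real.exp (-s) = 1 := by rw [← Real.exp_add]; simp
  rw [h1, h2]
  linear_combination (-|b| ^ 2 * Real.exp t ^ 2 * (Real.exp s * Real.exp (-s) + 1)) * h3

theorem gaussKernel_eq_exp_cosh {a b : ℝ} (ha : a ≠ 0) (hb : b ≠ 0) (x y t : ℝ) :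
    gaussKernel x y (Real.exp (-t) * a) (Real.exp t * b) = unitExp (a * b * x) *
      (Real.exp (-(2 * Real.pi * |a * b| * y) * Real.cosh (2 * (t - critParam a b))) : ℝ) := by
  rw [gaussKernel, exp_mul_sq_add_exp_mul_sq ha hb, unitExp, Complex.ofReal_exp, ← Complex.exp_add]
  have h : Real.exp (-t) * a * (Real.exp t * b) = a * b := by
    have : Real.exp (-t) * Real.exp t = 1 := by rw [← Real.exp_add]; simp
    linear_combination (a * b) * this
  rw [h]
  congr 1
  push_cast
  ring

/-- The difference between the Bessel summand and the integral of the Gaussian is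
`errorTerm` at `t₂` minus `errorTerm` at `t₁`. -/
def errorTerm (x y t a b : ℝ) : ℂ :=
  unitExp (a * b * x) * (besselTail (2 * Real.pi * |a * b| * y) (t - critParam a b) : ℝ)

theorem critParam_exp_mul {a b : ℝ} (ha : a ≠ 0) (hb : b ≠ 0) (s : ℝ) :
    critParam (Real.exp s * a) (Real.exp (-s) * b) = critParam a b + s := by
  rw [critParam, critParam, abs_mul, abs_mul, Real.abs_exp, Real.abs_exp, mul_div_mul_comm,
    ← Real.exp_sub, Real.log_mul (Real.exp_pos _).ne', Real.log_exp]
  · ring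
  · exact div_ne_zero (abs_ne_zero.mpr ha) (abs_ne_zero.mpr hb)

/-- The term depends only on ab and on t minus the critical parameter; the scaling preserves the
former and shifts t and the critical parameter alike. This makes the error terms cancel along the
action of γ. -/
theorem errorTerm_exp_mul {a b : ℝ} (ha : a ≠ 0) (hb : b ≠ 0) (x y t s : ℝ) :
    errorTerm x y (t + s) (Real.exp s * a) (Real.exp (-s) * b) = errorTerm x y t a b := by
  have h : Real.exp s * a * (Real.exp (-s) * b) = a * b := by
    have : Real.exp s * Real.exp (-s) = 1 := by rw [← Real.exp_add]; simp
    linear_combination (a * b) * this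
  rw [errorTerm, errorTerm, h, critParam_exp_mul ha hb]
  congr 3
  ring

/-- The surviving factor of the tail bound is exactly the Gaussian at height y/2, so the error terms
are summable like a theta series. The constant needs |ab| to stay away from 0. -/
theorem norm_errorTerm_le {a b δ : ℝ} (hδ : 0 < δ) (hab : δ ≤ |a * b|) (x : ℝ) {y : ℝ} (hy : 0 < y)
    (t : ℝ) : ‖errorTerm x y t a b‖ ≤ besselK0 (2 * Real.pi * δ * y / 2) / 2 *
      ‖gaussKernel x (y / 2) (Real.exp (-t) * a) (Real.exp t * b)‖ := by
  have hne : a * b ≠ 0 := abs_pos.mp (hδ.trans_le hab)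
  have ha := left_ne_zero_of_mul hne
  have hb := right_ne_zero_of_mul hne
  rw [errorTerm, norm_mul, norm_unitExp, one_mul, Complex.norm_real, Real.norm_eq_abs,
    norm_gaussKernel, exp_mul_sq_add_exp_mul_sq ha hb]
  have h := abs_besselTail_le (κ₀ := 2 * Real.pi * δ * y) (κ := 2 * Real.pi * |a * b| * y)
    (by positivity) (by gcongr) (t - critParam a b)
  refine h.trans (le_of_eq ?_)
  congr 2
  ring

theorem integral_gaussKernel {a b : ℝ} (ha : a ≠ 0) (hb : b ≠ 0) (x y t₁ t₂ : ℝ) :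
    ∫ t in t₁..t₂, gaussKernel x y (Real.exp (-t) * a) (Real.exp t * b) =
      unitExp (a * b * x) * (∫ v in (t₁ - critParam a b)..(t₂ - critParam a b),
        Real.exp (-(2 * Real.pi * |a * b| * y) * Real.cosh (2 * v)) : ℝ) := by
  simp_rw [gaussKernel_eq_exp_cosh ha hb]
  rw [intervalIntegral.integral_const_mul, intervalIntegral.integral_ofReal,
    ← intervalIntegral.integral_comp_sub_right
      (fun v => Real.exp (-(2 * Real.pi * |a * b| * y) * Real.cosh (2 * v)))]

/-- The bracket with `B(ν, c(t)) = beᵗ - ae⁻ᵗ` for a vector with `ab > 0`. -/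
theorem sign_mul_bracket_sub {a b : ℝ} (hab : 0 < a * b) (t₁ t₂ : ℝ) :
    Real.sign (t₂ - t₁) * (1 / 2 * (1 - Real.sign ((b * Real.exp t₁ - a * Real.exp (-t₁)) *
      (b * Real.exp t₂ - a * Real.exp (-t₂))))) =
      1 / 2 * (Real.sign (t₂ - critParam a b) - Real.sign (t₁ - critParam a b)) := by
  have ha := left_ne_zero_of_mul hab.ne'
  have hb := right_ne_zero_of_mul hab.ne'
  have h1 : (b * Real.exp t₁ - a * Real.exp (-t₁)) * (b * Real.exp t₂ - a * Real.exp (-t₂)) =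
      (|b| * Real.exp t₁ - |a| * Real.exp (-t₁)) * (|b| * Real.exp t₂ - |a| * Real.exp (-t₂)) := by
    rcases pos_and_pos_or_neg_and_neg_of_mul_pos hab with ⟨h, h'⟩ | ⟨h, h'⟩
    · rw [abs_of_pos h, abs_of_pos h']
    · rw [abs_of_neg h, abs_of_neg h']
      ring
  have hb' := abs_pos.mpr hb
  have h2 := sign_sub_mul_bracket (c := (2 * |b| * Real.exp (critParam a b)) ^ 2) (by positivity)
    (t₁ - critParam a b) (t₂ - critParam a b)
  rw [sub_sub_sub_cancel_right] at h2
  rw [h1, abs_mul_exp_sub ha hb, abs_mul_exp_sub ha hb, ← h2]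
  congr 4
  ring

/-- For ab > 0 both factors carry the common sign of a and b. Hence each vector contributes to only
one of the two series, according to the sign of Q. -/
theorem bracket_add_eq_zero {a b : ℝ} (hab : 0 < a * b) (t₁ t₂ : ℝ) :
    1 - Real.sign ((b * Real.exp t₁ + a * Real.exp (-t₁)) *
      (b * Real.exp t₂ + a * Real.exp (-t₂))) = 0 := by
  rw [Real.sign_of_pos, sub_self]
  have e1 := Real.exp_pos t₁
  have e2 := Real.exp_pos t₂
  have e3 := Real.exp_pos (-t₁)
  have e4 := Real.exp_pos (-t₂)
  rcases pos_and_pos_or_neg_and_neg_of_mul_pos hab with ⟨h, h'⟩ | ⟨h, h'⟩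
  · positivity
  · apply mul_pos_of_neg_of_neg <;> nlinarith

/-- The two Bessel summands in terms of the integral of the Gaussian. -/
theorem sign_mul_besselTerms {a b : ℝ} (hab : a * b ≠ 0) (x y t₁ t₂ : ℝ) :
    (Real.sign (t₂ - t₁) : ℂ) *
      (((1 / 2 * (1 - Real.sign ((b * Real.exp t₁ - a * Real.exp (-t₁)) *
        (b * Real.exp t₂ - a * Real.exp (-t₂)))) : ℝ) : ℂ) *
        (unitExp (a * b * x) * (besselK0 (2 * Real.pi * (1 * (a * b)) * y) : ℝ)) +
      ((1 / 2 * (1 - Real.sign ((b * Real.exp t₁ + a * Real.exp (-t₁)) *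
        (b * Real.exp t₂ + a * Real.exp (-t₂)))) : ℝ) : ℂ) *
        (unitExp (a * b * x) * (besselK0 (2 * Real.pi * (-1 * (a * b)) * y) : ℝ))) =
      (∫ t in t₁..t₂, gaussKernel x y (Real.exp (-t) * a) (Real.exp t * b)) +
        errorTerm x y t₂ a b - errorTerm x y t₁ a b := by
  have ha := left_ne_zero_of_mul hab
  have hb := right_ne_zero_of_mul hab
  -- The tails complete the finite integral, leaving K₀ times half the jump of sgn(t − s) from t₁ to
  -- t₂, with s the critical parameter.
  have hR : (∫ t in t₁..t₂, gaussKernel x y (Real.exp (-t) * a) (Real.exp t * b)) +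
      errorTerm x y t₂ a b - errorTerm x y t₁ a b = unitExp (a * b * x) *
        ((1 / 2 * (Real.sign (t₂ - critParam a b) - Real.sign (t₁ - critParam a b)) *
          besselK0 (2 * Real.pi * |a * b| * y) : ℝ) : ℂ) := by
    have h := besselTail_sub (2 * Real.pi * |a * b| * y) (t₁ - critParam a b) (t₂ - critParam a b)
    rw [sub_eq_iff_eq_add] at h
    rw [integral_gaussKernel ha hb, errorTerm, errorTerm, h]
    push_cast
    ring
  rw [hR]
  rcases lt_or_gt_of_ne hab with hneg | hpos
  -- Changing the sign of a exchanges the brackets for c and c^⊥ and keeps the critical parameter.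
  · have hpos : 0 < (-a) * b := by linarith
    have h1 := bracket_add_eq_zero hpos t₁ t₂
    have h2 := sign_mul_bracket_sub hpos t₁ t₂
    have h3 : critParam (-a) b = critParam a b := by rw [critParam, critParam, abs_neg]
    simp only [neg_mul, ← sub_eq_add_neg, sub_neg_eq_add, h3] at h1 h2
    rw [h1, ← h2, abs_of_neg hneg]
    push_cast
    ring_nf
  · rw [bracket_add_eq_zero hpos, ← sign_mul_bracket_sub hpos, abs_of_pos hpos]
    push_cast
    ring_nf

end

end IndefTheta

/-! ### The splitting coordinates, automorphs and periodic coefficients -/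

namespace IndefTheta

noncomputable section

variable {A : Matrix (Fin 2) (Fin 2) ℤ} {c₀ : Fin 2 → ℝ} {P : GL (Fin 2) ℝ}

theorem B_eq_Q (hA : A.IsSymm) (u v : Fin 2 → ℝ) : B A u v = Q A (u + v) - Q A u - Q A v := by
  have h10 : A 1 0 = A 0 1 := hA.apply 0 1
  simp only [Q_apply, B, dotProduct, Matrix.mulVec, Fin.sum_univ_two, Matrix.map_apply,
    Pi.add_apply, h10]
  ring

theorem Splits.B_eq (hP : Splits A c₀ P) (hA : A.IsSymm) (u v : Fin 2 → ℝ) :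
    B A u v = P.1.mulVec u 0 * P.1.mulVec v 1 + P.1.mulVec u 1 * P.1.mulVec v 0 := by
  rw [B_eq_Q hA, hP.eq_mul, hP.eq_mul, hP.eq_mul, Matrix.mulVec_add]
  simp only [Pi.add_apply]
  ring

theorem mulVec_inv_mulVec (P : GL (Fin 2) ℝ) (v : Fin 2 → ℝ) :
    P.1.mulVec ((P⁻¹ : GL (Fin 2) ℝ).1.mulVec v) = v := by
  rw [Matrix.mulVec_mulVec, ← Units.val_mul, mul_inv_cancel, Units.val_one, Matrix.one_mulVec]

theorem Splits.B_cCurve (hP : Splits A c₀ P) (hA : A.IsSymm) (v : Fin 2 → ℝ) (t : ℝ) :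
    B A v (cCurve P t) = P.1.mulVec v 1 * Real.exp t - P.1.mulVec v 0 * Real.exp (-t) := by
  rw [hP.B_eq hA, cCurve, mulVec_inv_mulVec]
  simp
  ring

theorem Splits.B_cPerpCurve (hP : Splits A c₀ P) (hA : A.IsSymm) (v : Fin 2 → ℝ) (t : ℝ) :
    B A v (cPerpCurve P t) = P.1.mulVec v 1 * Real.exp t + P.1.mulVec v 0 * Real.exp (-t) := by
  rw [hP.B_eq hA, cPerpCurve, mulVec_inv_mulVec]
  simp
  ring

theorem Splits.transpose_mul_mul (hP : Splits A c₀ P) (hA : A.IsSymm) :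
    P.1.transpose * !![0, 1; 1, 0] * P.1 = A.map (Int.cast : ℤ → ℝ) := by
  ext i j
  have h := hP.B_eq hA (Pi.single i 1) (Pi.single j 1)
  rw [B, single_one_dotProduct, Matrix.mulVec_single_one, Matrix.mulVec_single_one,
    Matrix.mulVec_single_one] at h
  simp only [Matrix.col_apply] at h
  rw [h]
  simp [Matrix.mul_apply, Fin.sum_univ_two]
  ring

theorem toReal_actInt (γ : SL(2, ℤ)) (ν : Fin 2 → ℤ) :
    toReal (actInt γ ν) = actReal γ (toReal ν) := toReal_mulVec _ _

theorem mulVec_mem_CQ (hA : A.IsSymm) (hc₀ : Q A c₀ = -1) (hP : Splits A c₀ P) {c : Fin 2 → ℝ}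
    (hc : c ∈ CQ A c₀) : P.1.mulVec c 0 = Real.exp (tParam P c) := by
  conv_lhs => rw [← cCurve_tParam hA hc₀ hP hc]
  rw [cCurve, mulVec_inv_mulVec]
  simp

/-- Elements of `Aut⁺(Q, ℤ²)` act as `diag(eˢ, e⁻ˢ)` in the coordinates given by `P`. -/
theorem exists_exp_of_mem_AutPlus (hA : A.IsSymm) (hc₀ : Q A c₀ = -1) (hP : Splits A c₀ P)
    {γ : SL(2, ℤ)} (hγ : γ ∈ AutPlus A c₀) :
    ∃ s : ℝ, ∀ v, P.1.mulVec (actReal γ v) 0 = Real.exp s * P.1.mulVec v 0 ∧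
      P.1.mulVec (actReal γ v) 1 = Real.exp (-s) * P.1.mulVec v 1 := by
  set M : Matrix (Fin 2) (Fin 2) ℝ := P.1 * (γ.1.map (Int.cast : ℤ → ℝ)) * (P⁻¹ : GL (Fin 2) ℝ).1
    with hM
  have hact : ∀ v, P.1.mulVec (actReal γ v) = M.mulVec (P.1.mulVec v) := by
    intro v
    rw [hM, Matrix.mulVec_mulVec, Matrix.mul_assoc, ← Units.val_mul, inv_mul_cancel, Units.val_one,
      Matrix.mul_one, ← Matrix.mulVec_mulVec]
    rfl
  have hform : ∀ p q : ℝ, (M 0 0 * p + M 0 1 * q) * (M 1 0 * p + M 1 1 * q) = p * q := by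
    intro p q
    have h := hγ.1 ((P⁻¹ : GL (Fin 2) ℝ).1.mulVec ![p, q])
    rw [hP.eq_mul, hP.eq_mul, hact, mulVec_inv_mulVec] at h
    simpa [Matrix.mulVec, dotProduct, Fin.sum_univ_two] using h
  have hdet : M 0 0 * M 1 1 - M 0 1 * M 1 0 = 1 := by
    rw [← Matrix.det_fin_two, hM, Matrix.det_mul_right_comm, Matrix.det_mul, ← Units.val_mul,
      mul_inv_cancel, Units.val_one, Matrix.det_one, one_mul,
      show (γ.1.map (Int.cast : ℤ → ℝ)).det = (γ.1.det : ℝ) from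
      ((Int.castRingHom ℝ).map_det γ.1).symm, γ.2, Int.cast_one]
  have h10 := hform 1 0
  have h01 := hform 0 1
  have h11 := hform 1 1
  ring_nf at h10 h01 h11
  -- An isometry of pq is diagonal or antidiagonal; determinant 1 excludes the antidiagonal ones.
  have hprod : M 0 0 * M 1 1 = 1 := by linarith
  have hne0 : M 0 0 ≠ 0 := left_ne_zero_of_mul (hprod ▸ one_ne_zero)
  have hne1 : M 1 1 ≠ 0 := right_ne_zero_of_mul (hprod ▸ one_ne_zero)
  have hz1 : M 1 0 = 0 := (mul_eq_zero.mp h10).resolve_left hne0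
  have hz0 : M 0 1 = 0 := (mul_eq_zero.mp h01).resolve_right hne1
  -- Preserving the chosen component excludes −diag(eˢ, e⁻ˢ), because the first coordinate is
  -- positive on it.
  have hpos : 0 < M 0 0 := by
    have hmem : actReal γ ((P⁻¹ : GL (Fin 2) ℝ).1.mulVec ![1, -1]) ∈ CQ A c₀ := by
      rw [← hγ.2]
      exact ⟨_, hP.mem, rfl⟩
    have h := mulVec_mem_CQ hA hc₀ hP hmem
    rw [hact, mulVec_inv_mulVec] at h
    simp [Matrix.mulVec, dotProduct, Fin.sum_univ_two, hz0] at h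
    rw [h]
    exact Real.exp_pos _
  refine ⟨Real.log (M 0 0), fun v => ?_⟩
  rw [hact, Real.exp_neg, Real.exp_log hpos, ← eq_inv_of_mul_eq_one_right hprod]
  constructor <;> simp [Matrix.mulVec, dotProduct, Fin.sum_univ_two, hz0, hz1]

theorem actReal_mem_CQ {γ : SL(2, ℤ)} (hγ : γ ∈ AutPlus A c₀) {c : Fin 2 → ℝ}
    (hc : c ∈ CQ A c₀) : actReal γ c ∈ CQ A c₀ := by
  rw [← hγ.2]
  exact ⟨c, hc, rfl⟩

theorem tParam_actReal (hA : A.IsSymm) (hc₀ : Q A c₀ = -1) (hP : Splits A c₀ P) {γ : SL(2, ℤ)}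
    {s : ℝ} (hs : ∀ v, P.1.mulVec (actReal γ v) 0 = Real.exp s * P.1.mulVec v 0)
    {c : Fin 2 → ℝ} (hc : c ∈ CQ A c₀) : tParam P (actReal γ c) = tParam P c + s := by
  rw [tParam, hs, mulVec_mem_CQ hA hc₀ hP hc, ← Real.exp_add, Real.log_exp, add_comm]

/-- `SL₂(ℤ)` permutes `ℤ²`. -/
def actIntEquiv (γ : SL(2, ℤ)) : (Fin 2 → ℤ) ≃ (Fin 2 → ℤ) where
  toFun := actInt γ
  invFun := actInt γ⁻¹
  left_inv ν := by
    rw [actInt, actInt, Matrix.mulVec_mulVec, ← Matrix.SpecialLinearGroup.coe_mul, inv_mul_cancel,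
      Matrix.SpecialLinearGroup.coe_one, Matrix.one_mulVec]
  right_inv ν := by
    rw [actInt, actInt, Matrix.mulVec_mulVec, ← Matrix.SpecialLinearGroup.coe_mul, mul_inv_cancel,
      Matrix.SpecialLinearGroup.coe_one, Matrix.one_mulVec]

/-- The relation `∑ (m_j - m_j ∘ γ_j) = 0` makes sums over `ℤ²` telescope. -/
theorem sum_tsum_mul_eq {ι : Type*} [Fintype ι] {m : ι → (Fin 2 → ℤ) → ℂ} {γ : ι → SL(2, ℤ)}
    (hsum : ∑ j, (m j - m j ∘ actInt (γ j)) = 0) {h : (Fin 2 → ℤ) → ℂ}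
    {h' : ι → (Fin 2 → ℤ) → ℂ}
    (hh : ∀ j ν, m j (actInt (γ j) ν) * h' j (actInt (γ j) ν) = m j (actInt (γ j) ν) * h ν)
    (hs : ∀ j, Summable fun ν => m j ν * h ν)
    (hs' : ∀ j, Summable fun ν => m j (actInt (γ j) ν) * h ν) :
    ∑ j, ∑' ν, m j ν * h' j ν = ∑ j, ∑' ν, m j ν * h ν := by
  have h1 : ∀ j, ∑' ν, m j ν * h' j ν = ∑' ν, m j (actInt (γ j) ν) * h ν := by
    intro j
    rw [← (actIntEquiv (γ j)).tsum_eq]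
    exact tsum_congr fun ν => hh j ν
  simp_rw [h1]
  rw [← Summable.tsum_finsetSum fun j _ => hs' j, ← Summable.tsum_finsetSum fun j _ => hs j]
  refine tsum_congr fun ν => ?_
  have h2 := congrFun hsum ν
  simp only [Finset.sum_apply, Pi.sub_apply, Function.comp_apply, Pi.zero_apply,
    Finset.sum_sub_distrib, sub_eq_zero] at h2
  rw [← Finset.sum_mul, ← Finset.sum_mul, h2]

theorem IsPeriodic.exists_norm_le {m : (Fin 2 → ℤ) → ℂ} (hm : IsPeriodic m) :
    ∃ C, ∀ ν, ‖m ν‖ ≤ C := by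
  obtain ⟨L, hL, h⟩ := hm
  refine ⟨∑ r ∈ Fintype.piFinset fun _ : Fin 2 => Finset.Ico 0 |L|, ‖m r‖, fun ν => ?_⟩
  have h1 : m ν = m (fun i => ν i % L) := by
    rw [← h (fun i => ν i % L) (fun i => ν i / L)]
    congr 1
    ext i
    simp [Int.emod_add_mul_ediv]
  rw [h1]
  refine Finset.single_le_sum (f := fun r => ‖m r‖) (fun _ _ => norm_nonneg _) ?_
  simp only [Fintype.mem_piFinset, Finset.mem_Ico]
  exact fun i => ⟨Int.emod_nonneg _ hL, Int.emod_lt_abs _ hL⟩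

theorem exists_common_period {ι : Type*} [Fintype ι] {m : ι → (Fin 2 → ℤ) → ℂ}
    (hm : ∀ j, IsPeriodic (m j)) :
    ∃ L : ℤ, L ≠ 0 ∧ Even L ∧ ∀ j (ν μ : Fin 2 → ℤ), m j (ν + L • μ) = m j ν := by
  choose L hL h using hm
  -- The extra factor 2 makes L² A an even form even if A has odd diagonal entries.
  refine ⟨2 * ∏ j, L j, mul_ne_zero two_ne_zero (Finset.prod_ne_zero_iff.mpr fun j _ => hL j),
    even_two_mul _, fun j ν μ => ?_⟩
  obtain ⟨n, hn⟩ := Finset.dvd_prod_of_mem L (Finset.mem_univ j)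
  rw [hn, show (2 * (L j * n)) • μ = L j • ((2 * n) • μ) by rw [smul_smul]; congr 1; ring, h]

open DiscGroup

/-- The lattice `ℤ²`, rescaled to `LAℤ²`, inside the dual of the even lattice with Gram matrix
`L²A`. -/
theorem Splits.isDualForm (hP : Splits A c₀ P) (hA : A.IsSymm) {L : ℤ} (hL : L ≠ 0)
    (hL2 : Even L) :
    IsDualForm (P.1 * ((L • A).map (Int.cast : ℤ → ℝ))⁻¹) (L ^ 2 • A) := by
  have hAP := hP.transpose_mul_mul hA
  set A' := A.map (Int.cast : ℤ → ℝ) with hA'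
  have hL' : (L : ℝ) ≠ 0 := by exact_mod_cast hL
  have hPdet : P.1.det ≠ 0 := ((Matrix.isUnit_iff_isUnit_det _).mp P.isUnit).ne_zero
  have hdet : A'.det ≠ 0 := by
    rw [← hAP, Matrix.det_mul, Matrix.det_mul, Matrix.det_transpose, Matrix.det_fin_two_of]
    simpa using hPdet
  have hsymm : A'.transpose = A' := by
    rw [hA', ← Matrix.transpose_map, hA.eq]
  have e1 : (L • A).map (Int.cast : ℤ → ℝ) = (L : ℝ) • A' := by
    ext i j
    simp only [hA', Matrix.map_apply, Matrix.smul_apply, smul_eq_mul, Int.cast_mul]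
  have e2 : (L ^ 2 • A).map (Int.cast : ℤ → ℝ) = (L : ℝ) ^ 2 • A' := by
    ext i j
    simp only [hA', Matrix.map_apply, Matrix.smul_apply, smul_eq_mul, Int.cast_mul, Int.cast_pow]
  have hunit : IsUnit A'.det := hdet.isUnit
  have hinv : ((L : ℝ) • A')⁻¹ = (L : ℝ)⁻¹ • A'⁻¹ := by
    apply Matrix.inv_eq_left_inv
    rw [Matrix.smul_mul, Matrix.mul_smul, smul_smul, inv_mul_cancel₀ hL', one_smul,
      Matrix.nonsing_inv_mul _ hunit]
  refine ⟨?_, fun l => ?_⟩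
  · rw [e1, e2, hinv]
    calc (P.1 * ((L : ℝ)⁻¹ • A'⁻¹)).transpose * !![0, 1; 1, 0] * (P.1 * ((L : ℝ)⁻¹ • A'⁻¹)) *
          ((L : ℝ) ^ 2 • A') = ((L : ℝ)⁻¹ * (L : ℝ)⁻¹ * (L : ℝ) ^ 2) •
          (A'⁻¹.transpose * (P.1.transpose * !![0, 1; 1, 0] * P.1) * (A'⁻¹ * A')) := by
          simp only [Matrix.transpose_mul, Matrix.transpose_smul, Matrix.smul_mul, Matrix.mul_smul,
            smul_smul, Matrix.mul_assoc]
          congr 1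
          ring
      _ = 1 := by
          rw [hAP, Matrix.nonsing_inv_mul _ hunit, Matrix.mul_one, Matrix.transpose_nonsing_inv,
            hsymm, Matrix.nonsing_inv_mul _ hunit]
          have : (L : ℝ)⁻¹ * (L : ℝ)⁻¹ * (L : ℝ) ^ 2 = 1 := by field_simp
          rw [this, one_smul]
  · rw [Matrix.smul_mulVec, dotProduct_smul, smul_eq_mul]
    exact (hL2.pow_of_ne_zero two_ne_zero).mul_right _

/-- A theta function with periodic coefficients on `ℤ²` is one with coefficients on the
discriminant group. -/
theorem Splits.exists_theta_eq (hP : Splits A c₀ P) (hA : A.IsSymm) {L : ℤ} (hL : L ≠ 0)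
    (hL2 : Even L) {m : (Fin 2 → ℤ) → ℂ} (hm : ∀ ν μ : Fin 2 → ℤ, m (ν + L • μ) = m ν) :
    ∃ M : DiscGroup (L ^ 2 • A) → ℂ, ∀ t τ, theta P.1 m t τ =
      theta (P.1 * ((L • A).map (Int.cast : ℤ → ℝ))⁻¹) (fun k => M (cls _ k)) t τ := by
  classical
  have hD := hP.isDualForm hA hL hL2
  set S := L ^ 2 • A with hS
  set W := P.1 * ((L • A).map (Int.cast : ℤ → ℝ))⁻¹ with hW
  have hdetA : A.det ≠ 0 := by
    have h := hD.det_ne_zero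
    rw [hS, Matrix.det_smul] at h
    exact right_ne_zero_of_mul h
  have hdetLA : ((L • A).map (Int.cast : ℤ → ℝ)).det ≠ 0 := by
    rw [show ((L • A).map (Int.cast : ℤ → ℝ)).det = ((L • A).det : ℝ) from
      ((Int.castRingHom ℝ).map_det (L • A)).symm, Matrix.det_smul]
    exact_mod_cast mul_ne_zero (pow_ne_zero _ hL) hdetA
  have hWP : ∀ ν : Fin 2 → ℤ, W.mulVec (toReal ((L • A).mulVec ν)) = P.1.mulVec (toReal ν) := by
    intro ν
    rw [toReal_mulVec, Matrix.mulVec_mulVec, hW, Matrix.mul_assoc,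
      Matrix.nonsing_inv_mul _ hdetLA.isUnit, Matrix.mul_one]
  have hinj : Function.Injective (L • A).mulVec := by
    intro ν ν' h
    have h1 := congrArg (fun k => (P⁻¹ : GL (Fin 2) ℝ).1.mulVec (W.mulVec (toReal k))) h
    simp only [hWP, Matrix.mulVec_mulVec, ← Units.val_mul, inv_mul_cancel, Units.val_one,
      Matrix.one_mulVec] at h1
    ext i
    have := congrFun h1 i
    simp only [toReal] at this
    exact_mod_cast this
  -- Thus ν ↦ LAν sends Lℤ² onto Sℤ²: periodic functions on ℤ² become functions on classes, extended
  -- by zero off the image of LA.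
  have hSL : ∀ l, S.mulVec l = (L • A).mulVec (L • l) := by
    intro l
    rw [hS, Matrix.mulVec_smul, Matrix.smul_mulVec, Matrix.smul_mulVec, smul_smul, pow_two]
  let M : DiscGroup S → ℂ := fun x =>
    if h : ∃ ν, cls S ((L • A).mulVec ν) = x then m h.choose else 0
  have hM1 : ∀ ν, M (cls S ((L • A).mulVec ν)) = m ν := by
    intro ν
    have hex : ∃ ν', cls S ((L • A).mulVec ν') = cls S ((L • A).mulVec ν) := ⟨ν, rfl⟩
    have h1 : M (cls S ((L • A).mulVec ν)) = m hex.choose := dif_pos hex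
    obtain ⟨l, hl⟩ := cls_eq_cls_iff.mp hex.choose_spec
    rw [hSL, ← Matrix.mulVec_add] at hl
    rw [h1, hinj hl, hm]
  have hM2 : ∀ k, M (cls S k) ≠ 0 → k ∈ Set.range (L • A).mulVec := by
    intro k hk
    by_contra hc
    apply hk
    refine dif_neg ?_
    rintro ⟨ν, hν⟩
    obtain ⟨l, hl⟩ := cls_eq_cls_iff.mp hν.symm
    rw [hSL, ← Matrix.mulVec_add] at hl
    exact hc ⟨_, hl.symm⟩
  refine ⟨M, fun t τ => ?_⟩
  rw [theta, theta]
  congr 1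
  rw [← hinj.tsum_eq (f := fun k => M (cls S k) * latticeKernel W τ.re τ.im t k)]
  · refine tsum_congr fun ν => ?_
    rw [hM1, latticeKernel, latticeKernel, hWP]
  · intro k hk
    exact hM2 k (left_ne_zero_of_mul hk)

end

end IndefTheta

/-! ### Absolute convergence, and Φ as an integral of theta functions -/

namespace IndefTheta

noncomputable section

open MeasureTheory Set

/-- The integral over `t ∈ [t₁, t₂]` of a theta function, computed term by term. -/
def thetaIntegral (W : Matrix (Fin 2) (Fin 2) ℝ) (m : (Fin 2 → ℤ) → ℂ) (t₁ t₂ : ℝ) (τ : ℍ) : ℂ :=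
  (Real.sqrt τ.im : ℝ) * ∑' ν, m ν * ∫ t in t₁..t₂, latticeKernel W τ.re τ.im t ν

theorem continuous_latticeKernel (W : Matrix (Fin 2) (Fin 2) ℝ) (x y : ℝ) (ν : Fin 2 → ℤ) :
    Continuous fun t => latticeKernel W x y t ν := by
  unfold latticeKernel gaussKernel
  fun_prop

theorem abs_le_of_mem_uIoc {t₁ t₂ t : ℝ} (ht : t ∈ uIoc t₁ t₂) : |t| ≤ max |t₁| |t₂| := by
  rw [mem_uIoc] at ht
  rw [le_max_iff, abs_le, abs_le]
  rcases ht with ⟨h1, h2⟩ | ⟨h1, h2⟩ <;> rcases le_total t 0 with h | h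
  · left; constructor <;> [linarith [neg_abs_le t₁]; linarith [abs_nonneg t₁]]
  · right; constructor <;> [linarith [abs_nonneg t₂]; linarith [le_abs_self t₂]]
  · right; constructor <;> [linarith [neg_abs_le t₂]; linarith [abs_nonneg t₂]]
  · left; constructor <;> [linarith [abs_nonneg t₁]; linarith [le_abs_self t₁]]

variable {W : Matrix (Fin 2) (Fin 2) ℝ} {m : (Fin 2 → ℤ) → ℂ} {C : ℝ}

theorem summable_mul_integral_latticeKernel (hW : W.det ≠ 0) (hm : ∀ ν, ‖m ν‖ ≤ C) (x : ℝ) {y : ℝ}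
    (hy : 0 < y) (t₁ t₂ : ℝ) :
    Summable fun ν => m ν * ∫ t in t₁..t₂, latticeKernel W x y t ν := by
  obtain ⟨c, hc, h⟩ := exists_norm_latticeKernel_le hW (max |t₁| |t₂|)
  refine Summable.of_norm_bounded
    (((summable_exp_neg_lattice (mul_pos hc hy)).mul_right |t₂ - t₁|).mul_left C) fun ν => ?_
  rw [norm_mul]
  refine mul_le_mul (hm ν) ?_ (norm_nonneg _) ((norm_nonneg _).trans (hm ν))
  exact intervalIntegral.norm_integral_le_of_norm_le_const fun t ht =>
    h t (abs_le_of_mem_uIoc ht) x y hy.le ν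

theorem thetaIntegral_eq_integral (hW : W.det ≠ 0) (hm : ∀ ν, ‖m ν‖ ≤ C) (t₁ t₂ : ℝ) (τ : ℍ) :
    thetaIntegral W m t₁ t₂ τ = ∫ t in t₁..t₂, theta W m t τ := by
  obtain ⟨c, hc, h⟩ := exists_norm_latticeKernel_le hW (max |t₁| |t₂|)
  have hs := (summable_exp_neg_lattice (mul_pos hc τ.im_pos)).mul_left C
  have key := intervalIntegral.hasSum_integral_of_dominated_convergence (μ := volume) (a := t₁)
    (b := t₂) (F := fun ν t => m ν * latticeKernel W τ.re τ.im t ν)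
    (f := fun t => ∑' ν, m ν * latticeKernel W τ.re τ.im t ν)
    (fun ν _ => C * Real.exp (-((c * τ.im) * ((ν 0 : ℝ) ^ 2 + (ν 1 : ℝ) ^ 2))))
    (fun ν => ((continuous_latticeKernel W _ _ ν).const_mul (m ν)).aestronglyMeasurable)
    (fun ν => Filter.Eventually.of_forall fun t ht => by
      rw [norm_mul]
      exact mul_le_mul (hm ν) (h t (abs_le_of_mem_uIoc ht) _ _ τ.im_pos.le ν) (norm_nonneg _)
        ((norm_nonneg _).trans (hm ν)))
    (Filter.Eventually.of_forall fun t _ => hs) intervalIntegrable_const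
    (Filter.Eventually.of_forall fun t _ =>
      (summable_mul_latticeKernel hW hm _ τ.im_pos t).hasSum)
  simp only [intervalIntegral.integral_const_mul] at key
  simp only [thetaIntegral, theta, intervalIntegral.integral_const_mul]
  rw [key.tsum_eq]

theorem summable_mul_errorTerm (hW : W.det ≠ 0) (hm : ∀ ν, ‖m ν‖ ≤ C) {δ : ℝ} (hδ : 0 < δ)
    (hsupp : ∀ ν, m ν ≠ 0 → δ ≤ |W.mulVec (toReal ν) 0 * W.mulVec (toReal ν) 1|) (x : ℝ) {y : ℝ}
    (hy : 0 < y) (t : ℝ) : Summable fun ν =>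
      m ν * errorTerm x y t (W.mulVec (toReal ν) 0) (W.mulVec (toReal ν) 1) := by
  have hs := (summable_mul_latticeKernel hW hm x (half_pos hy) t).norm.mul_left
    (besselK0 (2 * Real.pi * δ * y / 2) / 2)
  refine Summable.of_norm_bounded hs fun ν => ?_
  by_cases h0 : m ν = 0
  · simp [h0]
  · rw [norm_mul, norm_mul, mul_left_comm]
    exact mul_le_mul_of_nonneg_left (norm_errorTerm_le hδ (hsupp ν h0) x hy t) (norm_nonneg _)

/-- Half of the exponent is estimated with cosh t ≥ 1 and leaves the integral. -/
theorem besselK0_le {κ₀ κ : ℝ} (hκ₀ : 0 < κ₀) (hκ : κ₀ ≤ κ) :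
    besselK0 κ ≤ besselK0 (κ₀ / 2) * Real.exp (-(κ / 2)) := by
  have hint : ∀ {b : ℝ}, 0 < b → IntegrableOn (fun t => Real.exp (-b * Real.cosh t)) (Ioi 0) := by
    intro b hb
    have := (integrableOn_Ioi_comp_mul_left_iff (fun t => Real.exp (-b * Real.cosh t)) 0
      (by norm_num : (0 : ℝ) < 2)).mp (integrableOn_exp_neg_mul_cosh hb 0)
    simpa using this
  rw [besselK0, besselK0, ← integral_mul_const]
  refine setIntegral_mono_on (hint (hκ₀.trans_le hκ)) ((hint (half_pos hκ₀)).mul_const _)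
    measurableSet_Ioi fun t _ => ?_
  rw [← Real.exp_add]
  apply Real.exp_le_exp.mpr
  nlinarith [Real.one_le_cosh t]

theorem abs_half_one_sub_sign_le (r : ℝ) : |1 / 2 * (1 - Real.sign r)| ≤ 1 := by
  rcases lt_trichotomy r 0 with h | rfl | h
  · rw [Real.sign_of_neg h]; norm_num
  · rw [Real.sign_zero]; norm_num
  · rw [Real.sign_of_pos h]; norm_num

/-- If the bracket does not vanish then the critical parameter lies between `t₁` and `t₂`, so that
the Bessel function has Gaussian decay. -/
theorem abs_bracket_mul_besselK0_le {a b δ y T E t₁ t₂ : ℝ} (hδ : 0 < δ) (hab : δ ≤ |a * b|)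
    (hy : 0 < y) (h₁ : |t₁| ≤ T) (h₂ : |t₂| ≤ T)
    (hE : ∀ t, |t| ≤ T → E ≤ Real.pi * ((Real.exp (-t) * a) ^ 2 + (Real.exp t * b) ^ 2)) :
    |1 / 2 * (1 - Real.sign ((b * Real.exp t₁ - a * Real.exp (-t₁)) *
      (b * Real.exp t₂ - a * Real.exp (-t₂))))| * besselK0 (2 * Real.pi * (a * b) * y) ≤
      besselK0 (2 * Real.pi * δ * y / 2) * Real.exp (-(y / 2 * E)) := by
  have hR : 0 ≤ besselK0 (2 * Real.pi * δ * y / 2) * Real.exp (-(y / 2 * E)) :=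
    mul_nonneg (besselK0_nonneg _) (Real.exp_pos _).le
  have hne : a * b ≠ 0 := abs_pos.mp (hδ.trans_le hab)
  have ha := left_ne_zero_of_mul hne
  have hb := right_ne_zero_of_mul hne
  rcases lt_or_gt_of_ne hne with hneg | hpos
  · have h := bracket_add_eq_zero (a := -a) (b := b) (by linarith) t₁ t₂
    simp only [neg_mul, ← sub_eq_add_neg] at h
    rw [h]
    simpa using hR
  by_cases hT : |critParam a b| ≤ T
  -- At the critical parameter the form equals 2|ab|, so the hypothesis there reads E ≤ 2π|ab|; the
  -- exponential decay of K₀ does the rest.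
  · have h1 := hE _ hT
    rw [exp_mul_sq_add_exp_mul_sq ha hb, sub_self, mul_zero, Real.cosh_zero, mul_one] at h1
    have h2 := besselK0_le (κ₀ := 2 * Real.pi * δ * y) (κ := 2 * Real.pi * |a * b| * y)
      (by positivity) (by gcongr)
    rw [abs_of_pos hpos] at h1 h2
    calc _ ≤ 1 * besselK0 (2 * Real.pi * (a * b) * y) :=
          mul_le_mul_of_nonneg_right (abs_half_one_sub_sign_le _) (besselK0_nonneg _)
      _ ≤ _ := by
          rw [one_mul]
          refine h2.trans (mul_le_mul_of_nonneg_left ?_ (besselK0_nonneg _))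
          apply Real.exp_le_exp.mpr
          nlinarith
  -- Here t₁ and t₂ lie on the same side of the critical parameter, so the bracket vanishes.
  · have hs : 0 < Real.sinh (t₁ - critParam a b) * Real.sinh (t₂ - critParam a b) := by
      rw [abs_le] at h₁ h₂
      rcases lt_abs.mp (not_le.mp hT) with h | h
      · exact mul_pos_of_neg_of_neg (Real.sinh_neg_iff.mpr (by linarith))
          (Real.sinh_neg_iff.mpr (by linarith))
      · exact mul_pos (Real.sinh_pos_iff.mpr (by linarith)) (Real.sinh_pos_iff.mpr (by linarith))
    have h1 : (b * Real.exp t₁ - a * Real.exp (-t₁)) * (b * Real.exp t₂ - a * Real.exp (-t₂)) =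
        (2 * b * Real.exp (critParam a b)) ^ 2 *
          (Real.sinh (t₁ - critParam a b) * Real.sinh (t₂ - critParam a b)) := by
      have e1 := abs_mul_exp_sub ha hb t₁
      have e2 := abs_mul_exp_sub ha hb t₂
      rcases pos_and_pos_or_neg_and_neg_of_mul_pos hpos with ⟨h, h'⟩ | ⟨h, h'⟩
      · rw [abs_of_pos h, abs_of_pos h'] at e1 e2
        rw [e1, e2]
        ring
      · rw [abs_of_neg h, abs_of_neg h'] at e1 e2
        have e1' : b * Real.exp t₁ - a * Real.exp (-t₁) =
          2 * b * Real.exp (critParam a b) * Real.sinh (t₁ - critParam a b) := by linarith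
        have e2' : b * Real.exp t₂ - a * Real.exp (-t₂) =
          2 * b * Real.exp (critParam a b) * Real.sinh (t₂ - critParam a b) := by linarith
        rw [e1', e2']
        ring
    have hb2 : 0 < (2 * b * Real.exp (critParam a b)) ^ 2 := by
      have := Real.exp_pos (critParam a b)
      positivity
    rw [h1, Real.sign_of_pos (mul_pos hb2 hs)]
    simpa using hR

variable {A : Matrix (Fin 2) (Fin 2) ℤ} {c₀ : Fin 2 → ℝ} {P : GL (Fin 2) ℝ}

/-- 2Q takes integer values on ℤ², so its nonzero values are bounded away from 0. This uniform gap
controls K₀ near its singularity. -/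
theorem half_le_abs_Q (ν : Fin 2 → ℤ) (h : Q A (toReal ν) ≠ 0) : 1 / 2 ≤ |Q A (toReal ν)| := by
  have h1 : Q A (toReal ν) = ((ν ⬝ᵥ A.mulVec ν : ℤ) : ℝ) / 2 := by
    rw [Q_apply, B, ← toReal_mulVec]
    simp [toReal, dotProduct]
  rw [h1] at h ⊢
  have h2 : (ν ⬝ᵥ A.mulVec ν : ℤ) ≠ 0 := by
    intro h0
    rw [h0, Int.cast_zero, zero_div] at h
    exact h rfl
  have h3 : (1 : ℝ) ≤ |((ν ⬝ᵥ A.mulVec ν : ℤ) : ℝ)| := by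
    exact_mod_cast Int.one_le_abs h2
  rw [abs_div, abs_two]
  linarith

theorem Splits.half_le_abs_mul (hP : Splits A c₀ P)
    (hsupp : ∀ ν, m ν ≠ 0 → Q A (toReal ν) ≠ 0) (ν : Fin 2 → ℤ) (h : m ν ≠ 0) :
    1 / 2 ≤ |P.1.mulVec (toReal ν) 0 * P.1.mulVec (toReal ν) 1| := by
  rw [← hP.eq_mul]
  exact half_le_abs_Q ν (hsupp ν h)

theorem det_ne_zero (P : GL (Fin 2) ℝ) : P.1.det ≠ 0 :=
  ((Matrix.isUnit_iff_isUnit_det _).mp P.isUnit).ne_zero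

theorem Splits.phiTerm_cCurve (hP : Splits A c₀ P) (hA : A.IsSymm) (m : (Fin 2 → ℤ) → ℂ)
    (t₁ t₂ s : ℝ) (τ : ℍ) (ν : Fin 2 → ℤ) : phiTerm A m (cCurve P t₁) (cCurve P t₂) s τ ν =
      ((1 / 2 * (1 - Real.sign ((P.1.mulVec (toReal ν) 1 * Real.exp t₁ -
        P.1.mulVec (toReal ν) 0 * Real.exp (-t₁)) * (P.1.mulVec (toReal ν) 1 * Real.exp t₂ -
          P.1.mulVec (toReal ν) 0 * Real.exp (-t₂)))) : ℝ) : ℂ) * m ν *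
        unitExp (P.1.mulVec (toReal ν) 0 * P.1.mulVec (toReal ν) 1 * τ.re) *
        (besselK0 (2 * Real.pi *
          (s * (P.1.mulVec (toReal ν) 0 * P.1.mulVec (toReal ν) 1)) * τ.im) : ℝ) := by
  rw [phiTerm, hP.B_cCurve hA, hP.B_cCurve hA, unitExp, ← hP.eq_mul]
  congr 3
  push_cast
  ring

theorem Splits.phiTerm_cPerpCurve (hP : Splits A c₀ P) (hA : A.IsSymm) (m : (Fin 2 → ℤ) → ℂ)
    (t₁ t₂ s : ℝ) (τ : ℍ) (ν : Fin 2 → ℤ) :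
    phiTerm A m (cPerpCurve P t₁) (cPerpCurve P t₂) s τ ν =
      ((1 / 2 * (1 - Real.sign ((P.1.mulVec (toReal ν) 1 * Real.exp t₁ +
        P.1.mulVec (toReal ν) 0 * Real.exp (-t₁)) * (P.1.mulVec (toReal ν) 1 * Real.exp t₂ +
          P.1.mulVec (toReal ν) 0 * Real.exp (-t₂)))) : ℝ) : ℂ) * m ν *
        unitExp (P.1.mulVec (toReal ν) 0 * P.1.mulVec (toReal ν) 1 * τ.re) *
        (besselK0 (2 * Real.pi *
          (s * (P.1.mulVec (toReal ν) 0 * P.1.mulVec (toReal ν) 1)) * τ.im) : ℝ) := by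
  rw [phiTerm, hP.B_cPerpCurve hA, hP.B_cPerpCurve hA, unitExp, ← hP.eq_mul]
  congr 3
  push_cast
  ring

theorem Splits.summable_phiTerm (hP : Splits A c₀ P) (hA : A.IsSymm) (hm : ∀ ν, ‖m ν‖ ≤ C)
    (hsupp : ∀ ν, m ν ≠ 0 → Q A (toReal ν) ≠ 0) (t₁ t₂ : ℝ) (τ : ℍ) :
    Summable (phiTerm A m (cCurve P t₁) (cCurve P t₂) 1 τ) ∧
      Summable (phiTerm A m (cPerpCurve P t₁) (cPerpCurve P t₂) (-1) τ) := by
  obtain ⟨c, hc, h⟩ := exists_pos_mul_le_mulVec (det_ne_zero P) (max |t₁| |t₂|)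
  have hy := τ.im_pos
  have hs := (summable_exp_neg_lattice (mul_pos (half_pos hy) hc)).mul_left
    (C * besselK0 (2 * Real.pi * (1 / 2) * τ.im / 2))
  have hC : 0 ≤ C := (norm_nonneg _).trans (hm 0)
  have key : ∀ (ν : Fin 2 → ℤ) (a b K : ℝ),
      1 / 2 ≤ |a * b| → K = besselK0 (2 * Real.pi * (a * b) * τ.im) →
      (∀ t, |t| ≤ max |t₁| |t₂| → c * ((ν 0 : ℝ) ^ 2 + (ν 1 : ℝ) ^ 2) ≤
        Real.pi * ((Real.exp (-t) * a) ^ 2 + (Real.exp t * b) ^ 2)) → ∀ r : ℝ,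
      ‖((1 / 2 * (1 - Real.sign ((b * Real.exp t₁ - a * Real.exp (-t₁)) *
        (b * Real.exp t₂ - a * Real.exp (-t₂)))) : ℝ) : ℂ) * m ν * unitExp r * (K : ℝ)‖ ≤
      C * besselK0 (2 * Real.pi * (1 / 2) * τ.im / 2) *
        Real.exp (-(τ.im / 2 * c * ((ν 0 : ℝ) ^ 2 + (ν 1 : ℝ) ^ 2))) := by
    intro ν a b K hab hK hE r
    have h1 := abs_bracket_mul_besselK0_le (by norm_num : (0 : ℝ) < 1 / 2) hab hy
      (le_max_left |t₁| |t₂|) (le_max_right |t₁| |t₂|) hE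
    rw [norm_mul, norm_mul, norm_mul, norm_unitExp, mul_one, Complex.norm_real, Complex.norm_real,
      Real.norm_eq_abs, Real.norm_eq_abs, hK, abs_of_nonneg (besselK0_nonneg _), mul_right_comm,
      mul_comm, mul_assoc C]
    refine mul_le_mul (hm ν) (h1.trans (le_of_eq ?_))
      (mul_nonneg (abs_nonneg _) (besselK0_nonneg _)) hC
    rw [mul_assoc (τ.im / 2)]
  constructor
  · refine Summable.of_norm_bounded hs fun ν => ?_
    by_cases h0 : m ν = 0
    · rw [phiTerm, h0]
      simp only [mul_zero, zero_mul, norm_zero]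
      have := besselK0_nonneg (2 * Real.pi * (1 / 2) * τ.im / 2)
      positivity
    rw [hP.phiTerm_cCurve hA]
    exact key ν _ _ _ (hP.half_le_abs_mul hsupp ν h0) (by rw [one_mul]) (fun t ht => h t ht ν) _
  · refine Summable.of_norm_bounded hs fun ν => ?_
    by_cases h0 : m ν = 0
    · rw [phiTerm, h0]
      simp only [mul_zero, zero_mul, norm_zero]
      have := besselK0_nonneg (2 * Real.pi * (1 / 2) * τ.im / 2)
      positivity
    rw [hP.phiTerm_cPerpCurve hA]
    -- Replacing a by −a turns the series for c^⊥ into the one already estimated.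
    have := key ν (-P.1.mulVec (toReal ν) 0) (P.1.mulVec (toReal ν) 1)
      (besselK0 (2 * Real.pi * (-1 * (P.1.mulVec (toReal ν) 0 * P.1.mulVec (toReal ν) 1)) * τ.im))
      (by rw [neg_mul, abs_neg]; exact hP.half_le_abs_mul hsupp ν h0) (by congr 3; ring)
      (fun t ht => by
        rw [mul_neg, neg_sq]
        exact h t ht ν) (P.1.mulVec (toReal ν) 0 * P.1.mulVec (toReal ν) 1 * τ.re)
    simpa only [neg_mul, sub_neg_eq_add] using this

/-- `Φ` is an integral of theta functions up to error terms that depend on one endpoint each. -/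
theorem Splits.Phi_eq (hP : Splits A c₀ P) (hA : A.IsSymm) (hm : ∀ ν, ‖m ν‖ ≤ C)
    (hsupp : ∀ ν, m ν ≠ 0 → Q A (toReal ν) ≠ 0) (t₁ t₂ : ℝ) (τ : ℍ) :
    Phi A P m (cCurve P t₁) (cCurve P t₂) τ = thetaIntegral P.1 m t₁ t₂ τ +
      (Real.sqrt τ.im : ℝ) * (∑' ν, m ν * errorTerm τ.re τ.im t₂ (P.1.mulVec (toReal ν) 0)
        (P.1.mulVec (toReal ν) 1) - ∑' ν, m ν * errorTerm τ.re τ.im t₁ (P.1.mulVec (toReal ν) 0)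
        (P.1.mulVec (toReal ν) 1)) := by
  obtain ⟨hs₁, hs₂⟩ := hP.summable_phiTerm hA hm hsupp t₁ t₂ τ
  have hδ := hP.half_le_abs_mul hsupp
  have he := fun t => summable_mul_errorTerm (det_ne_zero P) hm (by norm_num) hδ τ.re τ.im_pos t
  have hi := summable_mul_integral_latticeKernel (det_ne_zero P) hm τ.re τ.im_pos t₁ t₂
  rw [Phi, cPerp, cPerp, tParam_cCurve, tParam_cCurve, ← mul_add, ← hs₁.tsum_add hs₂, thetaIntegral,
    ← (he t₂).tsum_sub (he t₁), ← mul_add, ← hi.tsum_add ((he t₂).sub (he t₁)),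
    mul_comm ((Real.sign _ : ℝ) : ℂ), mul_assoc, ← tsum_mul_left]
  congr 1
  refine tsum_congr fun ν => ?_
  by_cases h0 : m ν = 0
  · simp [phiTerm, h0]
  have hab : P.1.mulVec (toReal ν) 0 * P.1.mulVec (toReal ν) 1 ≠ 0 :=
    abs_pos.mp ((by norm_num : (0 : ℝ) < 1 / 2).trans_le (hδ ν h0))
  have key := sign_mul_besselTerms hab τ.re τ.im t₁ t₂
  rw [hP.phiTerm_cCurve hA, hP.phiTerm_cPerpCurve hA]
  simp only [latticeKernel]
  linear_combination (m ν) * key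

end

end IndefTheta

/-! ### Smoothness and the Laplacian of the integrated theta functions -/

namespace IndefTheta

noncomputable section

open MeasureTheory Set

/-- The product of counting measure on `ℤ²` and Lebesgue measure between `t₁` and `t₂`. -/
def latticeMeasure (t₁ t₂ : ℝ) : Measure ((Fin 2 → ℤ) × ℝ) :=
  Measure.count.prod (volume.restrict (uIoc t₁ t₂))

/-- The frequency `2πab` in the variable `x` of the Gaussian. -/
def latticePhase (W : Matrix (Fin 2) (Fin 2) ℝ) (ξ : (Fin 2 → ℤ) × ℝ) : ℝ :=
  2 * Real.pi * (W.mulVec (toReal ξ.1) 0 * W.mulVec (toReal ξ.1) 1)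

/-- The rate of decay `π(e⁻²ᵗa² + e²ᵗb²)` in the variable `y` of the Gaussian. -/
def latticeDecay (W : Matrix (Fin 2) (Fin 2) ℝ) (ξ : (Fin 2 → ℤ) × ℝ) : ℝ :=
  Real.pi * ((Real.exp (-ξ.2) * W.mulVec (toReal ξ.1) 0) ^ 2 +
    (Real.exp ξ.2 * W.mulVec (toReal ξ.1) 1) ^ 2)

/-- The coefficients, with the sign of the orientation of the interval from `t₁` to `t₂`. -/
def latticeWeight (m : (Fin 2 → ℤ) → ℂ) (t₁ t₂ : ℝ) (ξ : (Fin 2 → ℤ) × ℝ) : ℂ :=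
  (if t₁ ≤ t₂ then 1 else -1) * m ξ.1

theorem norm_latticeWeight (m : (Fin 2 → ℤ) → ℂ) (t₁ t₂ : ℝ) (ξ : (Fin 2 → ℤ) × ℝ) :
    ‖latticeWeight m t₁ t₂ ξ‖ = ‖m ξ.1‖ := by
  rw [latticeWeight]
  split_ifs <;> simp

theorem abs_latticePhase_le (W : Matrix (Fin 2) (Fin 2) ℝ) (ξ : (Fin 2 → ℤ) × ℝ) :
    |latticePhase W ξ| ≤ latticeDecay W ξ := by
  have hu : Real.exp (-ξ.2) * Real.exp ξ.2 = 1 := by rw [← Real.exp_add]; simp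
  rw [latticePhase, latticeDecay]
  generalize Real.exp (-ξ.2) = u at *
  generalize Real.exp ξ.2 = v at *
  generalize W.mulVec (toReal ξ.1) 0 = a at *
  generalize W.mulVec (toReal ξ.1) 1 = b at *
  have h : a * b = (u * a) * (v * b) := by linear_combination (-(a * b)) * hu
  rw [h, abs_le]
  constructor <;> nlinarith [Real.pi_pos, mul_nonneg Real.pi_pos.le (sq_nonneg (u * a + v * b)),
    mul_nonneg Real.pi_pos.le (sq_nonneg (u * a - v * b))]

variable {W : Matrix (Fin 2) (Fin 2) ℝ} {m : (Fin 2 → ℤ) → ℂ} {C : ℝ}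

/-- The lattice sum and the t-integral are treated as one integral over a product measure, so that
the general results on exponential integrals apply at once. -/
theorem expIntegrable_lattice (hW : W.det ≠ 0) (hm : ∀ ν, ‖m ν‖ ≤ C) (t₁ t₂ : ℝ) :
    ExpIntegrable (latticeMeasure t₁ t₂) (latticePhase W) (latticeDecay W)
      (latticeWeight m t₁ t₂) := by
  have ha : Measurable fun ν : Fin 2 → ℤ => W.mulVec (toReal ν) 0 := measurable_of_countable _
  have hb : Measurable fun ν : Fin 2 → ℤ => W.mulVec (toReal ν) 1 := measurable_of_countable _
  have hm' : Measurable m := measurable_of_countable _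
  have hdec : Measurable (latticeDecay W) := by
    unfold latticeDecay
    fun_prop
  have hwt : Measurable (latticeWeight m t₁ t₂) := by
    unfold latticeWeight
    fun_prop
  refine ⟨by unfold latticePhase; fun_prop, hdec, hwt, abs_latticePhase_le W, fun y hy => ?_⟩
  obtain ⟨c, hc, h⟩ := exists_pos_mul_le_mulVec hW (max |t₁| |t₂|)
  have h1 : Integrable (fun ν : Fin 2 → ℤ =>
      C * Real.exp (-((c * y) * ((ν 0 : ℝ) ^ 2 + (ν 1 : ℝ) ^ 2)))) Measure.count :=
    integrable_count_iff.mpr ((summable_exp_neg_lattice (mul_pos hc hy)).mul_left C).norm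
  have h2 : Integrable (fun _ : ℝ => (1 : ℝ)) (volume.restrict (uIoc t₁ t₂)) := by
    refine integrable_const_iff.mpr (Or.inr ?_)
    rw [isFiniteMeasure_restrict, uIoc, Real.volume_Ioc]
    exact ENNReal.ofReal_ne_top
  refine Integrable.mono' (h1.mul_prod h2) (by fun_prop) ?_
  have hmem : ∀ᵐ ξ ∂(latticeMeasure t₁ t₂), ξ.2 ∈ uIoc t₁ t₂ :=
    Measure.quasiMeasurePreserving_snd.ae (ae_restrict_mem measurableSet_uIoc)
  filter_upwards [hmem] with ξ hξ
  rw [Real.norm_eq_abs, abs_of_nonneg (by positivity), norm_latticeWeight, mul_one]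
  refine mul_le_mul (hm _) (Real.exp_le_exp.mpr ?_) (Real.exp_pos _).le
    ((norm_nonneg _).trans (hm 0))
  have h3 := mul_le_mul_of_nonneg_right (h ξ.2 (abs_le_of_mem_uIoc hξ) ξ.1) hy.le
  rw [latticeDecay]
  linarith

theorem integral_latticeMeasure {t₁ t₂ : ℝ} {F : (Fin 2 → ℤ) × ℝ → ℂ}
    (hF : Integrable F (latticeMeasure t₁ t₂)) :
    ∫ ξ, F ξ ∂(latticeMeasure t₁ t₂) = ∑' ν, ∫ t in uIoc t₁ t₂, F (ν, t) := by
  have h := hF.integral_prod_left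
  rw [latticeMeasure, integral_prod _ hF, integral_countable h]
  simp [Measure.real]

theorem expIntegrand_lattice (p q : ℕ) (t₁ t₂ t : ℝ) (z : ℂ) (ν : Fin 2 → ℤ) :
    expIntegrand (latticePhase W) (latticeDecay W) (latticeWeight m t₁ t₂) p q z (ν, t) =
      (if t₁ ≤ t₂ then 1 else -1) * (m ν * (((latticePhase W (ν, t) : ℂ) * Complex.I) ^ p *
        (-(latticeDecay W (ν, t) : ℂ)) ^ q * latticeKernel W z.re z.im t ν)) := by
  rw [expIntegrand, latticeWeight, latticeKernel, gaussKernel]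
  have hu : (Real.exp (-t) : ℂ) * Real.exp t = 1 := by
    rw [← Complex.ofReal_mul, ← Real.exp_add]; simp
  have he : (latticePhase W (ν, t) : ℂ) * z.re * Complex.I - latticeDecay W (ν, t) * z.im =
      ((2 * Real.pi * (Real.exp (-t) * W.mulVec (toReal ν) 0 *
        (Real.exp t * W.mulVec (toReal ν) 1)) * z.re : ℝ) : ℂ) * Complex.I +
      ((-(Real.pi * ((Real.exp (-t) * W.mulVec (toReal ν) 0) ^ 2 +
        (Real.exp t * W.mulVec (toReal ν) 1) ^ 2) * z.im) : ℝ) : ℂ) := by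
    rw [latticePhase, latticeDecay]
    push_cast [-Complex.ofReal_exp]
    linear_combination (-(2 * Real.pi * (W.mulVec (toReal ν) 0 : ℂ) * W.mulVec (toReal ν) 1 *
      z.re * Complex.I)) * hu
  rw [he]
  ring

theorem orient_mul_integral (t₁ t₂ : ℝ) (f : ℝ → ℂ) :
    (if t₁ ≤ t₂ then 1 else -1 : ℂ) * ∫ t in uIoc t₁ t₂, f t = ∫ t in t₁..t₂, f t := by
  rw [intervalIntegral.intervalIntegral_eq_integral_uIoc]
  split_ifs <;> simp

theorem thetaIntegral_eq_expIntegral (hW : W.det ≠ 0) (hm : ∀ ν, ‖m ν‖ ≤ C) (t₁ t₂ : ℝ) (τ : ℍ) :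
    thetaIntegral W m t₁ t₂ τ = (Real.sqrt τ.im : ℝ) * expIntegral (latticeMeasure t₁ t₂)
      (latticePhase W) (latticeDecay W) (latticeWeight m t₁ t₂) 0 0 τ := by
  have hE := expIntegrable_lattice hW hm t₁ t₂
  rw [thetaIntegral, expIntegral, integral_latticeMeasure
    (hE.integrable_expIntegrand 0 0 (z := (τ : ℂ)) τ.im_pos)]
  congr 1
  refine tsum_congr fun ν => ?_
  simp only [expIntegrand_lattice, pow_zero, one_mul]
  rw [integral_const_mul, orient_mul_integral, intervalIntegral.integral_const_mul]
  rfl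

/-- The derivative of the Gaussian with respect to `t`. -/
def latticeKernelDeriv (W : Matrix (Fin 2) (Fin 2) ℝ) (x y t : ℝ) (ν : Fin 2 → ℤ) : ℂ :=
  ((-(Real.pi * y * (2 * (Real.exp t * W.mulVec (toReal ν) 1) ^ 2 -
    2 * (Real.exp (-t) * W.mulVec (toReal ν) 0) ^ 2)) : ℝ) : ℂ) * latticeKernel W x y t ν

theorem hasDerivAt_latticeKernel (W : Matrix (Fin 2) (Fin 2) ℝ) (x y t : ℝ) (ν : Fin 2 → ℤ) :
    HasDerivAt (fun t => latticeKernel W x y t ν) (latticeKernelDeriv W x y t ν) t := by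
  have h1 := (Real.hasDerivAt_exp t)
  have h2 : HasDerivAt (fun t => Real.exp (-t)) (-Real.exp (-t)) t := by
    simpa using (hasDerivAt_neg t).exp
  have ha := h2.mul_const (W.mulVec (toReal ν) 0)
  have hb := h1.mul_const (W.mulVec (toReal ν) 1)
  have hphase := ((((ha.mul hb).const_mul (2 * Real.pi)).mul_const x).ofReal_comp).mul_const
    Complex.I
  have hdecay := (((((ha.pow 2).add (hb.pow 2)).const_mul Real.pi).mul_const y).neg).ofReal_comp
  have key := (hphase.add hdecay).cexp
  refine key.congr_deriv ?_
  simp only [latticeKernelDeriv, latticeKernel, gaussKernel, Pi.add_apply, Pi.mul_apply,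
    Pi.pow_apply, Pi.neg_apply]
  rw [mul_comm]
  congr 1
  push_cast
  ring

/-- This is the heat-type identity ∂²/∂t² = 4(y²(∂²/∂x² + ∂²/∂y²) + y∂/∂y) on the kernel. It makes
the defect of the eigenvalue equation for an integrated theta function a pure boundary term. -/
theorem hasDerivAt_latticeKernelDeriv (W : Matrix (Fin 2) (Fin 2) ℝ) (x y t : ℝ) (ν : Fin 2 → ℤ) :
    HasDerivAt (fun t => latticeKernelDeriv W x y t ν)
      (4 * (((y : ℂ) ^ 2 * ((latticeDecay W (ν, t) : ℂ) ^ 2 - (latticePhase W (ν, t) : ℂ) ^ 2) -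
        y * latticeDecay W (ν, t)) * latticeKernel W x y t ν)) t := by
  have h1 := (Real.hasDerivAt_exp t)
  have h2 : HasDerivAt (fun t => Real.exp (-t)) (-Real.exp (-t)) t := by
    simpa using (hasDerivAt_neg t).exp
  have ha := h2.mul_const (W.mulVec (toReal ν) 0)
  have hb := h1.mul_const (W.mulVec (toReal ν) 1)
  have hc := ((((((hb.pow 2).const_mul 2).sub ((ha.pow 2).const_mul 2)).const_mul
    (Real.pi * y))).neg).ofReal_comp
  have key := hc.mul (hasDerivAt_latticeKernel W x y t ν)
  refine key.congr_deriv ?_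
  have hu : (Real.exp (-t) : ℂ) * Real.exp t = 1 := by
    rw [← Complex.ofReal_mul, ← Real.exp_add]; simp
  simp only [latticeKernelDeriv, latticeDecay, latticePhase, Pi.sub_apply,
    Pi.pow_apply, Pi.neg_apply]
  push_cast [-Complex.ofReal_exp]
  generalize (Real.exp (-t) : ℂ) = u at *
  generalize (Real.exp t : ℂ) = v at *
  generalize (W.mulVec (toReal ν) 0 : ℂ) = a at *
  generalize (W.mulVec (toReal ν) 1 : ℂ) = b at *
  generalize latticeKernel W x y t ν = k at *
  linear_combination (-16 * Real.pi ^ 2 * y ^ 2 * a ^ 2 * b ^ 2 * k * (u * v + 1)) * hu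

theorem summable_mul_latticeKernelDeriv (hW : W.det ≠ 0) (hm : ∀ ν, ‖m ν‖ ≤ C) (x : ℝ) {y : ℝ}
    (hy : 0 < y) (t : ℝ) : Summable fun ν => m ν * latticeKernelDeriv W x y t ν := by
  have hs := (summable_mul_latticeKernel hW hm x (half_pos hy) t).norm.mul_left 4
  refine Summable.of_norm_bounded hs fun ν => ?_
  rw [norm_mul, norm_mul, mul_left_comm]
  refine mul_le_mul_of_nonneg_left ?_ (norm_nonneg _)
  rw [latticeKernelDeriv, norm_mul, norm_latticeKernel, norm_latticeKernel, Complex.norm_real,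
    Real.norm_eq_abs]
  set p := (Real.exp (-t) * W.mulVec (toReal ν) 0) ^ 2 with hp
  set q := (Real.exp t * W.mulVec (toReal ν) 1) ^ 2 with hq
  have hp0 : 0 ≤ p := sq_nonneg _
  have hq0 : 0 ≤ q := sq_nonneg _
  have h1 : |-(Real.pi * y * (2 * q - 2 * p))| ≤ 2 * (Real.pi * (p + q) * y) := by
    have : 0 < Real.pi * y := by positivity
    rw [abs_neg, abs_le]
    constructor <;> nlinarith [mul_nonneg this.le hp0, mul_nonneg this.le hq0]
  have h2 := pow_mul_exp_neg_le (b := Real.pi * (p + q)) (by positivity) hy le_rfl 1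
  simp only [pow_one, Nat.factorial_one, Nat.cast_one] at h2
  calc _ ≤ 2 * (Real.pi * (p + q) * y) * Real.exp (-(Real.pi * (p + q) * y)) := by gcongr
    _ = 2 * y * (Real.pi * (p + q) * Real.exp (-(Real.pi * (p + q) * y))) := by ring
    _ ≤ 2 * y * (1 / (y / 2) * Real.exp (-(Real.pi * (p + q) * (y / 2)))) := by gcongr
    _ = _ := by field_simp; norm_num

/-- The hyperbolic Laplacian of an integral of theta functions. -/
theorem laplacian_thetaIntegral (hW : W.det ≠ 0) (hm : ∀ ν, ‖m ν‖ ≤ C) (t₁ t₂ : ℝ) (τ : ℍ) :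
    -((τ.im : ℂ) ^ 2) * Laplacian.laplacian (fun z : ℂ => (Real.sqrt z.im : ℂ) *
      expIntegral (latticeMeasure t₁ t₂) (latticePhase W) (latticeDecay W)
        (latticeWeight m t₁ t₂) 0 0 z) τ =
      1 / 4 * thetaIntegral W m t₁ t₂ τ - (Real.sqrt τ.im : ℝ) * (1 / 4 *
        (∑' ν, m ν * latticeKernelDeriv W τ.re τ.im t₂ ν -
          ∑' ν, m ν * latticeKernelDeriv W τ.re τ.im t₁ ν)) := by
  have hE := expIntegrable_lattice hW hm t₁ t₂
  have hpos : 0 < (τ : ℂ).im := τ.im_pos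
  have hmain := hE.laplacian_sqrt_mul hpos
  have hi := fun p q => hE.integrable_expIntegrand p q hpos
  have hint : (τ.im : ℂ) ^ 2 * (expIntegral (latticeMeasure t₁ t₂) (latticePhase W)
        (latticeDecay W) (latticeWeight m t₁ t₂) 2 0 τ + expIntegral (latticeMeasure t₁ t₂)
        (latticePhase W) (latticeDecay W) (latticeWeight m t₁ t₂) 0 2 τ) +
      τ.im * expIntegral (latticeMeasure t₁ t₂) (latticePhase W)
        (latticeDecay W) (latticeWeight m t₁ t₂) 0 1 τ =
      1 / 4 * (∑' ν, m ν * latticeKernelDeriv W τ.re τ.im t₂ ν -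
          ∑' ν, m ν * latticeKernelDeriv W τ.re τ.im t₁ ν) := by
    have h1 : Integrable (fun ξ => expIntegrand (latticePhase W) (latticeDecay W)
        (latticeWeight m t₁ t₂) 2 0 τ ξ + expIntegrand (latticePhase W) (latticeDecay W)
        (latticeWeight m t₁ t₂) 0 2 τ ξ) (latticeMeasure t₁ t₂) := (hi 2 0).add (hi 0 2)
    simp only [expIntegral]
    rw [← integral_add (hi 2 0) (hi 0 2), ← integral_const_mul, ← integral_const_mul,
      ← integral_add (h1.const_mul _) ((hi 0 1).const_mul _)]
    refine (integral_latticeMeasure ((h1.const_mul ((τ.im : ℂ) ^ 2)).add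
      ((hi 0 1).const_mul (τ.im : ℂ)))).trans ?_
    rw [← (summable_mul_latticeKernelDeriv hW hm _ τ.im_pos t₂).tsum_sub
      (summable_mul_latticeKernelDeriv hW hm _ τ.im_pos t₁), ← tsum_mul_left]
    refine tsum_congr fun ν => ?_
    -- The integrand is a quarter of a second t-derivative, so each lattice vector contributes only
    -- the first derivative at the two ends.
    have hftc := intervalIntegral.integral_eq_sub_of_hasDerivAt (a := t₁) (b := t₂)
      (fun t _ => hasDerivAt_latticeKernelDeriv W τ.re τ.im t ν)
      (Continuous.intervalIntegrable (by
        have := continuous_latticeKernel W τ.re τ.im ν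
        unfold latticeDecay latticePhase
        fun_prop) _ _)
    rw [← mul_sub, ← hftc, mul_left_comm, ← intervalIntegral.integral_const_mul,
      ← intervalIntegral.integral_const_mul, ← orient_mul_integral, ← integral_const_mul]
    refine integral_congr_ae (Filter.Eventually.of_forall fun t => ?_)
    simp only [Pi.add_apply, expIntegrand_lattice]
    have hI : (latticePhase W (ν, t) * Complex.I : ℂ) ^ 2 = -(latticePhase W (ν, t) : ℂ) ^ 2 := by
      rw [mul_pow, Complex.I_sq]
      ring
    rw [hI, UpperHalfPlane.coe_re, UpperHalfPlane.coe_im]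
    ring
  rw [thetaIntegral_eq_expIntegral hW hm, ← hint]
  exact hmain

end

end IndefTheta

/-! ### Cancellation over the collection and the Maass form properties -/

namespace IndefTheta

noncomputable section

open MeasureTheory Set

section Equivariance

variable {W : Matrix (Fin 2) (Fin 2) ℝ} {γ : SL(2, ℤ)} {s : ℝ}

/-- The scaling of a and b by e^{±s} cancels against the weights e^{∓(t+s)}. -/
theorem latticeKernel_actInt
    (hs : ∀ v, W.mulVec (actReal γ v) 0 = Real.exp s * W.mulVec v 0 ∧
      W.mulVec (actReal γ v) 1 = Real.exp (-s) * W.mulVec v 1) (x y t : ℝ) (ν : Fin 2 → ℤ) :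
    latticeKernel W x y (t + s) (actInt γ ν) = latticeKernel W x y t ν := by
  rw [latticeKernel, toReal_actInt, (hs _).1, (hs _).2, latticeKernel, ← mul_assoc, ← mul_assoc,
    ← Real.exp_add, ← Real.exp_add]
  congr 3
  · ring
  · ring

theorem latticeKernelDeriv_actInt
    (hs : ∀ v, W.mulVec (actReal γ v) 0 = Real.exp s * W.mulVec v 0 ∧
      W.mulVec (actReal γ v) 1 = Real.exp (-s) * W.mulVec v 1) (x y t : ℝ) (ν : Fin 2 → ℤ) :
    latticeKernelDeriv W x y (t + s) (actInt γ ν) = latticeKernelDeriv W x y t ν := by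
  rw [latticeKernelDeriv, latticeKernel_actInt hs, latticeKernelDeriv, toReal_actInt, (hs _).1,
    (hs _).2, ← mul_assoc, ← mul_assoc, ← Real.exp_add, ← Real.exp_add,
    show t + s + -s = t by ring, show -(t + s) + s = -t by ring]

theorem integral_latticeKernel_actInt
    (hs : ∀ v, W.mulVec (actReal γ v) 0 = Real.exp s * W.mulVec v 0 ∧
      W.mulVec (actReal γ v) 1 = Real.exp (-s) * W.mulVec v 1) (x y t t' : ℝ) (ν : Fin 2 → ℤ) :
    ∫ u in (t + s)..(t' + s), latticeKernel W x y u (actInt γ ν) =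
      ∫ u in t..t', latticeKernel W x y u ν := by
  rw [← intervalIntegral.integral_comp_add_right]
  simp only [latticeKernel_actInt hs]

end Equivariance

theorem thetaIntegral_add_thetaIntegral {W : Matrix (Fin 2) (Fin 2) ℝ} {m : (Fin 2 → ℤ) → ℂ}
    {C : ℝ} (hW : W.det ≠ 0) (hm : ∀ ν, ‖m ν‖ ≤ C) (t₁ t₂ t₃ : ℝ) (τ : ℍ) :
    thetaIntegral W m t₁ t₂ τ + thetaIntegral W m t₂ t₃ τ = thetaIntegral W m t₁ t₃ τ := by
  rw [thetaIntegral, thetaIntegral, thetaIntegral, ← mul_add,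
    ← (summable_mul_integral_latticeKernel hW hm _ τ.im_pos t₁ t₂).tsum_add
      (summable_mul_integral_latticeKernel hW hm _ τ.im_pos t₂ t₃)]
  congr 1
  refine tsum_congr fun ν => ?_
  rw [← mul_add, intervalIntegral.integral_add_adjacent_intervals] <;>
    exact (continuous_latticeKernel W _ _ ν).intervalIntegrable _ _

section Collection

variable {A : Matrix (Fin 2) (Fin 2) ℤ} {c₀ : Fin 2 → ℝ} {P : GL (Fin 2) ℝ}
  {ι : Type*} [Fintype ι] {m : ι → (Fin 2 → ℤ) → ℂ} {γ : ι → SL(2, ℤ)} {s : ι → ℝ} {C : ι → ℝ}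

/-- Moving t to t' changes the j-th integral by the integral from t + s_j to t' + s_j minus the one
from t to t'; summed over j these differences telescope to 0. -/
theorem sum_thetaIntegral_eq (hm : ∀ j ν, ‖m j ν‖ ≤ C j)
    (hs : ∀ j v, P.1.mulVec (actReal (γ j) v) 0 = Real.exp (s j) * P.1.mulVec v 0 ∧
      P.1.mulVec (actReal (γ j) v) 1 = Real.exp (-s j) * P.1.mulVec v 1)
    (hsum : ∑ j, (m j - m j ∘ actInt (γ j)) = 0) (t t' : ℝ) (τ : ℍ) :
    ∑ j, thetaIntegral P.1 (m j) t (t + s j) τ =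
      ∑ j, thetaIntegral P.1 (m j) t' (t' + s j) τ := by
  have hP := det_ne_zero P
  have htel : ∑ j, thetaIntegral P.1 (m j) (t + s j) (t' + s j) τ =
      ∑ j, thetaIntegral P.1 (m j) t t' τ := by
    simp only [thetaIntegral, ← Finset.mul_sum]
    congr 1
    exact sum_tsum_mul_eq hsum
      (h := fun ν => ∫ u in t..t', latticeKernel P.1 τ.re τ.im u ν)
      (h' := fun j ν => ∫ u in (t + s j)..(t' + s j), latticeKernel P.1 τ.re τ.im u ν)
      (fun j ν => by rw [integral_latticeKernel_actInt (hs j)])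
      (fun j => summable_mul_integral_latticeKernel hP (hm j) _ τ.im_pos _ _)
      (fun j => summable_mul_integral_latticeKernel hP (m := m j ∘ actInt (γ j))
        (fun ν => hm j _) _ τ.im_pos _ _)
  have h1 := Finset.sum_congr rfl fun (j : ι) (_ : j ∈ Finset.univ) =>
    (thetaIntegral_add_thetaIntegral hP (hm j) t (t + s j) (t' + s j) τ).trans
      (thetaIntegral_add_thetaIntegral hP (hm j) t t' (t' + s j) τ).symm
  rw [Finset.sum_add_distrib, Finset.sum_add_distrib, htel, add_comm] at h1
  exact add_left_cancel h1

theorem sum_tsum_latticeKernelDeriv_eq (hm : ∀ j ν, ‖m j ν‖ ≤ C j)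
    (hs : ∀ j v, P.1.mulVec (actReal (γ j) v) 0 = Real.exp (s j) * P.1.mulVec v 0 ∧
      P.1.mulVec (actReal (γ j) v) 1 = Real.exp (-s j) * P.1.mulVec v 1)
    (hsum : ∑ j, (m j - m j ∘ actInt (γ j)) = 0) (x : ℝ) {y : ℝ} (hy : 0 < y) (t : ℝ) :
    ∑ j, ∑' ν, m j ν * latticeKernelDeriv P.1 x y (t + s j) ν =
      ∑ j, ∑' ν, m j ν * latticeKernelDeriv P.1 x y t ν :=
  sum_tsum_mul_eq hsum (h' := fun j ν => latticeKernelDeriv P.1 x y (t + s j) ν)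
    (fun j ν => by rw [latticeKernelDeriv_actInt (hs j)])
    (fun j => summable_mul_latticeKernelDeriv (det_ne_zero P) (hm j) x hy t)
    (fun j => summable_mul_latticeKernelDeriv (det_ne_zero P) (m := m j ∘ actInt (γ j))
      (fun ν => hm j _) x hy t)

/-- In the sum over the collection the error terms cancel. -/
theorem Splits.sum_Phi_eq (hP : Splits A c₀ P) (hA : A.IsSymm) (hm : ∀ j ν, ‖m j ν‖ ≤ C j)
    (hsupp : ∀ j ν, m j ν ≠ 0 → Q A (toReal ν) ≠ 0) (hγ : ∀ j, γ j ∈ AutPlus A c₀)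
    (hs : ∀ j v, P.1.mulVec (actReal (γ j) v) 0 = Real.exp (s j) * P.1.mulVec v 0 ∧
      P.1.mulVec (actReal (γ j) v) 1 = Real.exp (-s j) * P.1.mulVec v 1)
    (hsum : ∑ j, (m j - m j ∘ actInt (γ j)) = 0) (t : ℝ) (τ : ℍ) :
    ∑ j, Phi A P (m j) (cCurve P t) (cCurve P (t + s j)) τ =
      ∑ j, thetaIntegral P.1 (m j) t (t + s j) τ := by
  have hsupp' : ∀ j ν, m j (actInt (γ j) ν) ≠ 0 → Q A (toReal ν) ≠ 0 := fun j ν h => by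
    have := hsupp j _ h
    rwa [toReal_actInt, (hγ j).1] at this
  simp only [hP.Phi_eq hA (hm _) (hsupp _)]
  rw [Finset.sum_add_distrib, ← Finset.mul_sum, Finset.sum_sub_distrib, add_eq_left]
  refine mul_eq_zero_of_right _ (sub_eq_zero.mpr ?_)
  refine sum_tsum_mul_eq hsum
    (h := fun ν => errorTerm τ.re τ.im t (P.1.mulVec (toReal ν) 0) (P.1.mulVec (toReal ν) 1))
    (h' := fun j ν => errorTerm τ.re τ.im (t + s j) (P.1.mulVec (toReal ν) 0)
      (P.1.mulVec (toReal ν) 1)) (fun j ν => ?_)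
    (fun j => summable_mul_errorTerm (det_ne_zero P) (hm j) (by norm_num)
      (hP.half_le_abs_mul (hsupp j)) _ τ.im_pos t)
    (fun j => summable_mul_errorTerm (det_ne_zero P) (m := m j ∘ actInt (γ j))
      (fun ν => hm j _) (by norm_num) (hP.half_le_abs_mul (hsupp' j)) _ τ.im_pos t)
  by_cases h0 : m j (actInt (γ j) ν) = 0
  · simp [h0]
  · have h1 := hsupp' j ν h0
    rw [hP.eq_mul, mul_ne_zero_iff] at h1
    rw [toReal_actInt, (hs j _).1, (hs j _).2, errorTerm_exp_mul h1.1 h1.2]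

theorem contDiffOn_sqrt_mul_expIntegral {W : Matrix (Fin 2) (Fin 2) ℝ} {m : (Fin 2 → ℤ) → ℂ}
    {C : ℝ} (hW : W.det ≠ 0) (hm : ∀ ν, ‖m ν‖ ≤ C) (t₁ t₂ : ℝ) :
    ContDiffOn ℝ ∞ (fun z : ℂ => (Real.sqrt z.im : ℂ) * expIntegral (latticeMeasure t₁ t₂)
      (latticePhase W) (latticeDecay W) (latticeWeight m t₁ t₂) 0 0 z) {z : ℂ | 0 < z.im} := by
  refine ContDiffOn.mul ?_ ((expIntegrable_lattice hW hm t₁ t₂).contDiffOn_infty_expIntegral 0 0)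
  refine Complex.ofRealCLM.contDiff.comp_contDiffOn (ContDiffOn.sqrt ?_ fun z hz => hz.ne')
  exact Complex.imCLM.contDiff.contDiffOn

theorem thetaIntegral_ofComplex {W : Matrix (Fin 2) (Fin 2) ℝ} {m : (Fin 2 → ℤ) → ℂ}
    {C : ℝ} (hW : W.det ≠ 0) (hm : ∀ ν, ‖m ν‖ ≤ C) (t₁ t₂ : ℝ) {z : ℂ} (hz : 0 < z.im) :
    thetaIntegral W m t₁ t₂ (UpperHalfPlane.ofComplex z) =
      (Real.sqrt z.im : ℂ) * expIntegral (latticeMeasure t₁ t₂)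
      (latticePhase W) (latticeDecay W) (latticeWeight m t₁ t₂) 0 0 z := by
  rw [thetaIntegral_eq_expIntegral hW hm, UpperHalfPlane.ofComplex_apply_of_im_pos hz]
  rfl

theorem contDiffOn_thetaIntegral {W : Matrix (Fin 2) (Fin 2) ℝ} {m : (Fin 2 → ℤ) → ℂ}
    {C : ℝ} (hW : W.det ≠ 0) (hm : ∀ ν, ‖m ν‖ ≤ C) (t₁ t₂ : ℝ) :
    ContDiffOn ℝ ∞ (fun z : ℂ => thetaIntegral W m t₁ t₂ (UpperHalfPlane.ofComplex z))
      {z : ℂ | 0 < z.im} :=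
  (contDiffOn_sqrt_mul_expIntegral hW hm t₁ t₂).congr fun _ hz =>
    thetaIntegral_ofComplex hW hm t₁ t₂ hz

theorem hypLaplacian_thetaIntegral {W : Matrix (Fin 2) (Fin 2) ℝ} {m : (Fin 2 → ℤ) → ℂ}
    {C : ℝ} (hW : W.det ≠ 0) (hm : ∀ ν, ‖m ν‖ ≤ C) (t₁ t₂ : ℝ) (τ : ℍ) :
    hypLaplacian (thetaIntegral W m t₁ t₂) τ =
      1 / 4 * thetaIntegral W m t₁ t₂ τ - (Real.sqrt τ.im : ℝ) * (1 / 4 *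
        (∑' ν, m ν * latticeKernelDeriv W τ.re τ.im t₂ ν -
          ∑' ν, m ν * latticeKernelDeriv W τ.re τ.im t₁ ν)) := by
  rw [hypLaplacian, ← laplacian_thetaIntegral hW hm]
  congr 1
  refine (InnerProductSpace.laplacian_congr_nhds ?_).eq_of_nhds
  filter_upwards [isOpen_im_pos.mem_nhds (show 0 < (τ : ℂ).im from τ.im_pos)] with z hz
  exact thetaIntegral_ofComplex hW hm t₁ t₂ hz

theorem hypLaplacian_sum {κ : Type*} (u : Finset κ) {f : κ → ℍ → ℂ}
    (hf : ∀ j ∈ u, ContDiffOn ℝ ∞ (fun z : ℂ => f j (UpperHalfPlane.ofComplex z))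
      {z : ℂ | 0 < z.im}) (τ : ℍ) :
    hypLaplacian (fun τ => ∑ j ∈ u, f j τ) τ = ∑ j ∈ u, hypLaplacian (f j) τ := by
  classical
  have hτ : {z : ℂ | 0 < z.im} ∈ nhds (τ : ℂ) := isOpen_im_pos.mem_nhds τ.im_pos
  have hat : ∀ j ∈ u, ContDiffAt ℝ 2 (fun z : ℂ => f j (UpperHalfPlane.ofComplex z)) τ :=
    fun j hj => contDiffAt_infty.mp ((hf j hj).contDiffAt hτ) 2
  simp only [hypLaplacian, ← Finset.mul_sum]
  congr 1
  clear hf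
  induction u using Finset.induction_on with
  | empty => simp
  | insert j u hj ih =>
    have h1 := hat j (Finset.mem_insert_self j u)
    have h2 : ContDiffAt ℝ 2 (fun z : ℂ => ∑ i ∈ u, f i (UpperHalfPlane.ofComplex z)) τ :=
      ContDiffAt.sum fun i hi => hat i (Finset.mem_insert_of_mem hi)
    simp only [Finset.sum_insert hj]
    rw [← ih fun i hi => hat i (Finset.mem_insert_of_mem hi)]
    exact h1.laplacian_add h2

theorem hypLaplacian_sum_thetaIntegral (hm : ∀ j ν, ‖m j ν‖ ≤ C j)
    (hs : ∀ j v, P.1.mulVec (actReal (γ j) v) 0 = Real.exp (s j) * P.1.mulVec v 0 ∧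
      P.1.mulVec (actReal (γ j) v) 1 = Real.exp (-s j) * P.1.mulVec v 1)
    (hsum : ∑ j, (m j - m j ∘ actInt (γ j)) = 0) (t : ℝ) (τ : ℍ) :
    hypLaplacian (fun τ => ∑ j, thetaIntegral P.1 (m j) t (t + s j) τ) τ =
      1 / 4 * ∑ j, thetaIntegral P.1 (m j) t (t + s j) τ := by
  rw [hypLaplacian_sum _ fun j _ => contDiffOn_thetaIntegral (det_ne_zero P) (hm j) _ _]
  simp only [hypLaplacian_thetaIntegral (det_ne_zero P) (hm _)]
  rw [Finset.sum_sub_distrib, ← Finset.mul_sum, ← Finset.mul_sum, ← Finset.mul_sum,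
    Finset.sum_sub_distrib, sum_tsum_latticeKernelDeriv_eq hm hs hsum _ τ.im_pos]
  simp

/-- For y ≥ 1 the series is dominated by a majorant at y = 1, and √y ≤ y. -/
theorem exists_norm_theta_le {W : Matrix (Fin 2) (Fin 2) ℝ} {m : (Fin 2 → ℤ) → ℂ}
    {C : ℝ} (hW : W.det ≠ 0) (hm : ∀ ν, ‖m ν‖ ≤ C) (T : ℝ) :
    ∃ E, ∀ t, |t| ≤ T → ∀ τ : ℍ, 1 ≤ τ.im → ‖theta W m t τ‖ ≤ E * τ.im := by
  obtain ⟨c, hc, h⟩ := exists_norm_latticeKernel_le hW T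
  have hC : 0 ≤ C := (norm_nonneg _).trans (hm 0)
  have hS := summable_exp_neg_lattice hc
  refine ⟨∑' k : Fin 2 → ℤ, C * Real.exp (-(c * ((k 0 : ℝ) ^ 2 + (k 1 : ℝ) ^ 2))),
    fun t ht τ hτ => ?_⟩
  rw [theta, norm_mul, mul_comm]
  refine mul_le_mul (tsum_of_norm_bounded (hS.mul_left C).hasSum fun k => ?_) ?_ (norm_nonneg _)
    (tsum_nonneg fun k => by positivity)
  · rw [norm_mul]
    refine mul_le_mul (hm k) ((h t ht _ _ τ.im_pos.le k).trans ?_) (norm_nonneg _) hC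
    rw [Real.exp_le_exp, neg_le_neg_iff]
    exact mul_le_mul_of_nonneg_right (le_mul_of_one_le_right hc.le hτ) (by positivity)
  · rw [Complex.norm_real, Real.norm_of_nonneg (Real.sqrt_nonneg _)]
    refine Real.sqrt_le_iff.mpr ⟨τ.im_pos.le, ?_⟩
    nlinarith

/-- Composition with σ only replaces the coefficients M by RM, so the behaviour at any cusp reduces
to that at infinity. -/
theorem IsDualForm.isBigO_integral_theta {W : Matrix (Fin 2) (Fin 2) ℝ}
    {S : Matrix (Fin 2) (Fin 2) ℤ} (h : IsDualForm W S) [Fintype (DiscGroup S)]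
    (M : DiscGroup S → ℂ) (t₁ t₂ : ℝ) (σ : SL(2, ℤ)) :
    (fun τ : ℍ => ∫ t in t₁..t₂, theta W (fun k => M (DiscGroup.cls S k)) t (σ • τ))
      =O[UpperHalfPlane.atImInfty] (fun τ : ℍ => τ.im ^ 1) := by
  obtain ⟨R, hR⟩ := h.exists_isIntertwiner σ
  obtain ⟨E, hE⟩ := exists_norm_theta_le h.det_left_ne_zero
    (m := fun k => R M (DiscGroup.cls S k)) (C := ∑ x, ‖R M x‖)
    (fun k => Finset.single_le_sum (f := fun x => ‖R M x‖) (fun x _ => norm_nonneg _)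
      (Finset.mem_univ _)) (max |t₁| |t₂|)
  refine Asymptotics.IsBigO.of_bound (E * |t₂ - t₁|) ?_
  refine (UpperHalfPlane.atImInfty_mem _).mpr ⟨1, fun τ hτ => ?_⟩
  have hb := intervalIntegral.norm_integral_le_of_norm_le_const (a := t₁) (b := t₂)
    (f := fun t => theta W (fun k => M (DiscGroup.cls S k)) t (σ • τ)) (C := E * τ.im)
    fun t ht => by
      rw [hR.theta]
      exact hE t (abs_le_of_mem_uIoc ht) τ hτ
  rw [mem_ofPred_eq, pow_one, Real.norm_of_nonneg τ.im_pos.le]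
  linarith

theorem Splits.isMaassForm (hP : Splits A c₀ P) (hA : A.IsSymm) (hper : ∀ j, IsPeriodic (m j))
    (hs : ∀ j v, P.1.mulVec (actReal (γ j) v) 0 = Real.exp (s j) * P.1.mulVec v 0 ∧
      P.1.mulVec (actReal (γ j) v) 1 = Real.exp (-s j) * P.1.mulVec v 1)
    (hsum : ∑ j, (m j - m j ∘ actInt (γ j)) = 0) (t : ℝ) :
    ∃ (Γ : Subgroup SL(2, ℤ)) (v : Γ →* Circle), IsMaassForm Γ v (1 / 4)
      (fun τ => ∑ j, thetaIntegral P.1 (m j) t (t + s j) τ) := by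
  choose C hm using fun j => (hper j).exists_norm_le
  obtain ⟨L, hL, hL2, hmL⟩ := exists_common_period hper
  have hD := hP.isDualForm hA hL hL2
  have := hD.finite_discGroup
  have : Fintype (DiscGroup (L ^ 2 • A)) := Fintype.ofFinite _
  choose M hM using fun j => hP.exists_theta_eq hA hL hL2 (hmL j)
  obtain ⟨v, hv⟩ := hD.exists_multiplier
  have hint : ∀ j τ, thetaIntegral P.1 (m j) t (t + s j) τ = ∫ u in t..(t + s j),
      theta (P.1 * ((L • A).map (Int.cast : ℤ → ℝ))⁻¹)
        (fun k => M j (DiscGroup.cls _ k)) u τ := fun j τ => by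
    rw [thetaIntegral_eq_integral (det_ne_zero P) (hm j)]
    simp only [hM]
  have : NeZero (2 * (L ^ 2 • A).det.natAbs) :=
    ⟨mul_ne_zero two_ne_zero (Int.natAbs_ne_zero.mpr hD.det_ne_zero)⟩
  refine ⟨_, v, inferInstance, fun h => ?_, ?_, ?_, fun g τ => ?_, fun σ => ⟨1, ?_⟩⟩
  -- −1 acts trivially on the upper half-plane, so its multiplier fixes a nonzero theta value.
  · have h1 := hv ⟨-1, h⟩ (fun _ => 1) 0 UpperHalfPlane.I
    rw [ModularGroup.SL_neg_smul, one_smul] at h1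
    exact Circle.ext (mul_right_cancel₀ (theta_one_ne_zero hD.det_left_ne_zero)
      (by simpa using h1.symm))
  · exact ContDiffOn.sum fun j _ => contDiffOn_thetaIntegral (det_ne_zero P) (hm j) _ _
  · exact hypLaplacian_sum_thetaIntegral hm hs hsum t
  · simp only [hint, hv, intervalIntegral.integral_const_mul, Finset.mul_sum]
  · simp only [hint]
    exact Asymptotics.IsBigO.fun_sum fun j _ => hD.isBigO_integral_theta (M j) _ _ σ

end Collection

end

end IndefTheta

theorem mainTheorem4
    (A : Matrix (Fin 2) (Fin 2) ℤ) (hA : A.IsSymm)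
    (hsig : sigPos (IndefTheta.Q A) = 1 ∧ sigNeg (IndefTheta.Q A) = 1)
    (c₀ : Fin 2 → ℝ) (hc₀ : IndefTheta.Q A c₀ = -1)
    (P : GL (Fin 2) ℝ) (hP : IndefTheta.Splits A c₀ P)
    {ι : Type*} [Fintype ι] (m : ι → (Fin 2 → ℤ) → ℂ) (γ : ι → SL(2, ℤ))
    (hm : ∀ j, IndefTheta.IsPeriodic (m j))
    (hsupp : ∀ j ν, m j ν ≠ 0 → IndefTheta.Q A (IndefTheta.toReal ν) ≠ 0)
    (hγ : ∀ j, γ j ∈ IndefTheta.AutPlus A c₀)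
    (hsum : ∑ j, (m j - m j ∘ IndefTheta.actInt (γ j)) = 0) :
    -- the two series that define each `Φ` converge absolutely
    (∀ c ∈ IndefTheta.CQ A c₀, ∀ j, ∀ τ : ℍ,
      Summable (IndefTheta.phiTerm A (m j) c (IndefTheta.actReal (γ j) c) 1 τ) ∧
      Summable (IndefTheta.phiTerm A (m j) (IndefTheta.cPerp P c)
        (IndefTheta.cPerp P (IndefTheta.actReal (γ j) c)) (-1) τ)) ∧
    -- the sum is a Maass form with eigenvalue `1/4`
    (∀ c ∈ IndefTheta.CQ A c₀, ∃ (Γ : Subgroup SL(2, ℤ)) (v : Γ →* Circle),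
      IndefTheta.IsMaassForm Γ v (1 / 4)
        (fun τ => ∑ j, IndefTheta.Phi A P (m j) c (IndefTheta.actReal (γ j) c) τ)) ∧
    -- the sum does not depend on `c`
    (∀ c ∈ IndefTheta.CQ A c₀, ∀ c' ∈ IndefTheta.CQ A c₀, ∀ τ : ℍ,
      ∑ j, IndefTheta.Phi A P (m j) c (IndefTheta.actReal (γ j) c) τ =
        ∑ j, IndefTheta.Phi A P (m j) c' (IndefTheta.actReal (γ j) c') τ) := by
  choose C hC using fun j => (hm j).exists_norm_le
  choose s hs using fun j => IndefTheta.exists_exp_of_mem_AutPlus hA hc₀ hP (hγ j)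
  -- On the hyperbola γ_j is translation of the parameter by s_j, so each Φ becomes an integral from
  -- t to t + s_j with the same t for all j.
  have hcurve : ∀ c ∈ IndefTheta.CQ A c₀, ∀ j, IndefTheta.actReal (γ j) c =
      IndefTheta.cCurve P (IndefTheta.tParam P c + s j) := fun c hc j => by
    rw [← IndefTheta.tParam_actReal hA hc₀ hP (fun v => (hs j v).1) hc,
      IndefTheta.cCurve_tParam hA hc₀ hP (IndefTheta.actReal_mem_CQ (hγ j) hc)]
  have hPhi : ∀ c ∈ IndefTheta.CQ A c₀, ∀ τ,
      ∑ j, IndefTheta.Phi A P (m j) c (IndefTheta.actReal (γ j) c) τ =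
      ∑ j, IndefTheta.thetaIntegral P.1 (m j) (IndefTheta.tParam P c)
        (IndefTheta.tParam P c + s j) τ := fun c hc τ => by
    rw [← hP.sum_Phi_eq hA hC hsupp hγ hs hsum]
    simp only [hcurve c hc, IndefTheta.cCurve_tParam hA hc₀ hP hc]
  refine ⟨fun c hc j τ => ?_, fun c hc => ?_, fun c hc c' hc' τ => ?_⟩
  · have h := hP.summable_phiTerm hA (hC j) (hsupp j) (IndefTheta.tParam P c)
      (IndefTheta.tParam P c + s j) τ
    rw [hcurve c hc, IndefTheta.cPerp, IndefTheta.cPerp, IndefTheta.tParam_cCurve]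
    rwa [IndefTheta.cCurve_tParam hA hc₀ hP hc] at h
  · simp only [hPhi c hc]
    exact hP.isMaassForm hA hm hs hsum _
  · rw [hPhi c hc, hPhi c' hc']
    exact IndefTheta.sum_thetaIntegral_eq hC hs hsum _ _ τ
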